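/- Let $\mathsf{Par}$ be the set of all partitions, identified with their Young diagrams in English notation, and let $\mathsf{Par}_{\mathbb Z}$ be the free $\mathbb Z$-module on $\mathsf{Par}$. The content of the box in row $i$ and column $j$ is $j-i$, its anticontent is $i+j$, and a box of content $q$ is called a $q$-box. If a $q$-box can be added to (removed from) $\lambda$, the resulting partition is written $\lambda\boxplus q$ (resp. $\lambda\boxminus q$). A connected hook is a non-empty edge-connected set of boxes containing no $2\times2$ square. A rim hook of $\lambda$ is a connected hook in $\lambda$ whose removal leaves a partition. A hook is balanced if it meets as many rows as columns; it starts (ends) at $q$ if $q$ is the minimal (maximal) content of its boxes. The rim $q$-box of $\lambda$ is its $q$-box $(i,j)$ with $(i+1,j+1)\notin\lambda$. The algebra $\mathrm{TL}_\infty(0)$ is the unital associative $\mathbb Z$-algebra with generators $T_i$, $i\in\mathbb Z$, and relations $T_i^2=0$, $T_iT_j=T_jT_i$ for $|i-j|>1$, and $T_iT_{i\pm1}T_i=T_i$. For $\lambda\in\mathsf{Par}$ and $q\in\mathbb Z$ exactly one of the following holds: (a) $\lambda$ has an addable $q$-box; (b) $\lambda$ has a removable $q$-box; (c) $\lambda$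 has no box with content in $\{q-1,q,q+1\}$, and $\lambda\neq\varnothing$ if $q=0$; (d) $\lambda$ has a box to the right of its rim $q$-box, but none below it; (e) $\lambda$ has a box below its rim $q$-box, but none to the right of it. Let $\mathsf b^q_{\lambda\mu}=1$ if $\mu=\lambda\boxplus q$ or $\mu=\lambda\boxminus(q-1)$, and $\mathsf b^q_{\lambda\mu}=0$ otherwise. Let $\Gamma_0$ be the set of connected hooks that meet exactly one more column than rows and in which the box of minimal content also has minimal anticontent. For $\mu\subseteq\lambda$, the $k$-th layer ($k\ge0$) of $\lambda/\mu$ consists of those boxes $(i,j)$ of $\lambda/\mu$ with $(i+k,j+k)\in\lambda$ and $(i+k+1,j+k+1)\notin\lambda$. Let $\mathsf c_{\lambda\mu}=1$ if $\mu\subseteq\lambda$ and all connected components of all layers of $\lambda/\mu$ belong to $\Gamma_0$, and $\mathsf c_{\lambda\mu}=0$ otherwise. **Theorem.** 1. There is a unique representation $\Xi:\mathrm{TL}_\infty(0)\to\mathrm{End}_{\mathbb Z}(\mathsf{Par}_{\mathbb Z})$ such that, writing $T_q(\lambda)$ for $\Xi(T_q)(\lambda)$, for all $q\in\mathbb Z$: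 $T_q(\varnothing)=\delta_{q0}\Box$, and $T_q(\lambda)=\lambda\boxplus q$ for every $\lambda\in\mathsf{Par}$ with an addable $q$-box. 2. Every representation with these two properties satisfies: $T_q(\lambda)=0$ if $\lambda$ is of type (b) or (c); if $\lambda$ is of type (d), then $T_q(\lambda)$ is the partition obtained from $\lambda$ by removing the minimal balanced rim hook starting at $q+1$ if such a balanced rim hook exists, and $T_q(\lambda)=0$ otherwise; if $\lambda$ is of type (e), then $T_q(\lambda)$ is the partition obtained from $\lambda$ by removing the minimal balanced rim hook ending at $q-1$ if such a balanced rim hook exists, and $T_q(\lambda)=0$ otherwise. 3. There is a unique representation $\Xi'$ of $\mathrm{TL}_\infty(0)$ on $\mathsf{Par}_{\mathbb Z}$ with $\Xi'(T_q)(\lambda)=\sum_\mu\mathsf b^q_{\lambda\mu}\,\mu$ for all $q$ and $\lambda$ (the Fock space representation). The rule $\lambda\mapsto\sum_\mu\mathsf c_{\lambda\mu}\,\mu$ defines an automorphism $C$ of $\mathsf{Par}_{\mathbb Z}$, and $\Xi(x)=C^{-1}\circ\Xi'(x)\circ C$ for all $x\in\mathrm{TL}_\infty(0)$; that is, $\Xi(T_q)(\nu)=\sum_{\lambda,\mu,\kappa}\mathsf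 c_{\nu\lambda}\mathsf b^q_{\lambda\mu}\mathsf c^{-1}_{\mu\kappa}\,\kappa$. 4. $\Xi$ and $\Xi'$ are faithful. -/

import Mathlib

namespace TLFock

noncomputable section

/-- Partitions are identified with Young diagrams in English notation; `ParZ` is the free
`ℤ`-module on the set of all partitions. Boxes `(i, j)` are indexed from `0`: row `i`, column `j`. -/
abbrev ParZ : Type := YoungDiagram →₀ ℤ

/-- The basis element of `ParZ` given by a partition. -/
abbrev basisVec (l : YoungDiagram) : ParZ := Finsupp.single l 1

/-- The partition of `1`, whose diagram is a single box. -/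
def box : YoungDiagram where
  cells := {(0, 0)}
  isLowerSet := by
    rintro ⟨a, b⟩ ⟨c, d⟩ h h'
    simp only [Finset.coe_singleton, Set.mem_singleton_iff, Prod.mk.injEq] at h' ⊢
    obtain ⟨h1, h2⟩ := Prod.mk_le_mk.mp h
    omega

/-! ### The infinite Temperley–Lieb algebra with parameter zero -/

/-- The defining relations on the generators `T_i`, `i ∈ ℤ`. -/
inductive TLRel : FreeAlgebra ℤ ℤ → FreeAlgebra ℤ ℤ → Prop
  | sq (i : ℤ) : TLRel (FreeAlgebra.ι ℤ i * FreeAlgebra.ι ℤ i) 0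
  | comm (i j : ℤ) (h : 1 < |i - j|) :
      TLRel (FreeAlgebra.ι ℤ i * FreeAlgebra.ι ℤ j) (FreeAlgebra.ι ℤ j * FreeAlgebra.ι ℤ i)
  | up (i : ℤ) :
      TLRel (FreeAlgebra.ι ℤ i * FreeAlgebra.ι ℤ (i + 1) * FreeAlgebra.ι ℤ i) (FreeAlgebra.ι ℤ i)
  | down (i : ℤ) :
      TLRel (FreeAlgebra.ι ℤ i * FreeAlgebra.ι ℤ (i - 1) * FreeAlgebra.ι ℤ i) (FreeAlgebra.ι ℤ i)

/-- The algebra `TL_∞(0)` over `ℤ`. -/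
abbrev TLInf : Type := RingQuot TLRel

/-- The generator `T_q`. -/
def T (q : ℤ) : TLInf := RingQuot.mkAlgHom ℤ TLRel (FreeAlgebra.ι ℤ q)

/-- A representation of `TL_∞(0)` on `ParZ`. -/
abbrev ParRep : Type := TLInf →ₐ[ℤ] Module.End ℤ ParZ

/-! ### Boxes -/

/-- The content (column minus row) of a box. -/
def content (c : ℕ × ℕ) : ℤ := (c.2 : ℤ) - (c.1 : ℤ)

/-- The anticontent (column plus row) of a box. It is shifted by a constant from the one for
indices starting at `1`; only comparisons of anticontents are used. -/
def anticontent (c : ℕ × ℕ) : ℕ := c.1 + c.2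

/-- `m` is obtained from `l` by adding a `q`-box, that is, `m = l ⊞ q` and `l = m ⊟ q`. -/
def AddsBox (q : ℤ) (l m : YoungDiagram) : Prop :=
  ∃ c, content c = q ∧ c ∉ l.cells ∧ m.cells = insert c l.cells

/-- `c` is the `q`-box on the rim of `l`. -/
def IsRimBox (q : ℤ) (l : YoungDiagram) (c : ℕ × ℕ) : Prop :=
  c ∈ l ∧ content c = q ∧ (c.1 + 1, c.2 + 1) ∉ l

/-- The five possible configurations of a partition near content `q`. -/
inductive Config
  | a | b | c | d | e

/-- `l` is of the given type with respect to `q`. -/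
def HasType (q : ℤ) (l : YoungDiagram) : Config → Prop
  | .a => ∃ m, AddsBox q l m
  | .b => ∃ m, AddsBox q m l
  | .c => (∀ x ∈ l, content x ≠ q - 1 ∧ content x ≠ q ∧ content x ≠ q + 1) ∧ (q = 0 → l ≠ ⊥)
  | .d => ∃ x, IsRimBox q l x ∧ (x.1, x.2 + 1) ∈ l ∧ (x.1 + 1, x.2) ∉ l
  | .e => ∃ x, IsRimBox q l x ∧ (x.1 + 1, x.2) ∈ l ∧ (x.1, x.2 + 1) ∉ l

/-! ### Rim hooks -/

/-- Two boxes share an edge. -/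
def CellAdj (x y : ℕ × ℕ) : Prop :=
  (x.1 = y.1 ∧ (x.2 + 1 = y.2 ∨ y.2 + 1 = x.2)) ∨ (x.2 = y.2 ∧ (x.1 + 1 = y.1 ∨ y.1 + 1 = x.1))

/-- A nonempty set of boxes in which any two boxes are joined by a path of adjacent boxes. -/
def IsConn (S : Finset (ℕ × ℕ)) : Prop :=
  S.Nonempty ∧ ∀ x ∈ S, ∀ y ∈ S, Relation.ReflTransGen (fun u v => v ∈ S ∧ CellAdj u v) x y

/-- A connected hook: a connected set of boxes that contains no `2 × 2` square. -/
def IsConnHook (S : Finset (ℕ × ℕ)) : Prop :=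
  IsConn S ∧ ∀ i j, ¬ ((i, j) ∈ S ∧ (i + 1, j) ∈ S ∧ (i, j + 1) ∈ S ∧ (i + 1, j + 1) ∈ S)

/-- `H` is a rim hook of `l`: a connected hook in `l` whose removal leaves a partition. -/
def IsRimHook (l : YoungDiagram) (H : Finset (ℕ × ℕ)) : Prop :=
  IsConnHook H ∧ H ⊆ l.cells ∧ ∃ m : YoungDiagram, m.cells = l.cells \ H

/-- The number of rows in which `H` has boxes. -/
def height (H : Finset (ℕ × ℕ)) : ℕ := (H.image Prod.fst).card

/-- The number of columns in which `H` has boxes. -/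
def width (H : Finset (ℕ × ℕ)) : ℕ := (H.image Prod.snd).card

/-- The minimal content of the boxes of `H` is `q`. -/
def StartsAt (q : ℤ) (H : Finset (ℕ × ℕ)) : Prop :=
  (∃ x ∈ H, content x = q) ∧ ∀ x ∈ H, q ≤ content x

/-- The maximal content of the boxes of `H` is `q`. -/
def EndsAt (q : ℤ) (H : Finset (ℕ × ℕ)) : Prop :=
  (∃ x ∈ H, content x = q) ∧ ∀ x ∈ H, content x ≤ q

/-- `H` is a balanced rim hook of `l` starting at `q`. -/
def BalancedFrom (q : ℤ) (l : YoungDiagram) (H : Finset (ℕ × ℕ)) : Prop :=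
  IsRimHook l H ∧ height H = width H ∧ StartsAt q H

/-- `H` is a balanced rim hook of `l` ending at `q`. -/
def BalancedTo (q : ℤ) (l : YoungDiagram) (H : Finset (ℕ × ℕ)) : Prop :=
  IsRimHook l H ∧ height H = width H ∧ EndsAt q H

/-- `v` is the partition obtained from `l` by removing the minimal set of boxes with property `P`,
if there is one, and otherwise `v = 0`. -/
def RemovesMinimal (P : Finset (ℕ × ℕ) → Prop) (l : YoungDiagram) (v : ParZ) : Prop :=
  (∃ H, Minimal P H ∧ (∀ H', Minimal P H' → H' = H) ∧
    ∃ m : YoungDiagram, m.cells = l.cells \ H ∧ v = basisVec m) ∨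
  ((¬ ∃ H, P H) ∧ v = 0)

/-! ### Properties of representations -/

/-- `T_q(∅) = δ_{q0} □`, and `T_q(l) = l ⊞ q` whenever `l` has an addable `q`-box. -/
def IsBoxAdding (R : ParRep) : Prop :=
  (∀ q : ℤ, R (T q) (basisVec ⊥) = if q = 0 then basisVec box else 0) ∧
  (∀ (q : ℤ) (l m : YoungDiagram), AddsBox q l m → R (T q) (basisVec l) = basisVec m)

/-- The values of `T_q` on partitions without addable `q`-box. -/
def HasRimHookValues (R : ParRep) : Prop :=
  ∀ (q : ℤ) (l : YoungDiagram),
    ((HasType q l .b ∨ HasType q l .c) → R (T q) (basisVec l) = 0) ∧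
    (HasType q l .d → RemovesMinimal (BalancedFrom (q + 1) l) l (R (T q) (basisVec l))) ∧
    (HasType q l .e → RemovesMinimal (BalancedTo (q - 1) l) l (R (T q) (basisVec l)))

open scoped Classical in
/-- The matrix `b^q`: the entry at `(l, m)` is `1` if `m = l ⊞ q` or `m = l ⊟ (q - 1)`. -/
def bMat (q : ℤ) (l m : YoungDiagram) : ℤ :=
  if AddsBox q l m ∨ AddsBox (q - 1) m l then 1 else 0

/-- `R` is the Fock space representation, `T_q(l) = ∑_m b^q_{l m} m`. -/
def IsFock (R : ParRep) : Prop :=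
  ∀ (q : ℤ) (l m : YoungDiagram), R (T q) (basisVec l) m = bMat q l m

/-! ### The matrix `c` -/

/-- The set `Γ₀` of connected hooks that are one box wider than high and in which the box of
minimal content has minimal anticontent. -/
def IsGammaZero (S : Finset (ℕ × ℕ)) : Prop :=
  IsConnHook S ∧ width S = height S + 1 ∧
    ∃ x ∈ S, ∀ y ∈ S, content x ≤ content y ∧ anticontent x ≤ anticontent y

/-- The `k`-th layer of the skew diagram `l / m`: its boxes at diagonal distance `k` from the rim
of `l`. The layers are the parts of the skew diagram on the successive rims of `l`. -/
def layer (l m : YoungDiagram) (k : ℕ) : Finset (ℕ × ℕ) :=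
  (l.cells \ m.cells).filter fun x => (x.1 + k, x.2 + k) ∈ l ∧ (x.1 + k + 1, x.2 + k + 1) ∉ l

/-- `S` is a connected component of the set of boxes `L`. -/
def IsComponent (S L : Finset (ℕ × ℕ)) : Prop :=
  S ⊆ L ∧ IsConn S ∧ ∀ x ∈ S, ∀ y ∈ L, CellAdj x y → y ∈ S

/-- The skew diagram `l / m` is in `Γ`: all connected components of its layers are in `Γ₀`. -/
def IsGamma (l m : YoungDiagram) : Prop :=
  m ≤ l ∧ ∀ (k : ℕ) (S : Finset (ℕ × ℕ)), IsComponent S (layer l m k) → IsGammaZero S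

open scoped Classical in
/-- The matrix `c`: the entry at `(l, m)` is `1` if `m ⊆ l` and `l / m ∈ Γ`, and `0` otherwise. -/
def cMat (l m : YoungDiagram) : ℤ := if IsGamma l m then 1 else 0

end

end TLFock

open TLFock

/-! A partition is encoded by its profile `prof`, the boundary of its diagram in Russian notation: a
path on ℤ with steps ±1 that stays at or above |q| and agrees with |q| far out. Adding a `q`-box
turns a valley at `q` into a peak, the five types are the possible shapes near `q`, and the minimal
balanced rim hooks are arcs of the path between consecutive visits to one height.

Fock space. Put a bead at each descent of the profile. Then T_q moves the bead at q to q+1 (a q-box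
is added) or to q-1 (a (q-1)-box is removed). On arbitrary bead configurations this operator is
built from creation and annihilation operators that commute at distinct sites, and the
Temperley–Lieb relations follow from their algebra (`hopOp_mul_hopOp_mul_hopOp`). They pass to Fock
space through the injection `beadMap`.

Faithfulness. Every monomial is zero or comes from a word whose letters can all be executed as moves
of beads to the right (`mono_eq_zero_or_runs`). Such a word is an order of adding boxes that leads
from some l to some m. The endpoints determine the monomial (`AddsPath.mono_eq`), and among words of
at most |m| - |l| letters exactly those leading from l to m have matrix entry 1 at (l, m), the
others 0 (`fockRep_mono_apply`). Hence in a linear relation the longest words cancel among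
themselves.

Rigidity. Box adding forces all other values. If the profile of l rises through q, let p be the
nearest peak to the right and l = k ⊞ p. Then T_q l = T_q T_p k, and either T_q commutes with T_p or
p = q+1 and T_q T_{q+1} T_q = T_q applies; one inducts on the size (`AddsBoxes.apply_of_rise`).
Falling profiles follow by transposition.

Existence. The matrix c is unitriangular for inclusion, hence invertible, and it remains to see that
the Fock operator of T_q maps the row of l to the row of l ⊞ q (`fockOp_cRow`). The components of
the layers of l/m are the excursions of half the difference of the two profiles, and membership in
Γ₀ says that the profile of l returns along the excursion to its initial height without going below
it (`isGamma_iff`). The identity of rows thus becomes a comparison of excursions before and after a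
change near q. Rigidity shows that the conjugated Fock representation is the only box-adding one,
and conjugation preserves faithfulness. -/

namespace TLFock

/-! ### The profile of a partition -/

/-- The `n`-th box on the diagonal of content `q`. -/
def diagBox (q : ℤ) (n : ℕ) : ℕ × ℕ := (n + (-q).toNat, n + q.toNat)

theorem eq_diagBox (c : ℕ × ℕ) : c = diagBox (content c) (min c.1 c.2) := by
  obtain ⟨i, j⟩ := c
  simp only [diagBox, content, Prod.mk.injEq]
  omega

theorem content_diagBox (q : ℤ) (n : ℕ) : content (diagBox q n) = q := by
  simp only [diagBox, content]
  omega

theorem diagBox_injective (q : ℤ) : Function.Injective (diagBox q) := by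
  intro a b h
  simp only [diagBox, Prod.mk.injEq] at h
  omega

theorem add_le_sup_of_mem {l : YoungDiagram} {c : ℕ × ℕ} (h : c ∈ l) :
    c.1 + c.2 ≤ l.cells.sup fun c => c.1 + c.2 :=
  Finset.le_sup (f := fun c : ℕ × ℕ => c.1 + c.2) ((YoungDiagram.mem_cells c).mpr h)

theorem exists_diagBox_notMem (l : YoungDiagram) (q : ℤ) : ∃ n, diagBox q n ∉ l := by
  refine ⟨(l.cells.sup fun c => c.1 + c.2) + 1, fun h => ?_⟩
  have := add_le_sup_of_mem h
  simp only [diagBox] at this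
  omega

/-- The number of boxes of content `q`. -/
def diagLen (l : YoungDiagram) (q : ℤ) : ℕ := Nat.find (exists_diagBox_notMem l q)

theorem diagBox_mem_iff {l : YoungDiagram} {q : ℤ} {n : ℕ} :
    diagBox q n ∈ l ↔ n < diagLen l q := by
  rw [diagLen, Nat.lt_find_iff]
  refine ⟨fun h m hm => ?_, fun h => not_not.mp (h n le_rfl)⟩
  exact not_not.mpr (l.up_left_mem (by omega) (by omega) h)

theorem mem_iff_diagLen {l : YoungDiagram} {c : ℕ × ℕ} :
    c ∈ l ↔ min c.1 c.2 < diagLen l (content c) := by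
  rw [← diagBox_mem_iff, ← eq_diagBox]

theorem eq_of_forall_lt_iff {a b : ℕ} (h : ∀ n, n < a ↔ n < b) : a = b := by
  have h1 := h a
  have h2 := h b
  omega

theorem diagLen_succ_of_nonneg (l : YoungDiagram) {q : ℤ} (hq : 0 ≤ q) :
    diagLen l (q + 1) ≤ diagLen l q ∧ diagLen l q ≤ diagLen l (q + 1) + 1 := by
  constructor
  · by_contra! h
    have h1 := diagBox_mem_iff.mpr h
    have h2 : diagBox q (diagLen l q) ∈ l :=
      l.up_left_mem (by omega) (by omega) h1
    exact lt_irrefl _ (diagBox_mem_iff.mp h2)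
  · by_contra! h
    have h1 := diagBox_mem_iff.mpr h
    have h2 : diagBox (q + 1) (diagLen l (q + 1)) ∈ l :=
      l.up_left_mem (by omega) (by omega) h1
    exact lt_irrefl _ (diagBox_mem_iff.mp h2)

theorem diagLen_succ_of_neg (l : YoungDiagram) {q : ℤ} (hq : q < 0) :
    diagLen l q ≤ diagLen l (q + 1) ∧ diagLen l (q + 1) ≤ diagLen l q + 1 := by
  constructor
  · by_contra! h
    have h1 := diagBox_mem_iff.mpr h
    have h2 : diagBox (q + 1) (diagLen l (q + 1)) ∈ l :=
      l.up_left_mem (by omega) (by omega) h1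
    exact lt_irrefl _ (diagBox_mem_iff.mp h2)
  · by_contra! h
    have h1 := diagBox_mem_iff.mpr h
    have h2 : diagBox q (diagLen l q) ∈ l :=
      l.up_left_mem (by omega) (by omega) h1
    exact lt_irrefl _ (diagBox_mem_iff.mp h2)

/-- The profile of a partition: the boundary of its diagram in Russian notation, as a function of
the content. -/
def prof (l : YoungDiagram) (q : ℤ) : ℤ := (q.natAbs : ℤ) + 2 * diagLen l q

theorem natAbs_le_prof (l : YoungDiagram) (q : ℤ) : (q.natAbs : ℤ) ≤ prof l q := by
  simp [prof]

theorem prof_emod (l : YoungDiagram) (q : ℤ) : (prof l q - q) % 2 = 0 := by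
  unfold prof
  omega

theorem prof_step (l : YoungDiagram) (q : ℤ) :
    prof l (q + 1) = prof l q + 1 ∨ prof l (q + 1) = prof l q - 1 := by
  unfold prof
  rcases le_or_gt 0 q with h | h
  · have := diagLen_succ_of_nonneg l h
    omega
  · have := diagLen_succ_of_neg l h
    omega

theorem prof_step' (l : YoungDiagram) (q : ℤ) :
    prof l q = prof l (q - 1) + 1 ∨ prof l q = prof l (q - 1) - 1 := by
  simpa using prof_step l (q - 1)

theorem mem_iff_prof {l : YoungDiagram} {c : ℕ × ℕ} :
    c ∈ l ↔ (anticontent c : ℤ) < prof l (content c) := by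
  rw [mem_iff_diagLen]
  unfold prof
  generalize diagLen l (content c) = n
  simp only [anticontent, content]
  omega

theorem exists_prof_eq_natAbs (l : YoungDiagram) : ∃ N : ℤ, 0 ≤ N ∧ ∀ q, N ≤ (q.natAbs : ℤ) → prof l q = (q.natAbs : ℤ) := by
  refine ⟨(l.cells.sup fun c => c.1 + c.2) + 1, by positivity, fun q hq => ?_⟩
  have : ¬ 0 < diagLen l q := fun h => by
    have h1 := add_le_sup_of_mem (diagBox_mem_iff.mpr h)
    simp only [diagBox] at h1
    omega
  unfold prof
  omega

theorem prof_le_iff {l m : YoungDiagram} : l ≤ m ↔ ∀ q, prof l q ≤ prof m q := by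
  constructor
  · intro h q
    by_contra! h'
    have h1 : diagLen m q < diagLen l q := by unfold prof at h'; omega
    have h2 : diagBox q (diagLen m q) ∈ m := h (diagBox_mem_iff.mpr h1)
    exact lt_irrefl _ (diagBox_mem_iff.mp h2)
  · intro h c hc
    have h1 : c ∈ l := hc
    have h2 : c ∈ m := mem_iff_prof.mpr ((mem_iff_prof.mp h1).trans_le (h _))
    exact h2

theorem prof_injective : Function.Injective prof := by
  intro l m h
  exact le_antisymm (prof_le_iff.mpr fun q => (congrFun h q).le)
    (prof_le_iff.mpr fun q => (congrFun h q).ge)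

theorem prof_bot (q : ℤ) : prof ⊥ q = (q.natAbs : ℤ) := by
  have : ¬ 0 < diagLen ⊥ q := fun h => YoungDiagram.notMem_bot _ (diagBox_mem_iff.mpr h)
  unfold prof
  omega

/-- Every function with the properties of a profile is one. -/
theorem exists_prof_eq (g : ℤ → ℤ) (h0 : ∀ q, (q.natAbs : ℤ) ≤ g q) (hp : ∀ q, (g q - q) % 2 = 0)
    (hs : ∀ q, g (q + 1) ≤ g q + 1 ∧ g q ≤ g (q + 1) + 1)
    (hN : ∃ N : ℤ, ∀ q, N ≤ (q.natAbs : ℤ) → g q = (q.natAbs : ℤ)) : ∃ l, prof l = g := by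
  obtain ⟨N, hN⟩ := hN
  have hfin : {c : ℕ × ℕ | (anticontent c : ℤ) < g (content c)}.Finite := by
    refine ((Set.finite_Icc (-N) N).biUnion (t := fun q => diagBox q '' Set.Iio (g q).toNat)
      fun q _ => (Set.finite_Iio _).image _).subset ?_
    intro c hc
    simp only [Set.mem_ofPred_eq] at hc
    simp only [Set.mem_iUnion, Set.mem_image, Set.mem_Iio, exists_prop]
    refine ⟨content c, ?_, min c.1 c.2, ?_, (eq_diagBox c).symm⟩
    · by_contra h
      have h1 : N ≤ ((content c).natAbs : ℤ) := by
        simp only [Set.mem_Icc, not_and_or] at h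
        omega
      rw [hN _ h1] at hc
      simp only [anticontent, content] at hc
      omega
    · simp only [anticontent, content] at *
      omega
  have hstep1 : ∀ i j : ℕ, (anticontent (i + 1, j) : ℤ) < g (content (i + 1, j)) →
      (anticontent (i, j) : ℤ) < g (content (i, j)) := by
    intro i j h
    have h1 := (hs (content (i + 1, j))).1
    have h2 : content (i + 1, j) + 1 = content (i, j) := by
      simp only [content]; push_cast; ring
    have h3 := (hs (content (i + 1, j))).2
    rw [h2] at h3
    simp only [anticontent] at h ⊢
    push_cast at h ⊢
    omega
  have hstep2 : ∀ i j : ℕ, (anticontent (i, j + 1) : ℤ) < g (content (i, j + 1)) →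
      (anticontent (i, j) : ℤ) < g (content (i, j)) := by
    intro i j h
    have h2 : content (i, j) + 1 = content (i, j + 1) := by simp only [content]; push_cast; ring
    have h3 := (hs (content (i, j))).1
    rw [h2] at h3
    simp only [anticontent] at h ⊢
    push_cast at h ⊢
    omega
  have hlow : IsLowerSet {c : ℕ × ℕ | (anticontent c : ℤ) < g (content c)} := by
    rintro ⟨a, b⟩ ⟨c, d⟩ h h'
    obtain ⟨h1, h2⟩ := Prod.mk_le_mk.mp h
    have key : (anticontent (c, b) : ℤ) < g (content (c, b)) := by
      clear h h2
      induction a, h1 using Nat.le_induction with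
      | base => exact h'
      | succ n _ ih => exact ih (hstep1 _ _ h')
    clear h h' h1
    simp only [Set.mem_ofPred_eq]
    induction b, h2 using Nat.le_induction with
    | base => exact key
    | succ n _ ih => exact ih (hstep2 _ _ key)
  refine ⟨⟨hfin.toFinset, by simpa using hlow⟩, funext fun q => ?_⟩
  set l : YoungDiagram := ⟨hfin.toFinset, by simpa using hlow⟩ with hl
  have hmem : ∀ n, diagBox q n ∈ l ↔ (anticontent (diagBox q n) : ℤ) < g q := by
    intro n
    rw [hl, YoungDiagram.mem_mk, Set.Finite.mem_toFinset, Set.mem_ofPred_eq, content_diagBox]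
  have hd : diagLen l q = ((g q - (q.natAbs : ℤ)) / 2).toNat := by
    refine eq_of_forall_lt_iff fun n => ?_
    rw [← diagBox_mem_iff, hmem]
    have := h0 q
    have := hp q
    simp only [anticontent, diagBox]
    omega
  have := h0 q
  have := hp q
  unfold prof
  omega

/-! ### Adding boxes -/

/-- The boxes of one content in a diagram form an initial segment of their diagonal, so a new one
lengthens this segment by one. From here on adding boxes is arithmetic of profiles. -/
theorem addsBox_iff {q : ℤ} {l m : YoungDiagram} :
    AddsBox q l m ↔ ∀ p, prof m p = prof l p + if p = q then 2 else 0 := by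
  constructor
  · rintro ⟨c, hc, hcl, hm⟩ p
    have hmem : ∀ n, n < diagLen m p ↔ (diagBox p n = c ∨ n < diagLen l p) := fun n => by
      rw [← diagBox_mem_iff, ← diagBox_mem_iff, ← YoungDiagram.mem_cells, hm, Finset.mem_insert,
        YoungDiagram.mem_cells]
    split_ifs with h
    · subst h
      rw [eq_diagBox c, hc] at hmem
      have h1 := mt mem_iff_diagLen.mpr hcl
      rw [hc] at h1
      have h2 : ∀ n, n < diagLen m p ↔ (n = min c.1 c.2 ∨ n < diagLen l p) := fun n => by
        rw [hmem, (diagBox_injective p).eq_iff]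
      have h3 := (h2 (min c.1 c.2)).mpr (Or.inl rfl)
      have h4 := h2 (diagLen l p)
      have h5 := h2 (diagLen l p + 1)
      unfold prof
      omega
    · have : diagLen m p = diagLen l p := eq_of_forall_lt_iff fun n => by
        rw [hmem]
        refine or_iff_right fun h' => h ?_
        rw [← hc, ← h', content_diagBox]
      simp [prof, this]
  · intro h
    have hd : diagLen m q = diagLen l q + 1 := by
      have := h q
      simp only [prof, if_true] at this
      omega
    refine ⟨diagBox q (diagLen l q), content_diagBox _ _, ?_, ?_⟩
    · rw [YoungDiagram.mem_cells, diagBox_mem_iff]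
      exact lt_irrefl _
    · ext c
      rw [Finset.mem_insert, YoungDiagram.mem_cells, YoungDiagram.mem_cells, mem_iff_diagLen,
        mem_iff_diagLen]
      by_cases hc : content c = q
      · rw [hc, hd]
        have : c = diagBox q (diagLen l q) ↔ min c.1 c.2 = diagLen l q := by
          conv_lhs => rw [eq_diagBox c, hc]
          exact (diagBox_injective q).eq_iff
        rw [this]
        omega
      · have h1 := h (content c)
        simp only [prof, hc, if_false] at h1
        have h2 : diagLen m (content c) = diagLen l (content c) := by omega
        rw [h2]
        refine (or_iff_right fun h' => hc ?_).symm
        rw [h', content_diagBox]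

theorem AddsBox.prof_self {q : ℤ} {l m : YoungDiagram} (h : AddsBox q l m) :
    prof m q = prof l q + 2 := by
  simpa using addsBox_iff.mp h q

theorem AddsBox.prof_of_ne {q p : ℤ} {l m : YoungDiagram} (h : AddsBox q l m) (hp : p ≠ q) :
    prof m p = prof l p := by
  simpa [hp] using addsBox_iff.mp h p

theorem AddsBox.card {q : ℤ} {l m : YoungDiagram} (h : AddsBox q l m) : m.card = l.card + 1 := by
  obtain ⟨c, -, hc, hm⟩ := h
  rw [YoungDiagram.card, hm, Finset.card_insert_of_notMem hc]

theorem AddsBox.right_unique {q : ℤ} {l m m' : YoungDiagram} (h : AddsBox q l m)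
    (h' : AddsBox q l m') : m = m' :=
  prof_injective (funext fun p => by rw [addsBox_iff.mp h, addsBox_iff.mp h'])

theorem AddsBox.left_unique {q : ℤ} {l l' m : YoungDiagram} (h : AddsBox q l m)
    (h' : AddsBox q l' m) : l = l' :=
  prof_injective (funext fun p => by
    have h1 := addsBox_iff.mp h p
    have h2 := addsBox_iff.mp h' p
    omega)

theorem AddsBox.le {q : ℤ} {l m : YoungDiagram} (h : AddsBox q l m) : l ≤ m :=
  prof_le_iff.mpr fun p => by
    have := addsBox_iff.mp h p
    split_ifs at this <;> omega

/-- A partition with profile obtained from that of `l` by subtracting twice a function. -/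
theorem exists_prof_eq_sub (l : YoungDiagram) (f : ℤ → ℤ)
    (h0 : ∀ q, (q.natAbs : ℤ) ≤ prof l q - 2 * f q)
    (hs : ∀ q, prof l (q + 1) - 2 * f (q + 1) ≤ prof l q - 2 * f q + 1 ∧
      prof l q - 2 * f q ≤ prof l (q + 1) - 2 * f (q + 1) + 1)
    (hN : ∃ N : ℤ, ∀ q, N ≤ (q.natAbs : ℤ) → f q = 0) : ∃ m, ∀ q, prof m q = prof l q - 2 * f q := by
  obtain ⟨N, hN⟩ := hN
  obtain ⟨N', -, hN'⟩ := exists_prof_eq_natAbs l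
  obtain ⟨m, hm⟩ := exists_prof_eq (fun q => prof l q - 2 * f q) h0
    (fun q => by have := prof_emod l q; omega) hs
    ⟨max N N', fun q hq => by
      simp only [hN q ((le_max_left _ _).trans hq), hN' q ((le_max_right _ _).trans hq)]
      ring⟩
  exact ⟨m, fun q => congrFun hm q⟩

/-- Raising a single value by two keeps all steps equal to ±1 exactly at a valley. -/
theorem exists_addsBox_iff {q : ℤ} {l : YoungDiagram} :
    (∃ m, AddsBox q l m) ↔ prof l (q - 1) = prof l q + 1 ∧ prof l (q + 1) = prof l q + 1 := by
  constructor
  · rintro ⟨m, h⟩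
    have h1 := h.prof_self
    have h2 := h.prof_of_ne (p := q - 1) (by omega)
    have h3 := h.prof_of_ne (p := q + 1) (by omega)
    have h4 := prof_step l q
    have h5 := prof_step m q
    have h6 := prof_step' l q
    have h7 := prof_step' m q
    omega
  · rintro ⟨h1, h2⟩
    obtain ⟨m, hm⟩ := exists_prof_eq_sub l (fun p => if p = q then -1 else 0)
      (fun p => by have := natAbs_le_prof l p; split_ifs <;> omega)
      (fun p => by
        have := prof_step l p
        rcases eq_or_ne p q with rfl | hp
        · simp only [if_true, add_eq_left, one_ne_zero, if_false]; omega
        · rcases eq_or_ne (p + 1) q with rfl | hp'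
          · rw [if_pos rfl, if_neg hp]
            rw [add_sub_cancel_right] at h1
            omega
          · rw [if_neg hp, if_neg hp']; omega)
      ⟨(q.natAbs : ℤ) + 1, fun p hp => if_neg (by rintro rfl; omega)⟩
    refine ⟨m, addsBox_iff.mpr fun p => ?_⟩
    rw [hm]
    split_ifs <;> omega

theorem exists_addsBox_iff' {q : ℤ} {m : YoungDiagram} :
    (∃ l, AddsBox q l m) ↔ prof m (q - 1) = prof m q - 1 ∧ prof m (q + 1) = prof m q - 1 := by
  constructor
  · rintro ⟨l, h⟩
    have h1 := h.prof_self
    have h2 := h.prof_of_ne (p := q - 1) (by omega)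
    have h3 := h.prof_of_ne (p := q + 1) (by omega)
    have h4 := prof_step l q
    have h5 := prof_step m q
    have h6 := prof_step' l q
    have h7 := prof_step' m q
    omega
  · rintro ⟨h1, h2⟩
    obtain ⟨l, hl⟩ := exists_prof_eq_sub m (fun p => if p = q then 1 else 0)
      (fun p => by
        have := natAbs_le_prof m p
        -- One of q+1 and q-1 has absolute value |q|+1, so the bound at that neighbour leaves room
        -- to lower the peak by two.
        have h3 := natAbs_le_prof m (q + 1)
        have h4 := natAbs_le_prof m (q - 1)
        have h5 := prof_emod m q
        split_ifs with h
        · subst h; omega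
        · omega)
      (fun p => by
        have := prof_step m p
        rcases eq_or_ne p q with rfl | hp
        · simp only [if_true, add_eq_left, one_ne_zero, if_false]; omega
        · rcases eq_or_ne (p + 1) q with rfl | hp'
          · rw [if_pos rfl, if_neg hp]
            rw [add_sub_cancel_right] at h1
            omega
          · rw [if_neg hp, if_neg hp']; omega)
      ⟨(q.natAbs : ℤ) + 1, fun p hp => if_neg (by rintro rfl; omega)⟩
    refine ⟨l, addsBox_iff.mpr fun p => ?_⟩
    rw [hl]
    split_ifs <;> omega

theorem addsBox_bot_box : AddsBox 0 ⊥ box :=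
  ⟨(0, 0), rfl, by simp, rfl⟩

/-- A box of `l` outside `k` with maximal coordinate sum is a corner of `l`. -/
theorem exists_addsBox_of_lt {k l : YoungDiagram} (hk : k ≤ l) (h : k ≠ l) :
    ∃ p m, AddsBox p m l ∧ k ≤ m := by
  have hne : (l.cells \ k.cells).Nonempty := by
    rw [Finset.sdiff_nonempty]
    exact fun h' => h (le_antisymm hk h')
  obtain ⟨c, hc, hmax⟩ := (l.cells \ k.cells).exists_max_image (fun c => c.1 + c.2) hne
  rw [Finset.mem_sdiff] at hc
  refine ⟨content c, ⟨l.cells.erase c, ?_⟩, ⟨c, rfl, ?_, ?_⟩, ?_⟩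
  · intro a b hba ha
    simp only [Finset.coe_erase, Set.mem_sdiff, Set.mem_singleton_iff] at ha ⊢
    refine ⟨l.isLowerSet hba ha.1, ?_⟩
    rintro rfl
    obtain ⟨h1, h2⟩ := Prod.le_def.mp hba
    have := hmax a (Finset.mem_sdiff.mpr ⟨ha.1, fun h' => hc.2 (k.isLowerSet hba h')⟩)
    exact ha.2 (Prod.ext (by omega) (by omega))
  · simp
  · simp [Finset.insert_erase hc.1]
  · exact fun x hx => Finset.mem_erase.mpr ⟨by rintro rfl; exact hc.2 hx, hk hx⟩

/-! ### The five types -/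

theorem isRimBox_iff {q : ℤ} {l : YoungDiagram} {c : ℕ × ℕ} :
    IsRimBox q l c ↔ content c = q ∧ (anticontent c : ℤ) = prof l q - 2 := by
  unfold IsRimBox
  rw [mem_iff_prof, mem_iff_prof]
  have h1 : content (c.1 + 1, c.2 + 1) = content c := by simp [content]
  have h2 : (anticontent (c.1 + 1, c.2 + 1) : ℤ) = anticontent c + 2 := by
    simp only [anticontent]; push_cast; ring
  rw [h1, h2]
  constructor
  · rintro ⟨h3, rfl, h4⟩
    have h5 := prof_emod l (content c)
    have h6 : ((anticontent c : ℤ) - content c) % 2 = 0 := by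
      simp only [anticontent, content]; omega
    exact ⟨rfl, by omega⟩
  · rintro ⟨rfl, h3⟩
    omega

theorem exists_box {q a : ℤ} (h : (q.natAbs : ℤ) ≤ a) (h2 : (a - q) % 2 = 0) :
    ∃ c : ℕ × ℕ, content c = q ∧ (anticontent c : ℤ) = a :=
  ⟨(((a - q) / 2).toNat, ((a + q) / 2).toNat), by simp only [content]; omega,
    by simp only [anticontent]; omega⟩

theorem right_mem_iff {l : YoungDiagram} {q : ℤ} {c : ℕ × ℕ} (hc : IsRimBox q l c) :
    (c.1, c.2 + 1) ∈ l ↔ prof l (q + 1) = prof l q + 1 := by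
  obtain ⟨h1, h2⟩ := isRimBox_iff.mp hc
  have h3 : content (c.1, c.2 + 1) = q + 1 := by simp only [content] at *; omega
  have h4 := prof_step l q
  rw [mem_iff_prof, h3]
  simp only [anticontent] at *
  omega

theorem below_mem_iff {l : YoungDiagram} {q : ℤ} {c : ℕ × ℕ} (hc : IsRimBox q l c) :
    (c.1 + 1, c.2) ∈ l ↔ prof l (q - 1) = prof l q + 1 := by
  obtain ⟨h1, h2⟩ := isRimBox_iff.mp hc
  have h3 : content (c.1 + 1, c.2) = q - 1 := by simp only [content] at *; omega
  have h4 := prof_step' l q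
  rw [mem_iff_prof, h3]
  simp only [anticontent] at *
  omega

theorem exists_isRimBox_iff {l : YoungDiagram} {q : ℤ} : (∃ c, IsRimBox q l c) ↔ (q.natAbs : ℤ) < prof l q := by
  simp only [isRimBox_iff]
  constructor
  · rintro ⟨c, h1, h2⟩
    simp only [anticontent, content] at *
    omega
  · intro h
    have := prof_emod l q
    exact exists_box (by omega) (by omega)

theorem hasType_d_iff {q : ℤ} {l : YoungDiagram} : HasType q l .d ↔
    (q.natAbs : ℤ) < prof l q ∧ prof l (q + 1) = prof l q + 1 ∧ prof l (q - 1) = prof l q - 1 := by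
  rw [← exists_isRimBox_iff]
  have h4 := prof_step' l q
  constructor
  · rintro ⟨c, h1, h2, h3⟩
    rw [right_mem_iff h1] at h2
    rw [below_mem_iff h1] at h3
    exact ⟨⟨c, h1⟩, h2, by omega⟩
  · rintro ⟨⟨c, h1⟩, h2, h3⟩
    refine ⟨c, h1, (right_mem_iff h1).mpr h2, ?_⟩
    rw [below_mem_iff h1]
    omega

theorem hasType_e_iff {q : ℤ} {l : YoungDiagram} : HasType q l .e ↔
    (q.natAbs : ℤ) < prof l q ∧ prof l (q + 1) = prof l q - 1 ∧ prof l (q - 1) = prof l q + 1 := by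
  rw [← exists_isRimBox_iff]
  have h4 := prof_step l q
  constructor
  · rintro ⟨c, h1, h2, h3⟩
    rw [below_mem_iff h1] at h2
    rw [right_mem_iff h1] at h3
    exact ⟨⟨c, h1⟩, by omega, h2⟩
  · rintro ⟨⟨c, h1⟩, h2, h3⟩
    refine ⟨c, h1, (below_mem_iff h1).mpr h3, ?_⟩
    rw [right_mem_iff h1]
    omega

theorem forall_content_ne_iff {q : ℤ} {l : YoungDiagram} :
    (∀ x ∈ l, content x ≠ q) ↔ prof l q = (q.natAbs : ℤ) := by
  constructor
  · intro h
    by_contra h'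
    obtain ⟨c, hc⟩ := exists_isRimBox_iff.mpr ((natAbs_le_prof l q).lt_of_ne (Ne.symm h'))
    exact h c hc.1 hc.2.1
  · rintro h x hx rfl
    rw [mem_iff_prof, h] at hx
    simp only [anticontent, content] at hx
    omega

/-- To the right of 0 the lower bound |c| rises as fast as a profile can, so a profile that touches
it stays on it. -/
theorem prof_eq_natAbs_of_le {l : YoungDiagram} {q c : ℤ} (h : prof l q = (q.natAbs : ℤ)) (hq : 0 ≤ q)
    (hc : q ≤ c) : prof l c = (c.natAbs : ℤ) := by
  induction c, hc using Int.leInduction with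
  | base => exact h
  | succ n hn ih =>
    have := prof_step l n
    have := natAbs_le_prof l (n + 1)
    omega

theorem prof_eq_natAbs_of_ge {l : YoungDiagram} {q c : ℤ} (h : prof l q = (q.natAbs : ℤ)) (hq : q ≤ 0)
    (hc : c ≤ q) : prof l c = (c.natAbs : ℤ) := by
  induction c, hc using Int.leInductionDown with
  | base => exact h
  | pred n hn ih =>
    have := prof_step' l n
    have := natAbs_le_prof l (n - 1)
    omega

theorem eq_bot_of_prof_zero {l : YoungDiagram} (h : prof l 0 = 0) : l = ⊥ :=
  prof_injective (funext fun c => by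
    rw [prof_bot]
    rcases le_total 0 c with hc | hc
    · exact prof_eq_natAbs_of_le (by simpa using h) le_rfl hc
    · exact prof_eq_natAbs_of_ge (by simpa using h) le_rfl hc)

theorem hasType_c_iff {q : ℤ} {l : YoungDiagram} : HasType q l .c ↔
    q ≠ 0 ∧ prof l (q - 1) = ((q - 1).natAbs : ℤ) ∧ prof l q = (q.natAbs : ℤ) ∧ prof l (q + 1) = ((q + 1).natAbs : ℤ) := by
  have : HasType q l .c ↔ ((∀ x ∈ l, content x ≠ q - 1) ∧ (∀ x ∈ l, content x ≠ q) ∧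
      (∀ x ∈ l, content x ≠ q + 1)) ∧ (q = 0 → l ≠ ⊥) :=
    and_congr (by simp only [← forall_and]) Iff.rfl
  rw [this]
  simp only [forall_content_ne_iff]
  constructor
  · rintro ⟨h, h'⟩
    refine ⟨?_, h⟩
    rintro rfl
    exact h' rfl (eq_bot_of_prof_zero (by simpa using h.2.1))
  · rintro ⟨h, h'⟩
    exact ⟨h', fun h0 => absurd h0 h⟩

theorem existsUnique_hasType (q : ℤ) (l : YoungDiagram) : ∃! t : Config, HasType q l t := by
  have ha : HasType q l .a ↔ _ := exists_addsBox_iff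
  have hb : HasType q l .b ↔ _ := exists_addsBox_iff'
  have h1 := prof_step l q
  have h2 := prof_step' l q
  have h3 := natAbs_le_prof l q
  have h4 := natAbs_le_prof l (q + 1)
  have h5 := natAbs_le_prof l (q - 1)
  have h6 : prof l q = (q.natAbs : ℤ) → 0 ≤ q → prof l (q + 1) = ((q + 1).natAbs : ℤ) := fun h h' =>
    prof_eq_natAbs_of_le h h' (by omega)
  have h7 : prof l q = (q.natAbs : ℤ) → q ≤ 0 → prof l (q - 1) = ((q - 1).natAbs : ℤ) := fun h h' =>
    prof_eq_natAbs_of_ge h h' (by omega)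
  have hex : ∃ t, HasType q l t := by
    -- A valley is (a) and a peak is (b). A slope is (d) or (e), unless the profile touches its
    -- lower bound at `q`, which gives (c).
    rcases h1 with u | u <;> rcases h2 with v | v
    · by_cases h : (q.natAbs : ℤ) < prof l q
      · exact ⟨.d, hasType_d_iff.mpr ⟨h, u, by omega⟩⟩
      · exact ⟨.c, hasType_c_iff.mpr (by omega)⟩
    · exact ⟨.a, ha.mpr ⟨by omega, u⟩⟩
    · exact ⟨.b, hb.mpr ⟨by omega, u⟩⟩
    · by_cases h : (q.natAbs : ℤ) < prof l q
      · exact ⟨.e, hasType_e_iff.mpr ⟨h, u, by omega⟩⟩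
      · exact ⟨.c, hasType_c_iff.mpr (by omega)⟩
  obtain ⟨t, ht⟩ := hex
  refine ⟨t, ht, fun t' ht' => ?_⟩
  clear h3 h4 h5 h6 h7
  cases t <;> cases t' <;> first
    | rfl
    | (exfalso
       simp only [ha, hb, hasType_c_iff, hasType_d_iff, hasType_e_iff] at ht ht'
       omega)

end TLFock

/-! ### Temperley–Lieb relations for moving beads and the Fock space representation -/

namespace TLFock

noncomputable section

/-! ### Bead configurations -/

/-- The operator that changes the value at `i` from `s` to `!s`, and annihilates the configurations
in which it is `!s`. -/
def flip (s : Bool) (i : ℤ) : Module.End ℤ ((ℤ → Bool) →₀ ℤ) :=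
  Finsupp.linearCombination ℤ fun b =>
    if b i = s then Finsupp.single (Function.update b i !s) 1 else 0

theorem flip_single (s : Bool) (i : ℤ) (b : ℤ → Bool) : flip s i (Finsupp.single b 1) =
    if b i = s then Finsupp.single (Function.update b i !s) 1 else 0 := by
  simp [flip]

theorem config_hom_ext {f g : Module.End ℤ ((ℤ → Bool) →₀ ℤ)}
    (h : ∀ b, f (Finsupp.single b 1) = g (Finsupp.single b 1)) : f = g := by
  ext b : 2
  exact h b

theorem flip_mul_self (s : Bool) (i : ℤ) : flip s i * flip s i = 0 := by
  refine config_hom_ext fun b => ?_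
  rw [Module.End.mul_apply, flip_single]
  split_ifs <;> simp [flip_single]

/-- `flip true i` annihilates and `flip false i` creates a bead; this is their anticommutation
relation at one site. Operators at distinct sites commute without sign. -/
theorem flip_add_flip (s : Bool) (i : ℤ) : flip s i * flip (!s) i + flip (!s) i * flip s i = 1 := by
  refine config_hom_ext fun b => ?_
  rw [LinearMap.add_apply, Module.End.mul_apply, Module.End.mul_apply, flip_single, flip_single]
  by_cases h : b i = s
  · subst h
    simp [flip_single]
  · have h' : b i = !s := by cases s <;> simp_all
    rw [if_pos h', if_neg h]
    simp [flip_single, ← h']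

theorem flip_comm (s t : Bool) {i j : ℤ} (h : i ≠ j) : flip s i * flip t j = flip t j * flip s i := by
  refine config_hom_ext fun b => ?_
  rw [Module.End.mul_apply, Module.End.mul_apply, flip_single, flip_single]
  split_ifs with h1 h2 h2 <;>
    simp [flip_single, Function.update_of_ne h, Function.update_of_ne h.symm, h1, h2,
      Function.update_comm h]

theorem flip_mul_flip_mul_flip (s : Bool) (i : ℤ) :
    flip s i * flip (!s) i * flip s i = flip s i := by
  have h : flip (!s) i * flip s i = 1 - flip s i * flip (!s) i :=
    eq_sub_of_add_eq' (flip_add_flip s i)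
  rw [mul_assoc, h, mul_sub, ← mul_assoc, flip_mul_self]
  simp

/-- The operator of the `i`-th generator: the bead at `i` moves to a neighbouring position. -/
def hopOp (i : ℤ) : Module.End ℤ ((ℤ → Bool) →₀ ℤ) :=
  (flip false (i + 1) + flip false (i - 1)) * flip true i

theorem hopOp_sq (i : ℤ) : hopOp i * hopOp i = 0 := by
  unfold hopOp
  have h : flip true i * (flip false (i + 1) + flip false (i - 1)) =
      (flip false (i + 1) + flip false (i - 1)) * flip true i := by
    rw [mul_add, add_mul, flip_comm true false (i := i) (j := i + 1) (by omega),
      flip_comm true false (i := i) (j := i - 1) (by omega)]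
  rw [mul_assoc, ← mul_assoc (flip true i), h, mul_assoc, flip_mul_self]
  simp

theorem hopOp_comm {i j : ℤ} (h : 1 < |i - j|) : hopOp i * hopOp j = hopOp j * hopOp i := by
  have h1 : i ≠ j ∧ i ≠ j + 1 ∧ i ≠ j - 1 := by
    refine ⟨?_, ?_, ?_⟩ <;> rintro rfl <;> simp at h
  have hc : ∀ (s t : Bool) (a b : ℤ), a ≠ b ∨ s = t → Commute (flip s a) (flip t b) := by
    intro s t a b h
    rcases eq_or_ne a b with rfl | h'
    · rcases h with h | rfl
      · exact absurd rfl h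
      · rfl
    · exact flip_comm _ _ h'
  have : Commute (hopOp i) (hopOp j) := by
    unfold hopOp
    refine .mul_left (.mul_right (.add_left (.add_right ?_ ?_) (.add_right ?_ ?_))
      (.add_left ?_ ?_)) (.mul_right (.add_right ?_ ?_) ?_) <;> apply hc <;> simp <;> omega
  exact this

/-- Here `j`, `k` are the targets of `i`, and `n`, `i` those of `j`. Only distinctness of sites
matters, so both cubic relations are instances. The middle creation operator survives only at `i`,
where it cancels between the two annihilations (`h1`); the annihilation at `j` is absorbed between
the two outer sums (`h2`). -/
theorem hopOp_mul_hopOp_mul_hopOp {i j k n : ℤ} (hij : i ≠ j) (hik : i ≠ k) (hjk : j ≠ k)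
    (hin : i ≠ n) :
    (flip false j + flip false k) * flip true i * ((flip false n + flip false i) * flip true j) *
      ((flip false j + flip false k) * flip true i) =
    (flip false j + flip false k) * flip true i := by
  set a := flip false j
  set a' := flip false k
  set c := flip true i
  have hca : c * a = a * c := flip_comm _ _ hij
  have hca' : c * a' = a' * c := flip_comm _ _ hik
  have hcj : flip true j * c = c * flip true j := flip_comm _ _ hij.symm
  have hc : c * flip false i * c = c := flip_mul_flip_mul_flip true i
  have hcn : c * flip false n = flip false n * c := flip_comm _ _ hin
  have hcc : c * c = 0 := flip_mul_self _ _
  have h1 : c * (flip false n + flip false i) * c = c := by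
    rw [mul_add, add_mul, hc, hcn, mul_assoc, hcc, mul_zero, zero_add]
  have hs : (a + a') * c = c * (a + a') := by rw [mul_add, add_mul, hca, hca']
  have h2 : (a + a') * flip true j * (a + a') = a + a' := by
    have e1 : a * flip true j * a = a := flip_mul_flip_mul_flip false j
    have e2 : a * flip true j + flip true j * a = 1 := flip_add_flip false j
    have e3 : a' * flip true j = flip true j * a' := flip_comm _ _ hjk.symm
    have e4 : a' * a' = 0 := flip_mul_self _ _
    have e5 : a' * a = a * a' := flip_comm _ _ hjk.symm
    calc (a + a') * flip true j * (a + a')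
        = a * flip true j * a + a * flip true j * a' + a' * flip true j * a
          + a' * flip true j * a' := by noncomm_ring
      _ = a + (a * flip true j + flip true j * a) * a' + flip true j * (a' * a') := by
        rw [e1, e3, mul_assoc (flip true j) a' a, e5]; noncomm_ring
      _ = a + a' := by rw [e2, e4]; simp
  calc _ = (a + a') * (c * (flip false n + flip false i)) * (flip true j * ((a + a') * c)) := by
        noncomm_ring
    _ = (a + a') * (c * (flip false n + flip false i)) * (flip true j * c * (a + a')) := by
        rw [hs]; simp only [mul_assoc]
    _ = (a + a') * (c * (flip false n + flip false i) * c) * flip true j * (a + a') := by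
        rw [hcj]; noncomm_ring
    _ = (a + a') * flip true j * ((a + a') * c) := by
        rw [h1, mul_assoc _ c, ← hcj, hs]; noncomm_ring
    _ = (a + a') * c := by rw [← mul_assoc, h2]

theorem hopOp_up (i : ℤ) : hopOp i * hopOp (i + 1) * hopOp i = hopOp i := by
  have := hopOp_mul_hopOp_mul_hopOp (i := i) (j := i + 1) (k := i - 1) (n := i + 1 + 1)
    (by omega) (by omega) (by omega) (by omega)
  rwa [show flip false i = flip false (i + 1 - 1) by simp] at this

theorem hopOp_down (i : ℤ) : hopOp i * hopOp (i - 1) * hopOp i = hopOp i := by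
  have := hopOp_mul_hopOp_mul_hopOp (i := i) (j := i - 1) (k := i + 1) (n := i - 1 - 1)
    (by omega) (by omega) (by omega) (by omega)
  rw [show flip false i = flip false (i - 1 + 1) by simp, add_comm (flip false (i - 1)),
    add_comm (flip false (i - 1 - 1))] at this
  exact this

/-! ### The Fock space representation -/

/-- The bead configuration of a partition: there is a bead at `q` if the profile descends between
`q - 1` and `q`. -/
def bead (l : YoungDiagram) (q : ℤ) : Bool := decide (prof l q < prof l (q - 1))

theorem bead_eq_true {l : YoungDiagram} {q : ℤ} :
    bead l q = true ↔ prof l q = prof l (q - 1) - 1 := by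
  have := prof_step' l q
  simp only [bead, decide_eq_true_eq]
  omega

theorem bead_eq_false {l : YoungDiagram} {q : ℤ} :
    bead l q = false ↔ prof l q = prof l (q - 1) + 1 := by
  have := prof_step' l q
  simp only [bead, decide_eq_false_iff_not]
  omega

/-- The beads record all steps of the profile, and any two profiles agree far to the left. -/
theorem bead_injective : Function.Injective bead := by
  intro l m h
  obtain ⟨N, hN0, hN⟩ := exists_prof_eq_natAbs l
  obtain ⟨M, -, hM⟩ := exists_prof_eq_natAbs m
  refine prof_injective (funext fun q => ?_)
  have key : ∀ q, -(max N M) ≤ q → prof l q = prof m q := by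
    intro q hq
    induction q, hq using Int.leInduction with
    | base => rw [hN _ (by omega), hM _ (by omega)]
    | succ n _ ih =>
      have h1 := congrFun h (n + 1)
      cases h2 : bead m (n + 1)
      · rw [h2, bead_eq_false, add_sub_cancel_right] at h1
        rw [bead_eq_false, add_sub_cancel_right] at h2
        omega
      · rw [h2, bead_eq_true, add_sub_cancel_right] at h1
        rw [bead_eq_true, add_sub_cancel_right] at h2
        omega
  by_cases hq : -(max N M) ≤ q
  · exact key q hq
  · rw [hN _ (by omega), hM _ (by omega)]

/-- The configuration in which the bead at `i` has moved to `j`. -/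
def hop (i j : ℤ) (b : ℤ → Bool) : ℤ → Bool := Function.update (Function.update b i false) j true

theorem hop_apply (i j k : ℤ) (b : ℤ → Bool) :
    hop i j b k = if k = j then true else if k = i then false else b k := by
  simp [hop, Function.update_apply]

theorem bead_of_addsBox {q : ℤ} {l m : YoungDiagram} (h : AddsBox q l m) :
    bead l q = true ∧ bead l (q + 1) = false ∧ bead m q = false ∧ bead m (q + 1) = true ∧
      ∀ p, p ≠ q → p ≠ q + 1 → bead m p = bead l p := by
  have h1 := exists_addsBox_iff.mp ⟨m, h⟩
  have h2 := exists_addsBox_iff'.mp ⟨l, h⟩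
  rw [bead_eq_true, bead_eq_false, bead_eq_false, bead_eq_true, add_sub_cancel_right]
  refine ⟨by omega, by omega, by omega, by omega, fun p hp hp' => ?_⟩
  unfold bead
  rw [h.prof_of_ne hp, h.prof_of_ne (by omega)]

theorem bead_hop_right {q : ℤ} {l m : YoungDiagram} (h : AddsBox q l m) :
    bead m = hop q (q + 1) (bead l) := by
  obtain ⟨-, -, h1, h2, h3⟩ := bead_of_addsBox h
  funext p
  rw [hop_apply]
  split_ifs with h4 h5
  · rw [h4, h2]
  · rw [h5, h1]
  · exact h3 p h5 h4

theorem bead_hop_left {q : ℤ} {l m : YoungDiagram} (h : AddsBox q m l) :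
    bead m = hop (q + 1) q (bead l) := by
  obtain ⟨h1, h2, -, -, h3⟩ := bead_of_addsBox h
  funext p
  rw [hop_apply]
  split_ifs with h4 h5
  · rw [h4, h1]
  · rw [h5, h2]
  · exact (h3 p h4 h5).symm

theorem exists_addsBox_iff_bead {q : ℤ} {l : YoungDiagram} :
    (∃ m, AddsBox q l m) ↔ bead l q = true ∧ bead l (q + 1) = false := by
  rw [exists_addsBox_iff, bead_eq_true, bead_eq_false, add_sub_cancel_right]
  omega

theorem exists_addsBox_iff_bead' {q : ℤ} {m : YoungDiagram} :
    (∃ l, AddsBox q l m) ↔ bead m (q + 1) = true ∧ bead m q = false := by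
  rw [exists_addsBox_iff', bead_eq_true, bead_eq_false, add_sub_cancel_right]
  omega

open scoped Classical in
/-- The sum of the partitions obtained from `l` by adding a `q`-box. -/
def addVec (q : ℤ) (l : YoungDiagram) : ParZ :=
  if h : ∃ m, AddsBox q l m then basisVec h.choose else 0

open scoped Classical in
/-- The sum of the partitions obtained from `l` by removing a `q`-box. -/
def remVec (q : ℤ) (l : YoungDiagram) : ParZ :=
  if h : ∃ m, AddsBox q m l then basisVec h.choose else 0

open scoped Classical in
theorem addVec_apply (q : ℤ) (l m : YoungDiagram) :
    addVec q l m = if AddsBox q l m then 1 else 0 := by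
  unfold addVec
  split_ifs with h h' h'
  · rw [h'.right_unique h.choose_spec]; simp
  · rw [basisVec, Finsupp.single_apply, if_neg]
    rintro rfl
    exact h' h.choose_spec
  · exact absurd ⟨m, h'⟩ h
  · simp

open scoped Classical in
theorem remVec_apply (q : ℤ) (l m : YoungDiagram) :
    remVec q l m = if AddsBox q m l then 1 else 0 := by
  unfold remVec
  split_ifs with h h' h'
  · rw [h'.left_unique h.choose_spec]; simp
  · rw [basisVec, Finsupp.single_apply, if_neg]
    rintro rfl
    exact h' h.choose_spec
  · exact absurd ⟨m, h'⟩ h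
  · simp

theorem addVec_of_addsBox {q : ℤ} {l m : YoungDiagram} (h : AddsBox q l m) :
    addVec q l = basisVec m := by
  have h' : ∃ m, AddsBox q l m := ⟨m, h⟩
  rw [addVec, dif_pos h', h.right_unique h'.choose_spec]

theorem remVec_of_addsBox {q : ℤ} {l m : YoungDiagram} (h : AddsBox q m l) :
    remVec q l = basisVec m := by
  have h' : ∃ m, AddsBox q m l := ⟨m, h⟩
  rw [remVec, dif_pos h', h.left_unique h'.choose_spec]

/-- The operator of `T_q` on Fock space. -/
def fockOp (q : ℤ) : Module.End ℤ ParZ :=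
  Finsupp.linearCombination ℤ fun l => addVec q l + remVec (q - 1) l

theorem fockOp_basisVec (q : ℤ) (l : YoungDiagram) :
    fockOp q (basisVec l) = addVec q l + remVec (q - 1) l := by
  simp [fockOp]

/-- The embedding of Fock space into the span of all configurations. -/
def beadMap : ParZ →ₗ[ℤ] (ℤ → Bool) →₀ ℤ := Finsupp.lmapDomain ℤ ℤ bead

theorem beadMap_injective : Function.Injective beadMap :=
  Finsupp.mapDomain_injective bead_injective

theorem beadMap_basisVec (l : YoungDiagram) : beadMap (basisVec l) = Finsupp.single (bead l) 1 := by
  simp [beadMap]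

/-- This transfers the relations: they need to be checked only on arbitrary configurations, where
the sites are independent. -/
theorem beadMap_fockOp (q : ℤ) (v : ParZ) : beadMap (fockOp q v) = hopOp q (beadMap v) := by
  have : beadMap ∘ₗ fockOp q = hopOp q ∘ₗ beadMap := by
    ext l : 2
    change beadMap (fockOp q (basisVec l)) = hopOp q (beadMap (basisVec l))
    rw [fockOp_basisVec, beadMap_basisVec, hopOp, Module.End.mul_apply, flip_single]
    by_cases h : bead l q = true
    · rw [if_pos h, LinearMap.add_apply, flip_single, flip_single, map_add,
        Function.update_of_ne (by omega), Function.update_of_ne (by omega)]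
      congr 1
      · split_ifs with h'
        · obtain ⟨m, hm⟩ := exists_addsBox_iff_bead.mpr ⟨h, h'⟩
          rw [addVec_of_addsBox hm, beadMap_basisVec, bead_hop_right hm]
          rfl
        · rw [addVec, dif_neg (by rw [exists_addsBox_iff_bead]; tauto), map_zero]
      · split_ifs with h'
        · obtain ⟨m, hm⟩ := exists_addsBox_iff_bead' (q := q - 1).mpr ⟨by simpa using h, h'⟩
          rw [remVec_of_addsBox hm, beadMap_basisVec, bead_hop_left hm, sub_add_cancel]
          rfl
        · rw [remVec, dif_neg (by rw [exists_addsBox_iff_bead']; tauto), map_zero]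
    · rw [if_neg h, map_zero, addVec, remVec, dif_neg (by rw [exists_addsBox_iff_bead]; tauto),
        dif_neg (by rw [exists_addsBox_iff_bead', sub_add_cancel]; tauto)]
      simp
  exact LinearMap.congr_fun this v

theorem fockOp_relations {x y : FreeAlgebra ℤ ℤ} (h : TLRel x y) :
    FreeAlgebra.lift ℤ fockOp x = FreeAlgebra.lift ℤ fockOp y := by
  refine LinearMap.ext fun v => beadMap_injective ?_
  cases h with
  | sq i =>
    simp only [map_mul, map_zero, FreeAlgebra.lift_ι_apply, Module.End.mul_apply, beadMap_fockOp]
    rw [← Module.End.mul_apply, hopOp_sq]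
    simp
  | comm i j h =>
    simp only [map_mul, FreeAlgebra.lift_ι_apply, Module.End.mul_apply, beadMap_fockOp]
    rw [← Module.End.mul_apply, hopOp_comm h]
    rfl
  | up i =>
    simp only [map_mul, FreeAlgebra.lift_ι_apply, Module.End.mul_apply, beadMap_fockOp]
    exact LinearMap.congr_fun (hopOp_up i) _
  | down i =>
    simp only [map_mul, FreeAlgebra.lift_ι_apply, Module.End.mul_apply, beadMap_fockOp]
    exact LinearMap.congr_fun (hopOp_down i) _

/-- The Fock space representation. -/
def fockRep : ParRep :=
  RingQuot.liftAlgHom ℤ ⟨FreeAlgebra.lift ℤ fockOp, fun _ _ h => fockOp_relations h⟩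

theorem fockRep_T (q : ℤ) : fockRep (T q) = fockOp q := by
  unfold fockRep T
  rw [RingQuot.liftAlgHom_mkAlgHom_apply, FreeAlgebra.lift_ι_apply]

theorem rep_hom_ext {R R' : ParRep} (h : ∀ q l, R (T q) (basisVec l) = R' (T q) (basisVec l)) :
    R = R' := by
  refine RingQuot.ringQuot_ext' ℤ _ _ (FreeAlgebra.hom_ext (funext fun q => ?_))
  refine Finsupp.lhom_ext' fun l => LinearMap.ext_ring ?_
  exact h q l

theorem not_addsBox_addsBox {p q : ℤ} {l m : YoungDiagram} (h : AddsBox q l m)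
    (h' : AddsBox p m l) : False := by
  have := h.card
  have := h'.card
  omega

theorem isFock_fockRep : IsFock fockRep := by
  intro q l m
  rw [fockRep_T, fockOp_basisVec, Finsupp.add_apply, addVec_apply, remVec_apply, bMat]
  split_ifs with h1 h2 h3 h4 h5 <;> first | rfl | tauto | skip
  exact (not_addsBox_addsBox h1 h2).elim

theorem IsFock.unique {R : ParRep} (h : IsFock R) : R = fockRep :=
  rep_hom_ext fun q l => Finsupp.ext fun m => by rw [h, isFock_fockRep]

end

end TLFock

/-! ### Faithfulness of the Fock space representation -/

namespace TLFock

noncomputable section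

/-! ### Monomials -/

theorem T_sq (i : ℤ) : T i * T i = 0 := by
  have := RingQuot.mkAlgHom_rel ℤ (TLRel.sq i)
  rwa [map_mul, map_zero] at this

theorem T_comm {i j : ℤ} (h : 1 < |i - j|) : T i * T j = T j * T i := by
  have := RingQuot.mkAlgHom_rel ℤ (TLRel.comm i j h)
  rwa [map_mul, map_mul] at this

theorem T_up (i : ℤ) : T i * T (i + 1) * T i = T i := by
  have := RingQuot.mkAlgHom_rel ℤ (TLRel.up i)
  rwa [map_mul, map_mul] at this

theorem T_down (i : ℤ) : T i * T (i - 1) * T i = T i := by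
  have := RingQuot.mkAlgHom_rel ℤ (TLRel.down i)
  rwa [map_mul, map_mul] at this

theorem T_comm_of_ne {i j : ℤ} (h : i ≠ j) (h1 : i ≠ j - 1) (h2 : i ≠ j + 1) :
    T i * T j = T j * T i := by
  refine T_comm ?_
  rw [lt_abs]
  omega

/-- The monomial given by a word in the generators. -/
def mono (w : List ℤ) : TLInf := (w.map T).prod

theorem mono_cons (q : ℤ) (w : List ℤ) : mono (q :: w) = T q * mono w := by simp [mono]

theorem mono_append (u w : List ℤ) : mono (u ++ w) = mono u * mono w := by simp [mono]

theorem T_mul_mono {q : ℤ} {w : List ℤ} (h : q ∉ w) (h1 : q - 1 ∉ w) (h2 : q + 1 ∉ w) :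
    T q * mono w = mono w * T q := by
  induction w with
  | nil => simp [mono]
  | cons p w ih =>
    simp only [List.mem_cons, not_or] at h h1 h2
    rw [mono_cons, ← mul_assoc, T_comm_of_ne h.1 (by omega) (by omega), mul_assoc,
      ih h.2 h1.2 h2.2, mul_assoc]

theorem span_mono_eq_top : Submodule.span ℤ (Set.range mono) = ⊤ := by
  rw [eq_top_iff]
  rintro x -
  obtain ⟨y, rfl⟩ := RingQuot.mkAlgHom_surjective ℤ TLRel x
  induction y using FreeAlgebra.induction with
  | grade0 r =>
    rw [AlgHom.commutes, Algebra.algebraMap_eq_smul_one]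
    exact Submodule.smul_mem _ _ (Submodule.subset_span ⟨[], rfl⟩)
  | grade1 q => exact Submodule.subset_span ⟨[q], by simp [mono, T]⟩
  | mul a b ha hb =>
    rw [map_mul]
    refine Submodule.span_mono ?_
      (le_of_eq (Submodule.span_mul_span ..) (Submodule.mul_mem_mul ha hb))
    rintro _ ⟨_, ⟨u, rfl⟩, _, ⟨w, rfl⟩, rfl⟩
    exact ⟨u ++ w, mono_append u w⟩
  | add a b ha hb =>
    rw [map_add]
    exact add_mem ha hb

/-! ### Words that move beads to the right -/

/-- The configuration obtained from `b` by moving beads to the right according to a word, which is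
read from right to left. -/
def run : List ℤ → (ℤ → Bool) → (ℤ → Bool)
  | [], b => b
  | q :: w, b => hop q (q + 1) (run w b)

/-- All moves of a word are possible. -/
def Runs : List ℤ → (ℤ → Bool) → Prop
  | [], _ => True
  | q :: w, b => Runs w b ∧ run w b q = true ∧ run w b (q + 1) = false

theorem run_append (u w : List ℤ) (b : ℤ → Bool) : run (u ++ w) b = run u (run w b) := by
  induction u with
  | nil => rfl
  | cons q u ih => rw [List.cons_append, run, ih, run]

theorem runs_append (u w : List ℤ) (b : ℤ → Bool) :
    Runs (u ++ w) b ↔ Runs w b ∧ Runs u (run w b) := by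
  induction u with
  | nil => simp [Runs]
  | cons q u ih => rw [List.cons_append, Runs, ih, Runs, run_append, and_assoc]

theorem run_apply_of_notMem {w : List ℤ} {x : ℤ} (b : ℤ → Bool) (h : x ∉ w) (h' : x - 1 ∉ w) :
    run w b x = b x := by
  induction w with
  | nil => rfl
  | cons p w ih =>
    simp only [List.mem_cons, not_or] at h h'
    rw [run, hop_apply, if_neg (by omega), if_neg h.1, ih h.2 h'.2]

theorem run_update {w : List ℤ} {x : ℤ} (b : ℤ → Bool) (s : Bool) (h : x ∉ w) (h' : x - 1 ∉ w) :
    run w (Function.update b x s) = Function.update (run w b) x s := by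
  induction w with
  | nil => rfl
  | cons p w ih =>
    simp only [List.mem_cons, not_or] at h h'
    rw [run, run, ih h.2 h'.2]
    funext y
    simp only [hop_apply, Function.update_apply]
    have := h.1
    split_ifs <;> first | rfl | omega

theorem runs_update {w : List ℤ} {x : ℤ} {b : ℤ → Bool} (s : Bool) (h : x ∉ w) (h' : x - 1 ∉ w)
    (hw : Runs w b) : Runs w (Function.update b x s) := by
  induction w with
  | nil => trivial
  | cons p w ih =>
    simp only [List.mem_cons, not_or] at h h'
    refine ⟨ih h.2 h'.2 hw.1, ?_⟩
    rw [run_update b s h.2 h'.2, Function.update_of_ne (by omega), Function.update_of_ne (by omega)]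
    exact hw.2

/-- The latest move `q - 1` leaves a bead at `q`, and only a move `q` could take it away. -/
theorem run_apply_of_sub_one_mem {w : List ℤ} {q : ℤ} (b : ℤ → Bool) (h : q ∉ w)
    (h' : q - 1 ∈ w) : run w b q = true := by
  induction w with
  | nil => simp at h'
  | cons p w ih =>
    simp only [List.mem_cons, not_or] at h h'
    rw [run, hop_apply]
    split_ifs with h1 h2
    · rfl
    · exact absurd h2 h.1
    · exact ih h.2 (h'.resolve_left (by omega))

theorem run_apply_of_mem {w : List ℤ} {q : ℤ} (b : ℤ → Bool) (h : q ∉ w)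
    (h' : q + 1 ∈ w) : run w b (q + 1) = false := by
  induction w with
  | nil => simp at h'
  | cons p w ih =>
    simp only [List.mem_cons, not_or] at h h'
    rw [run, hop_apply]
    split_ifs with h1 h2
    · omega
    · rfl
    · exact ih h.2 (h'.resolve_left h2)

/-- Only a move `q` could bring a bead to the empty site `q + 1`, so no bead can ever leave that
site. -/
theorem notMem_of_runs {w : List ℤ} {q : ℤ} {b : ℤ → Bool} (h : q ∉ w) (hb : b (q + 1) = false)
    (hw : Runs w b) : q + 1 ∉ w := by
  induction w with
  | nil => simp
  | cons p w ih =>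
    simp only [List.mem_cons, not_or] at h ⊢
    have h1 := ih h.2 hw.1
    refine ⟨?_, h1⟩
    rintro rfl
    have := run_apply_of_notMem b h1 (by simpa using h.2)
    rw [hw.2.1, hb] at this
    exact Bool.noConfusion this

theorem notMem_of_runs' {w : List ℤ} {q : ℤ} {b : ℤ → Bool} (h : q ∉ w) (hb : b q = true)
    (hw : Runs w b) : q - 1 ∉ w := by
  induction w with
  | nil => simp
  | cons p w ih =>
    simp only [List.mem_cons, not_or] at h ⊢
    have h1 := ih h.2 hw.1
    refine ⟨?_, h1⟩
    rintro rfl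
    have := run_apply_of_notMem b h.2 h1
    have h3 := hw.2.2
    rw [sub_add_cancel, this, hb] at h3
    exact Bool.noConfusion h3

/-- The final values needed at `q` and `q + 1` hold automatically if the word touches these sites.
If it does not touch one of them, its initial value may be prescribed freely. -/
theorem exists_runs_cons_of_notMem {w : List ℤ} {q : ℤ} {b : ℤ → Bool} (h : q ∉ w)
    (hw : Runs w b) : ∃ b', Runs (q :: w) b' := by
  obtain ⟨b1, hb1, hq⟩ : ∃ b1, Runs w b1 ∧ run w b1 q = true := by
    by_cases h1 : q - 1 ∈ w
    · exact ⟨b, hw, run_apply_of_sub_one_mem b h h1⟩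
    · exact ⟨_, runs_update true h h1 hw, by rw [run_update b true h h1]; simp⟩
  by_cases h2 : q + 1 ∈ w
  · exact ⟨b1, hb1, hq, run_apply_of_mem b1 h h2⟩
  · have h3 : q + 1 - 1 ∉ w := by simpa using h
    refine ⟨_, runs_update false h2 h3 hb1, ?_, ?_⟩
    · rw [run_update b1 false h2 h3, Function.update_of_ne (by omega), hq]
    · rw [run_update b1 false h2 h3]; simp

theorem exists_eq_append_cons {q : ℤ} {w : List ℤ} (h : q ∈ w) :
    ∃ u v, w = u ++ q :: v ∧ q ∉ u := by
  induction w with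
  | nil => simp at h
  | cons p w ih =>
    by_cases hp : q = p
    · exact ⟨[], w, by simp [hp], by simp⟩
    · obtain ⟨u, v, rfl, hu⟩ := ih (by simpa [hp] using h)
      exact ⟨p :: u, v, rfl, by simp [hp, hu]⟩

theorem exists_eq_append_cons' {q : ℤ} {w : List ℤ} (h : q ∈ w) :
    ∃ u v, w = u ++ q :: v ∧ q ∉ v := by
  induction w with
  | nil => simp at h
  | cons p w ih =>
    by_cases hp : q ∈ w
    · obtain ⟨u, v, rfl, hu⟩ := ih hp
      exact ⟨p :: u, v, rfl, hu⟩
    · have : q = p := by simpa [hp] using h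
      exact ⟨[], w, by simp [this], hp⟩

/-- Multiplying an executable word by a generator gives zero, an executable word, or a shorter
monomial. -/
theorem mono_cons_cases {w : List ℤ} {b : ℤ → Bool} (hw : Runs w b) (q : ℤ) :
    mono (q :: w) = 0 ∨ (∃ b', Runs (q :: w) b') ∨
      ∃ w', w'.length < w.length ∧ mono w' = mono (q :: w) := by
  by_cases hq : q ∈ w
  swap
  · exact Or.inr (Or.inl (exists_runs_cons_of_notMem hq hw))
  -- Words are read from the right, so `u` contains the moves after the latest `q`. If both
  -- neighbours of `q` occur in `u`, then `q` can be executed again; if neither does, two factors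
  -- T_q meet and the product is zero.
  obtain ⟨u, v, rfl, hu⟩ := exists_eq_append_cons hq
  obtain ⟨hv, hwu⟩ := (runs_append _ _ _).mp hw
  -- If just one neighbour `p` of `q` occurs in `u`, it occurs only once: after it has moved,
  -- nothing restores its starting position. Everything else in `u` commutes with T_q, so T_q T_p
  -- T_q = T_q shortens the word.
  have reduce : ∀ p, p ∈ u →
      (∀ (b' : ℤ → Bool) (u' : List ℤ), q ∉ u' → Runs (u' ++ [p]) b' → p ∉ u') →
      (q - 1 ∉ u ∧ p = q + 1 ∨ q + 1 ∉ u ∧ p = q - 1) → T q * T p * T q = T q →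
      ∃ w', w'.length < (u ++ q :: v).length ∧ mono w' = mono (q :: (u ++ q :: v)) := by
    intro p hp hone hside hT
    obtain ⟨u1, u2, rfl, h2⟩ := exists_eq_append_cons' hp
    simp only [List.mem_append, List.mem_cons, not_or] at hu
    have h1 : p ∉ u1 := by
      have : Runs (u1 ++ [p]) (run u2 (run (q :: v) b)) := by
        rw [show u1 ++ p :: u2 = (u1 ++ [p]) ++ u2 by simp, runs_append] at hwu
        exact hwu.2
      exact hone _ _ hu.1 this
    have hside1 : q - 1 ∉ u1 ∧ q + 1 ∉ u1 ∧ q - 1 ∉ u2 ∧ q + 1 ∉ u2 := by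
      rcases hside with ⟨hs, rfl⟩ | ⟨hs, rfl⟩
      · exact ⟨fun h => hs (by simp [h]), h1, fun h => hs (by simp [h]), h2⟩
      · exact ⟨h1, fun h => hs (by simp [h]), h2, fun h => hs (by simp [h])⟩
    have c1 := T_mul_mono hu.1 hside1.1 hside1.2.1
    have c2 := T_mul_mono hu.2.2 hside1.2.2.1 hside1.2.2.2
    refine ⟨u1 ++ q :: (u2 ++ v), by simp, ?_⟩
    calc mono (u1 ++ q :: (u2 ++ v)) = mono u1 * (T q * T p * T q) * mono u2 * mono v := by
          rw [hT]; simp only [mono_append, mono_cons, mul_assoc]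
      _ = mono u1 * T q * T p * (T q * mono u2) * mono v := by simp only [mul_assoc]
      _ = T q * mono u1 * T p * (mono u2 * T q) * mono v := by rw [c1, c2]
      _ = mono (q :: (u1 ++ p :: u2 ++ q :: v)) := by
          simp only [mono_append, mono_cons, mul_assoc]
  by_cases h1 : q - 1 ∈ u <;> by_cases h2 : q + 1 ∈ u
  · refine Or.inr (Or.inl ⟨b, hw, ?_⟩)
    rw [run_append]
    exact ⟨run_apply_of_sub_one_mem _ hu h1, run_apply_of_mem _ hu h2⟩
  · refine Or.inr (Or.inr (reduce (q - 1) h1 ?_ (Or.inr ⟨h2, rfl⟩) (T_down q)))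
    intro b' u' hq' hr
    rw [runs_append] at hr
    exact notMem_of_runs' hq' (by simp [run, hop_apply]) hr.2
  · refine Or.inr (Or.inr (reduce (q + 1) h2 ?_ (Or.inl ⟨h1, rfl⟩) (T_up q)))
    intro b' u' hq' hr
    rw [runs_append] at hr
    exact notMem_of_runs hq' (by simp [run, hop_apply]) hr.2
  · refine Or.inl ?_
    rw [mono_cons, mono_append, mono_cons, ← mul_assoc, T_mul_mono hu h1 h2, mul_assoc,
      ← mul_assoc (T q), T_sq]
    simp

/-- The shorter word supplied by `mono_cons_cases` need not be executable; hence the induction on a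
bound for the length. -/
theorem mono_eq_zero_or_runs (n : ℕ) : ∀ w : List ℤ, w.length ≤ n →
    mono w = 0 ∨ ∃ w' b, Runs w' b ∧ w'.length ≤ w.length ∧ mono w' = mono w := by
  induction n with
  | zero =>
    intro w hw
    obtain rfl := List.length_eq_zero_iff.mp (Nat.le_zero.mp hw)
    exact Or.inr ⟨[], fun _ => true, trivial, le_rfl, rfl⟩
  | succ n ih =>
    intro w hw
    cases w with
    | nil => exact Or.inr ⟨[], fun _ => true, trivial, le_rfl, rfl⟩
    | cons q w =>
      rw [List.length_cons] at hw
      rcases ih w (by omega) with h | ⟨w1, b, hb, hl, he⟩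
      · left
        rw [mono_cons, h, mul_zero]
      · have he' : mono (q :: w1) = mono (q :: w) := by rw [mono_cons, mono_cons, he]
        rw [← he', List.length_cons]
        rcases mono_cons_cases hb q with h | ⟨b', hb'⟩ | ⟨w2, hl2, he2⟩
        · exact Or.inl h
        · exact Or.inr ⟨_, b', hb', by simpa using hl, rfl⟩
        · rcases ih w2 (by omega) with h | ⟨w3, b3, hb3, hl3, he3⟩
          · exact Or.inl (he2 ▸ h)
          · exact Or.inr ⟨w3, b3, hb3, by omega, he3.trans he2⟩

/-! ### Adding paths of partitions -/

/-- `m` is obtained from `l` by adding boxes whose contents are given by a word, which is read from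
right to left. -/
def AddsPath : List ℤ → YoungDiagram → YoungDiagram → Prop
  | [], l, m => l = m
  | q :: w, l, m => ∃ k, AddsPath w l k ∧ AddsBox q k m

theorem AddsPath.card {w : List ℤ} {l m : YoungDiagram} (h : AddsPath w l m) :
    m.card = l.card + w.length := by
  induction w generalizing m with
  | nil => rw [show l = m from h]; rfl
  | cons q w ih =>
    obtain ⟨k, h1, h2⟩ := h
    rw [h2.card, ih h1, List.length_cons, add_assoc]

theorem AddsPath.le {w : List ℤ} {l m : YoungDiagram} (h : AddsPath w l m) : l ≤ m := by
  induction w generalizing m with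
  | nil => exact le_of_eq h
  | cons q w ih =>
    obtain ⟨k, h1, h2⟩ := h
    exact (ih h1).trans h2.le

theorem exists_addsPath {l m : YoungDiagram} (h : l ≤ m) : ∃ w, AddsPath w l m := by
  by_cases hlm : l = m
  · exact ⟨[], hlm⟩
  · obtain ⟨p, k, h1, h2⟩ := exists_addsBox_of_lt h hlm
    have := h1.card
    obtain ⟨w, hw⟩ := exists_addsPath h2
    exact ⟨p :: w, k, hw, h1⟩
termination_by m.card

/-- Two peaks of a profile are never adjacent, so both boxes can be removed, in either order, and
their generators commute. -/
theorem exists_addsBox_square {p q : ℤ} {k k' m : YoungDiagram} (hpq : p ≠ q) (h : AddsBox p k m)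
    (h' : AddsBox q k' m) : p ≠ q - 1 ∧ p ≠ q + 1 ∧ ∃ n, AddsBox q n k ∧ AddsBox p n k' := by
  have h1 := exists_addsBox_iff'.mp ⟨k, h⟩
  have h2 := exists_addsBox_iff'.mp ⟨k', h'⟩
  have hp1 : p ≠ q - 1 := by
    rintro rfl
    rw [sub_add_cancel] at h1
    omega
  have hp2 : p ≠ q + 1 := by
    rintro rfl
    rw [add_sub_cancel_right] at h1
    omega
  obtain ⟨n, hn⟩ : ∃ n, AddsBox q n k := by
    rw [exists_addsBox_iff', h.prof_of_ne hpq.symm |>.symm, ← h.prof_of_ne (p := q - 1) hp1.symm,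
      ← h.prof_of_ne (p := q + 1) hp2.symm]
    exact h2
  refine ⟨hp1, hp2, n, hn, addsBox_iff.mpr fun x => ?_⟩
  have a1 := addsBox_iff.mp h x
  have a2 := addsBox_iff.mp h' x
  have a3 := addsBox_iff.mp hn x
  split_ifs at * <;> omega

/-- Any two orders of adding the boxes of a skew diagram are connected by commuting squares: paths
with different last boxes are compared with paths through the partition lacking both boxes. -/
theorem AddsPath.mono_eq {w w' : List ℤ} {l m : YoungDiagram} (h : AddsPath w l m)
    (h' : AddsPath w' l m) : mono w = mono w' := by
  have key : ∀ n, ∀ w w' : List ℤ, w.length = n → ∀ m, AddsPath w l m → AddsPath w' l m →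
      mono w = mono w' := by
    intro n
    induction n with
    | zero =>
      intro w w' hw m h h'
      have := h.card
      have := h'.card
      obtain rfl := List.length_eq_zero_iff.mp hw
      obtain rfl : w' = [] := List.length_eq_zero_iff.mp (by omega)
      rfl
    | succ n ih =>
      intro w w' hw m h h'
      have hc := h.card
      have hc' := h'.card
      rcases w with _ | ⟨q, u⟩
      · simp at hw
      rcases w' with _ | ⟨p, u'⟩
      · rw [List.length_nil] at hc'
        omega
      rw [List.length_cons] at hw hc hc'
      obtain ⟨k, h1, h2⟩ := h
      obtain ⟨k', h1', h2'⟩ := h'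
      rw [mono_cons, mono_cons]
      rcases eq_or_ne p q with rfl | hpq
      · obtain rfl := h2.left_unique h2'
        rw [ih u u' (by omega) k h1 h1']
      · obtain ⟨e1, e2, x, hx, hx'⟩ := exists_addsBox_square hpq h2' h2
        -- The profile of `x` is the pointwise minimum of those of `k` and `k'`, both of which
        -- contain `l`.
        have hl : l ≤ x := by
          rw [prof_le_iff]
          intro y
          have b1 := prof_le_iff.mp h1.le y
          have b2 := prof_le_iff.mp h1'.le y
          have b3 := addsBox_iff.mp hx y
          have b4 := addsBox_iff.mp hx' y
          split_ifs at * <;> omega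
        obtain ⟨v, hv⟩ := exists_addsPath hl
        rw [ih u (p :: v) (by omega) k h1 ⟨x, hv, hx'⟩,
          ih u' (q :: v) (by omega) k' h1' ⟨x, hv, hx⟩, mono_cons, mono_cons, ← mul_assoc,
          ← mul_assoc, T_comm_of_ne hpq e1 e2]
  exact key _ w w' rfl m h h'

-- Each of the two ways to reach `m` has at most one source. This form of the operator, by
-- coefficients of the image, serves both for extremal matrix entries and for the intertwining
-- identity.
open scoped Classical in
theorem fockOp_apply (q : ℤ) (v : ParZ) (m : YoungDiagram) : fockOp q v m =
    (if h : ∃ k, AddsBox q k m then v h.choose else 0) +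
      (if h : ∃ k, AddsBox (q - 1) m k then v h.choose else 0) := by
  induction v using Finsupp.induction_linear with
  | zero => simp
  | add v w hv hw =>
    rw [map_add, Finsupp.add_apply, hv, hw]
    split_ifs <;> (try simp only [Finsupp.add_apply]) <;> ring
  | single l a =>
    have e : Finsupp.single l a = a • basisVec l := by simp
    rw [e, map_smul, fockOp_basisVec, Finsupp.smul_apply, Finsupp.add_apply, addVec_apply,
      remVec_apply, smul_add]
    congr 1
    · split_ifs with h h' h'
      · rw [h.left_unique h'.choose_spec]; simp
      · exact absurd ⟨l, h⟩ h'
      · rw [Finsupp.smul_apply, basisVec, Finsupp.single_apply, if_neg]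
        rintro rfl
        exact h h'.choose_spec
      · simp
    · split_ifs with h h' h'
      · rw [h.right_unique h'.choose_spec]; simp
      · exact absurd ⟨l, h⟩ h'
      · rw [Finsupp.smul_apply, basisVec, Finsupp.single_apply, if_neg]
        rintro rfl
        exact h h'.choose_spec
      · simp

-- Each generator increases the size by at most one, so a target this large is reached only if every
-- letter adds a box. The inequality in the hypothesis, rather than equality, lets the induction
-- dispose of the terms that remove a box.
open scoped Classical in
theorem fockRep_mono_apply (w : List ℤ) {l m : YoungDiagram} (h : l.card + w.length ≤ m.card) :
    fockRep (mono w) (basisVec l) m = if AddsPath w l m then 1 else 0 := by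
  induction w generalizing m with
  | nil =>
    simp only [mono, List.map_nil, List.prod_nil, map_one, Module.End.one_apply, AddsPath]
    rw [basisVec, Finsupp.single_apply]
    congr
  | cons q w ih =>
    rw [List.length_cons] at h
    rw [mono_cons, map_mul, Module.End.mul_apply, fockRep_T, fockOp_apply]
    have h2 : (if h : ∃ k, AddsBox (q - 1) m k then
        fockRep (mono w) (basisVec l) h.choose else 0) = 0 := by
      split_ifs with h'
      · have hc := h'.choose_spec.card
        rw [ih (by omega), if_neg]
        intro hp
        have := hp.card
        omega
      · rfl
    rw [h2, add_zero]
    split_ifs with h1 h3 h3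
    · obtain ⟨k, hk, hk'⟩ := h3
      have hc := h1.choose_spec.card
      rw [ih (by omega), if_pos (hk'.left_unique h1.choose_spec ▸ hk)]
    · have hc := h1.choose_spec.card
      rw [ih (by omega), if_neg]
      exact fun hp => h3 ⟨_, hp, h1.choose_spec⟩
    · obtain ⟨k, hk, hk'⟩ := h3
      exact absurd ⟨k, hk'⟩ h1
    · rfl

/-! ### Realizing configurations on finite windows -/

theorem exists_primitive (s : ℤ → ℤ) : ∃ f : ℤ → ℤ, f 0 = 0 ∧ ∀ q, f (q + 1) = f q + s (q + 1) := by
  refine ⟨fun q => ∑ i ∈ Finset.range q.toNat, s (i + 1) - ∑ i ∈ Finset.range (-q).toNat, s (-i),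
    by simp, fun q => ?_⟩
  rcases le_or_gt 0 q with h | h
  · obtain ⟨n, rfl⟩ := Int.eq_ofNat_of_zero_le h
    have e1 : ((n : ℤ) + 1).toNat = n + 1 := by omega
    have e2 : (-((n : ℤ) + 1)).toNat = 0 := by omega
    have e3 : (-(n : ℤ)).toNat = 0 := by omega
    simp only [e1, e2, e3, Finset.sum_range_succ]
    simp
  · obtain ⟨n, rfl⟩ : ∃ n : ℕ, q = -(n + 1) := ⟨(-q - 1).toNat, by omega⟩
    have e1 : (-((n : ℤ) + 1) + 1).toNat = 0 := by omega
    have e2 : (-(-((n : ℤ) + 1) + 1)).toNat = n := by omega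
    have e3 : (-(-((n : ℤ) + 1))).toNat = n + 1 := by omega
    have e4 : (-((n : ℤ) + 1)).toNat = 0 := by omega
    have e5 : -((n : ℤ) + 1) + 1 = -n := by ring
    simp only [e1, e2, e3, e4, Finset.sum_range_succ]
    rw [e5]
    simp

/-- The path `f` has the prescribed steps on the window and falls away from it on both sides. Lifted
high enough, it determines the maximum with |q| on the window, and |q| takes over far out. -/
theorem exists_bead_eq (b : ℤ → Bool) (N : ℕ) :
    ∃ l, ∀ x : ℤ, -N ≤ x → x ≤ N → bead l x = b x := by
  obtain ⟨f, f0, hf⟩ := exists_primitive fun x =>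
    if x < -N then 1 else if (N : ℤ) < x then -1 else if b x then -1 else 1
  have hstep : ∀ q, f (q + 1) = f q + 1 ∨ f (q + 1) = f q - 1 := by
    intro q
    rw [hf]
    split_ifs <;> omega
  have hpos : ∀ q : ℤ, 0 ≤ q → -q ≤ f q ∧ f q ≤ q ∧ (f q - q) % 2 = 0 := by
    intro q hq
    induction q, hq using Int.leInduction with
    | base => omega
    | succ n _ ih => have := hstep n; omega
  have hneg : ∀ q : ℤ, q ≤ 0 → q ≤ f q ∧ f q ≤ -q ∧ (f q - q) % 2 = 0 := by
    intro q hq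
    induction q, hq using Int.leInductionDown with
    | base => omega
    | pred n _ ih => have := hstep (n - 1); rw [sub_add_cancel] at this; omega
  have hright : ∀ q : ℤ, (N : ℤ) ≤ q → f q ≤ 2 * N - q := by
    intro q hq
    induction q, hq using Int.leInduction with
    | base => have := hpos N (by omega); omega
    | succ n hn ih =>
      have := hf n
      rw [if_neg (by omega), if_pos (by omega)] at this
      omega
  have hleft : ∀ q : ℤ, q ≤ -N - 1 → f q ≤ 2 * N + 2 + q := by
    intro q hq
    induction q, hq using Int.leInductionDown with
    | base => have := hneg (-N - 1) (by omega); omega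
    | pred n hn ih =>
      have := hf (n - 1)
      rw [sub_add_cancel, if_pos (by omega)] at this
      omega
  -- Since f ≥ -|q|, and |q| ≤ N+1 on the window extended by one site to the left, the lift 2N+2
  -- suffices there. It is even, as parity demands.
  obtain ⟨l, hl⟩ := exists_prof_eq (fun q => max (q.natAbs : ℤ) (f q + (2 * N + 2)))
    (fun q => le_max_left _ _)
    (fun q => by
      rcases le_total 0 q with h | h
      · have := hpos q h; omega
      · have := hneg q h; omega)
    (fun q => by have := hstep q; omega)
    ⟨4 * N + 4, fun q hq => by
      rcases le_total 0 q with h | h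
      · have := hright q (by omega); omega
      · have := hleft q (by omega); omega⟩
  have hwin : ∀ x : ℤ, -N - 1 ≤ x → x ≤ N → prof l x = f x + (2 * N + 2) := by
    intro x h1 h2
    simp only [hl]
    rcases le_total 0 x with h | h
    · have := hpos x h; omega
    · have := hneg x h; omega
  refine ⟨l, fun x h1 h2 => ?_⟩
  have h3 := hwin x (by omega) h2
  have h4 := hwin (x - 1) (by omega) (by omega)
  have h5 := hf (x - 1)
  rw [sub_add_cancel, if_neg (by omega), if_neg (by omega)] at h5
  cases hb : b x
  · rw [hb, if_neg (by simp)] at h5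
    rw [bead_eq_false]
    omega
  · rw [hb, if_pos rfl] at h5
    rw [bead_eq_true]
    omega

theorem exists_addsPath_of_runs {w : List ℤ} {b : ℤ → Bool} {l : YoungDiagram} (A : Set ℤ)
    (hA : ∀ x ∈ A, bead l x = b x) (hw : Runs w b) (h : ∀ p ∈ w, p ∈ A ∧ p + 1 ∈ A) :
    ∃ m, AddsPath w l m ∧ ∀ x ∈ A, bead m x = run w b x := by
  induction w with
  | nil => exact ⟨l, rfl, hA⟩
  | cons q w ih =>
    obtain ⟨k, hk, hkA⟩ := ih hw.1 fun p hp => h p (List.mem_cons_of_mem _ hp)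
    obtain ⟨h1, h2⟩ := h q List.mem_cons_self
    obtain ⟨m, hm⟩ := exists_addsBox_iff_bead.mpr
      ⟨(hkA q h1).trans hw.2.1, (hkA _ h2).trans hw.2.2⟩
    refine ⟨m, ⟨k, hk, hm⟩, fun x hx => ?_⟩
    rw [bead_hop_right hm, run, hop_apply, hop_apply, hkA x hx]

theorem exists_addsPath_of_exists_runs {w : List ℤ} {b : ℤ → Bool} (hw : Runs w b) :
    ∃ l m, AddsPath w l m := by
  obtain ⟨N, hN⟩ : ∃ N : ℕ, ∀ p ∈ w, p.natAbs + 1 ≤ N := by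
    clear hw
    induction w with
    | nil => exact ⟨0, by simp⟩
    | cons q w ih =>
      obtain ⟨N, hN⟩ := ih
      refine ⟨max N (q.natAbs + 1), fun p hp => ?_⟩
      rcases List.mem_cons.mp hp with rfl | hp
      · exact le_max_right _ _
      · exact (hN p hp).trans (le_max_left _ _)
  obtain ⟨l, hl⟩ := exists_bead_eq b N
  obtain ⟨m, hm, -⟩ := exists_addsPath_of_runs (l := l) (Set.Icc (-N : ℤ) N)
    (fun x hx => hl x hx.1 hx.2) hw (fun p hp => by
      have := hN p hp
      simp only [Set.mem_Icc]
      omega)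
  exact ⟨l, m, hm⟩

/-! ### Faithfulness -/

-- A longest word leads from some `l` to some `m`. The entry at (l, m) is then the sum of the
-- coefficients of all words leading from `l` to `m`; these have the same monomial, so their terms
-- cancel and can be dropped. The induction is on the number of words.
open scoped Classical in
theorem sum_mono_eq_zero (n : ℕ) : ∀ (S : Finset (List ℤ)) (a : List ℤ → ℤ), S.card ≤ n →
    (∀ w ∈ S, ∃ b, Runs w b) → fockRep (∑ w ∈ S, a w • mono w) = 0 →
    ∑ w ∈ S, a w • mono w = 0 := by
  induction n with
  | zero =>
    intro S a hS _ _
    rw [Finset.card_eq_zero.mp (Nat.le_zero.mp hS), Finset.sum_empty]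
  | succ n ih =>
    intro S a hS hruns h0
    rcases S.eq_empty_or_nonempty with rfl | hne
    · simp
    obtain ⟨w, hwS, hmax⟩ := S.exists_max_image List.length hne
    obtain ⟨b, hb⟩ := hruns w hwS
    obtain ⟨l, m, hlm⟩ := exists_addsPath_of_exists_runs hb
    have hc := hlm.card
    have hcoef : ∑ u ∈ S with AddsPath u l m, a u = 0 := by
      have := congrArg (fun f : Module.End ℤ ParZ => f (basisVec l) m) h0
      rw [map_sum] at this
      simp only [LinearMap.sum_apply, Finsupp.finsetSum_apply, LinearMap.zero_apply,
        Finsupp.zero_apply] at this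
      rw [Finset.sum_filter]
      refine (Finset.sum_congr rfl fun u hu => ?_).trans this
      have e : fockRep (a u • mono u) = a u • fockRep (mono u) := map_zsmul _ _ _
      rw [e, LinearMap.smul_apply, Finsupp.smul_apply,
        fockRep_mono_apply u (by have := hmax u hu; omega)]
      split_ifs <;> simp
    have hpart : ∑ u ∈ S with AddsPath u l m, a u • mono u = 0 := by
      have e : (∑ u ∈ S with AddsPath u l m, a u) • mono w = 0 := by
        rw [hcoef]
        exact zero_zsmul _
      rw [← e]
      refine Eq.trans ?_ (Finset.sum_smul ..).symm
      refine Finset.sum_congr rfl fun u hu => ?_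
      rw [(Finset.mem_filter.mp hu).2.mono_eq hlm]
      rfl
    rw [← Finset.sum_filter_add_sum_filter_not S (fun u => AddsPath u l m), hpart, zero_add] at h0 ⊢
    refine ih _ a ?_ (fun u hu => hruns u (Finset.mem_filter.mp hu).1) h0
    have : (S.filter fun u => ¬ AddsPath u l m).card < S.card :=
      Finset.card_lt_card (Finset.filter_ssubset.mpr ⟨w, hwS, not_not.mpr hlm⟩)
    omega

theorem fockRep_injective : Function.Injective fockRep := by
  rw [injective_iff_map_eq_zero]
  intro x hx
  have hspan : x ∈ Submodule.span ℤ (mono '' {w | ∃ b, Runs w b}) := by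
    have : x ∈ Submodule.span ℤ (Set.range mono) := span_mono_eq_top ▸ Submodule.mem_top
    refine Submodule.span_le.mpr ?_ this
    rintro _ ⟨w, rfl⟩
    rcases mono_eq_zero_or_runs _ w le_rfl with h | ⟨w', b, hb, -, he⟩
    · rw [h]; exact zero_mem _
    · exact Submodule.subset_span ⟨w', ⟨b, hb⟩, he⟩
  obtain ⟨a, ha, rfl⟩ := (Finsupp.mem_span_image_iff_linearCombination ℤ).mp hspan
  rw [Finsupp.linearCombination_apply] at hx ⊢
  exact sum_mono_eq_zero _ a.support a le_rfl
    (fun w hw => (Finsupp.mem_supported ℤ a).mp ha hw) hx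

end

end TLFock

/-! ### Excursions of the difference of two paths, and their change under adding a box -/

namespace TLFock

/-! ### Excursions -/

/-- The function `d` rises at `s` and falls below its value at `s` for the first time at `z`. -/
def Exc (d : ℤ → ℤ) (s z : ℤ) : Prop :=
  s < z ∧ d (s - 1) < d s ∧ (∀ c, s ≤ c → c < z → d s ≤ d c) ∧ d z < d s

/-- The function `G` returns at `z` to its value at `s` without falling below it. -/
def Returns (G : ℤ → ℤ) (s z : ℤ) : Prop :=
  G z = G s ∧ ∀ c, s ≤ c → c ≤ z → G s ≤ G c

/-- `d` is nonnegative, and `G` returns along all excursions of `d`. -/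
def Gam (G d : ℤ → ℤ) : Prop :=
  (∀ c, 0 ≤ d c) ∧ ∀ s z, Exc d s z → Returns G s z

/-- `f` changes by `1` or `-1` in each step. -/
def UnitSteps (f : ℤ → ℤ) : Prop := ∀ c, f c = f (c - 1) + 1 ∨ f c = f (c - 1) - 1

/-- `G` and `F` are paths with difference `2 d`, and `d` has finite support. -/
structure PathPair (G F d : ℤ → ℤ) : Prop where
  left : UnitSteps G
  right : UnitSteps F
  diff : ∀ c, G c = F c + 2 * d c
  fin : ∃ N : ℤ, ∀ c, (c ≤ -N ∨ N ≤ c) → d c = 0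

theorem exists_level_end {d : ℤ → ℤ} (hfin : ∃ N : ℤ, ∀ c, (c ≤ -N ∨ N ≤ c) → d c = 0) {p v : ℤ}
    (hv : 0 < v) (hp : v ≤ d p) : ∃ z, p < z ∧ d z < v ∧ ∀ c, p ≤ c → c < z → v ≤ d c := by
  obtain ⟨N, hN⟩ := hfin
  obtain ⟨z, ⟨hz1, hz2⟩, hz3⟩ := Int.exists_least_of_bdd (P := fun z => p < z ∧ d z < v)
    ⟨p, fun z hz => hz.1.le⟩ ⟨max N (p + 1), by omega, by rw [hN _ (by omega)]; exact hv⟩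
  refine ⟨z, hz1, hz2, fun c hc hcz => ?_⟩
  by_contra! h
  rcases hc.eq_or_lt with rfl | hc
  · omega
  · have := hz3 c ⟨hc, h⟩
    omega

theorem exists_level_start {d : ℤ → ℤ} (hfin : ∃ N : ℤ, ∀ c, (c ≤ -N ∨ N ≤ c) → d c = 0) {p v : ℤ}
    (hv : 0 < v) (hp : v ≤ d p) : ∃ s, s ≤ p ∧ d (s - 1) < v ∧ ∀ c, s ≤ c → c ≤ p → v ≤ d c := by
  obtain ⟨N, hN⟩ := hfin
  obtain ⟨s, ⟨hs1, hs2⟩, hs3⟩ := Int.exists_greatest_of_bdd (P := fun s => s ≤ p ∧ d (s - 1) < v)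
    ⟨p, fun z hz => hz.1⟩ ⟨min (-N) p, by omega, by rw [hN _ (by omega)]; exact hv⟩
  refine ⟨s, hs1, hs2, fun c hc hcp => ?_⟩
  by_contra! h
  rcases hcp.eq_or_lt with rfl | hcp
  · omega
  · have := hs3 (c + 1) ⟨by omega, by simpa using h⟩
    omega

variable {G F d : ℤ → ℤ}

theorem PathPair.step (h : PathPair G F d) (c : ℤ) :
    d (c - 1) - 1 ≤ d c ∧ d c ≤ d (c - 1) + 1 := by
  have := h.left c
  have := h.right c
  have := h.diff c
  have := h.diff (c - 1)
  omega

/-- The excursion is the maximal interval around `p` on which d ≥ v. As `d` has steps of size at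
most one, it enters this interval exactly at height `v`. -/
theorem PathPair.exists_exc (h : PathPair G F d) {p v : ℤ} (hv : 0 < v) (hp : v ≤ d p) :
    ∃ s z, s ≤ p ∧ p < z ∧ Exc d s z ∧ d s = v ∧ ∀ c, s ≤ c → c < z → v ≤ d c := by
  obtain ⟨s, hs1, hs2, hs3⟩ := exists_level_start h.fin hv hp
  obtain ⟨z, hz1, hz2, hz3⟩ := exists_level_end h.fin hv hp
  have h1 := hs3 s le_rfl hs1
  have h2 := h.step s
  have h3 : ∀ c, s ≤ c → c < z → v ≤ d c := fun c hc hc' => by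
    rcases le_total c p with h | h
    · exact hs3 c hc h
    · exact hz3 c h hc'
  have h4 : d s = v := by omega
  exact ⟨s, z, hs1, hz1, ⟨by omega, by omega, by rwa [h4], by omega⟩, h4, h3⟩

theorem PathPair.exists_exc_of_rise (h : PathPair G F d) (h0 : ∀ c, 0 ≤ d c) {s : ℤ}
    (hs : d (s - 1) < d s) : ∃ z, Exc d s z := by
  have := h0 (s - 1)
  obtain ⟨z, hz1, hz2, hz3⟩ := exists_level_end h.fin (by omega) (le_refl (d s))
  exact ⟨z, hz1, hs, hz3, hz2⟩

theorem PathPair.exists_exc_of_fall (h : PathPair G F d) (h0 : ∀ c, 0 ≤ d c) {z : ℤ}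
    (hz : d z < d (z - 1)) : ∃ s, Exc d s z ∧ d s = d (z - 1) := by
  have := h0 z
  obtain ⟨s, z', hs, hz', he, hd, hle⟩ := h.exists_exc (p := z - 1) (by omega) le_rfl
  have : z' = z := by
    by_contra hne
    have := hle z (by omega) (by omega)
    omega
  exact ⟨s, this ▸ he, hd⟩

theorem PathPair.rise (h : PathPair G F d) {s : ℤ} (hs : d (s - 1) < d s) :
    G s = G (s - 1) + 1 ∧ F s = F (s - 1) - 1 ∧ d s = d (s - 1) + 1 := by
  have := h.left s
  have := h.right s
  have := h.diff s
  have := h.diff (s - 1)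
  omega

theorem PathPair.fall (h : PathPair G F d) {s : ℤ} (hs : d s < d (s - 1)) :
    G s = G (s - 1) - 1 ∧ F s = F (s - 1) + 1 ∧ d s = d (s - 1) - 1 := by
  have := h.left s
  have := h.right s
  have := h.diff s
  have := h.diff (s - 1)
  omega

/-- If `G` falls to its starting value inside an excursion, then `F` falls in the same step. -/
theorem Gam.step_eq (h : PathPair G F d) (hg : Gam G d) {s z p : ℤ} (he : Exc d s z) (hsp : s < p)
    (hpz : p < z) (hp : G p = G s) : G p = G (p - 1) - 1 ∧ F p = F (p - 1) - 1 := by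
  obtain ⟨-, hr⟩ := hg.2 s z he
  have h1 := hr (p - 1) (by omega) (by omega)
  have h2 := h.left p
  refine ⟨by omega, ?_⟩
  by_contra hF
  have h3 := h.right p
  have h4 := h.diff p
  have h5 := h.diff (p - 1)
  -- If `F` rose here, `d` would fall and end an excursion that starts at some s' > s. `G` returns
  -- along it, so G s' = G s, and as `G` rises at s' it lies below G s at s'-1.
  obtain ⟨s', he', hd⟩ := h.exists_exc_of_fall hg.1 (z := p) (by omega)
  have h6 := he.2.2.1 p hsp.le hpz
  have h7 : s < s' := by
    by_contra! hle
    have := he'.2.2.1 s hle hsp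
    have := he'.2.2.2
    omega
  have h8 := (h.rise he'.2.1).1
  have h9 := (hg.2 s' p he').1
  have h10 := hr (s' - 1) (by omega) (by have := he'.1; omega)
  omega

section AddBox

variable {G' d' : ℤ → ℤ} {q : ℤ}

/-- `d` rises at `q`, so an excursion starts at the peak of `G'`, which falls below its initial
height in the very next step. -/
theorem not_gam_of_fall (h' : PathPair G' F d) (h1 : G' q = G' (q - 1) + 1)
    (h2 : G' (q + 1) = G' q - 1) (hF : F q = F (q - 1) - 1) : ¬ Gam G' d := by
  intro hg
  have h3 := h'.diff q
  have h4 := h'.diff (q - 1)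
  obtain ⟨z, hz⟩ := h'.exists_exc_of_rise hg.1 (s := q) (by omega)
  have := (hg.2 q z hz).2 (q + 1) (by omega) (by have := hz.1; omega)
  omega

/-- No excursion starts or ends at `q`, since `d` does not change there; raising an interior value
of `G` is harmless. -/
theorem Gam.raise (hq : G' q = G q + 2) (hne : ∀ c, c ≠ q → G' c = G c)
    (h1 : d (q - 1) = d q) (hg : Gam G d) : Gam G' d := by
  refine ⟨hg.1, fun s z he => ?_⟩
  obtain ⟨h3, h4⟩ := hg.2 s z he
  have hs : s ≠ q := by rintro rfl; have := he.2.1; omega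
  have hz : z ≠ q := by
    rintro rfl
    have := he.2.2.1 (z - 1) (by have := he.1; omega) (by omega)
    have := he.2.2.2
    omega
  refine ⟨by rw [hne z hz, hne s hs, h3], fun c hc hc' => ?_⟩
  rw [hne s hs]
  have := h4 c hc hc'
  by_cases hcq : c = q
  · subst hcq; omega
  · rw [hne c hcq]; exact this

/-- The excursion along which `G` fails to return. -/
theorem exists_exc_of_not_gam (h' : PathPair G' F d) (hq : G' q = G q + 2)
    (hne : ∀ c, c ≠ q → G' c = G c) (h1 : G' q = G' (q - 1) + 1) (h2 : G' (q + 1) = G' q - 1)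
    (hd : d (q - 1) = d q) (hg' : Gam G' d) (hg : ¬ Gam G d) :
    ∃ s z, Exc d s z ∧ s < q ∧ q + 1 ≤ z ∧ G' (q - 1) = G' s := by
  by_contra! hno
  refine hg ⟨hg'.1, fun s z he => ?_⟩
  obtain ⟨h3, h4⟩ := hg'.2 s z he
  have hs : s ≠ q := by rintro rfl; have := he.2.1; omega
  have hz : z ≠ q := by
    rintro rfl
    have := he.2.2.1 (z - 1) (by have := he.1; omega) (by omega)
    have := he.2.2.2
    omega
  refine ⟨by rw [← hne z hz, ← hne s hs, h3], fun c hc hc' => ?_⟩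
  rw [← hne s hs]
  by_cases hcq : c = q
  · subst hcq
    have h5 := hno s z he (by omega) (by omega)
    have h6 := h4 (c - 1) (by omega) (by omega)
    have h7 := h'.left c
    omega
  · rw [← hne c hcq]; exact h4 c hc hc'

/-- Lowering `d` at q-1 and q cuts the excursion (s, z), along which `G` dips at `q`, into (s, q-1),
absent if s = q-1, and (q+1, z). Neither piece contains the dip, and the other excursions of `d'`
are excursions of `d`. -/
theorem Gam.lower_of_peak (h' : PathPair G' F d) (hq : G' q = G q + 2)
    (hne : ∀ c, c ≠ q → G' c = G c) (h1 : G' q = G' (q - 1) + 1) (h2 : G' (q + 1) = G' q - 1)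
    (hd : d (q - 1) = d q) (hd1 : d (q + 1) = d q)
    (h2q : d' q = d q - 1) (h2q' : d' (q - 1) = d (q - 1) - 1)
    (h2ne : ∀ c, c ≠ q → c ≠ q - 1 → d' c = d c) (hg' : Gam G' d) {s z : ℤ}
    (he : Exc d s z) (hsq : s < q) (hqz : q + 1 ≤ z) (hGs : G' (q - 1) = G' s) :
    F (q - 1) = F (q - 2) - 1 ∧ Gam G d' := by
  have e2 : q - 2 = q - 1 - 1 := by ring
  have hqz' : q + 1 < z := by
    rcases hqz.lt_or_eq with h | rfl
    · exact h
    · have := he.2.2.1 q hsq.le (by omega)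
      have := he.2.2.2
      omega
  obtain ⟨hz, hr⟩ := hg'.2 s z he
  have hF : F (q - 1) = F (q - 1 - 1) - 1 ∧
      (s = q - 1 ∨ s < q - 1 ∧ G' (q - 1) = G' (q - 1 - 1) - 1 ∧ d (q - 1 - 1) = d (q - 1)) := by
    rcases eq_or_ne s (q - 1) with rfl | hs
    · exact ⟨(h'.rise he.2.1).2.1, Or.inl rfl⟩
    · have h3 := hg'.step_eq h' he (p := q - 1) (by omega) (by omega) hGs
      have := h'.diff (q - 1)
      have := h'.diff (q - 1 - 1)
      exact ⟨h3.2, Or.inr ⟨by omega, h3.1, by omega⟩⟩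
  have hds : d s ≤ d (q - 1) := he.2.2.1 (q - 1) (by omega) (by omega)
  have hs0 : 0 ≤ d (s - 1) := hg'.1 _
  have hpos : 0 < d s := by have := he.2.1; omega
  -- Otherwise the excursion around q-1 at level d (q-1) starts at some s' > s with G' s' ≤ G' (q-1)
  -- = G' s, and the rise of `G'` at s' puts its value at s'-1 below G' s.
  have hdeq : d (q - 1) = d s := by
    by_contra hlt
    obtain ⟨s', z', hs', hz', he', hv, hle⟩ :=
      h'.exists_exc (p := q - 1) (v := d (q - 1)) (by omega) le_rfl
    have hss : s < s' := by
      by_contra! hcon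
      have := hle s hcon (by omega)
      omega
    have h3 := (hg'.2 s' z' he').2 (q - 1) hs' (by omega)
    have h4 := (h'.rise he'.2.1).1
    have h5 := hr (s' - 1) (by omega) (by omega)
    omega
  refine ⟨by rw [e2]; exact hF.1, fun c => ?_, fun a b hab => ?_⟩
  · by_cases c1 : c = q
    · subst c1; omega
    · by_cases c2 : c = q - 1
      · subst c2; omega
      · rw [h2ne c c1 c2]; exact hg'.1 c
  obtain ⟨hab1, hab2, hab3, hab4⟩ := hab
  have hdle : ∀ c, d' c ≤ d c := fun c => by
    by_cases c1 : c = q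
    · subst c1; omega
    · by_cases c2 : c = q - 1
      · subst c2; omega
      · rw [h2ne c c1 c2]
  have hstep := h'.step (q - 1)
  have ha1 : a ≠ q - 1 := by
    rintro rfl
    rw [h2ne (q - 1 - 1) (by omega) (by omega)] at hab2
    rcases hF.2 with h | h
    · subst h
      have := h'.rise he.2.1
      omega
    · omega
  have ha2 : a ≠ q := by rintro rfl; omega
  have hb2 : b ≠ q := by
    rintro rfl
    have := hab3 (b - 1) (by omega) (by omega)
    omega
  have hb3 : b ≠ q + 1 := by
    rintro rfl
    rw [h2ne (q + 1) (by omega) (by omega)] at hab4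
    have := hab3 q (by omega) (by omega)
    omega
  have hda : d' a = d a := h2ne a ha2 ha1
  rcases eq_or_ne a (q + 1) with rfl | ha3
  · have hbz : b = z := by
      rcases lt_trichotomy b z with h | h | h
      · have h3 := he.2.2.1 b (by omega) h
        rw [h2ne b (by omega) (by omega)] at hab4
        omega
      · exact h
      · have h3 := hab3 z (by omega) h
        have h4 := he.2.2.2
        rw [h2ne z (by omega) (by omega)] at h3
        omega
    subst hbz
    refine ⟨?_, fun c hc hc' => ?_⟩
    · rw [← hne b (by omega), ← hne (q + 1) (by omega)]
      omega
    · rw [← hne c (by omega), ← hne (q + 1) (by omega)]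
      have := hr c (by omega) hc'
      omega
  rcases eq_or_ne b (q - 1) with rfl | hb1
  · have has : a = s := by
      rcases hF.2 with h | ⟨h3, h4, h5⟩
      · have h6 := hab3 (q - 1 - 1) (by omega) (by omega)
        rw [h2ne (q - 1 - 1) (by omega) (by omega)] at h6
        subst h
        have := h'.rise he.2.1
        omega
      · have h6 := hab3 (q - 1 - 1) (by omega) (by omega)
        rw [h2ne (q - 1 - 1) (by omega) (by omega)] at h6
        rw [h2ne (a - 1) (by omega) (by omega)] at hab2
        rcases lt_trichotomy a s with h | h | h
        · have h7 := hab3 (s - 1) (by omega) (by omega)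
          rw [h2ne (s - 1) (by omega) (by omega)] at h7
          have := he.2.1
          omega
        · exact h
        · have h7 := he.2.2.1 (a - 1) (by omega) (by omega)
          omega
    subst has
    refine ⟨?_, fun c hc hc' => ?_⟩
    · rw [← hne (q - 1) (by omega), ← hne a (by omega)]
      omega
    · rw [← hne c (by omega), ← hne a (by omega)]
      exact hr c hc (by omega)
  have hexc : Exc d a b := by
    refine ⟨hab1, ?_, fun c hc hc' => ?_, ?_⟩
    · rwa [h2ne (a - 1) (by omega) (by omega), hda] at hab2
    · have := hab3 c hc hc'
      have := hdle c
      omega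
    · rwa [h2ne b hb2 hb1, hda] at hab4
  obtain ⟨h3, h4⟩ := hg'.2 a b hexc
  refine ⟨by rw [← hne b hb2, ← hne a ha2, h3], fun c hc hc' => ?_⟩
  rw [← hne a ha2]
  by_cases hcq : c = q
  · subst hcq
    have h5 := hab3 c hc (by omega)
    have has : a < s := by
      rcases lt_trichotomy a s with h | h | h
      · exact h
      · subst h; omega
      · have := he.2.2.1 a h.le (by omega)
        omega
    -- An excursion of `d'` across `q` starts before `s`. The dip G q = G' s - 1 equals G' (s-1),
    -- which is still at least G' a.
    have h6 := h4 (s - 1) (by omega) (by omega)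
    have h7 := (h'.rise he.2.1).1
    omega
  · rw [← hne c hcq]
    exact h4 c hc hc'

theorem Exc.right_unique {s z z' : ℤ} (h : Exc d s z) (h' : Exc d s z') : z = z' := by
  rcases lt_trichotomy z z' with hz | hz | hz
  · have := h'.2.2.1 z h.1.le hz
    have := h.2.2.2
    omega
  · exact hz
  · have := h.2.2.1 z' h'.1.le hz
    have := h'.2.2.2
    omega

/-- The converse of the cut: raising `d` at q-1 and q merges the pieces into one excursion. `G'`
returns along it, but `G` does not, because G q lies one below the initial height. -/
theorem Gam.raise_of_lower {F' : ℤ → ℤ} (h' : PathPair G' F d) (h : PathPair G F' d')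
    (hq : G' q = G q + 2) (hne : ∀ c, c ≠ q → G' c = G c) (h1 : G' q = G' (q - 1) + 1)
    (h2 : G' (q + 1) = G' q - 1) (hd : d (q - 1) = d q) (hd1 : d (q + 1) = d q)
    (h2q : d' q = d q - 1) (h2q' : d' (q - 1) = d (q - 1) - 1)
    (h2ne : ∀ c, c ≠ q → c ≠ q - 1 → d' c = d c) (hF : F (q - 1) = F (q - 2) - 1)
    (hg : Gam G d') : Gam G' d ∧ ¬ Gam G d := by
  rw [show q - 2 = q - 1 - 1 by ring] at hF
  have hdle : ∀ c, d' c ≤ d c := fun c => by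
    by_cases c1 : c = q
    · subst c1; omega
    · by_cases c2 : c = q - 1
      · subst c2; omega
      · rw [h2ne c c1 c2]
  have hGle : ∀ c, G c ≤ G' c := fun c => by
    by_cases c1 : c = q
    · subst c1; omega
    · rw [hne c c1]
  have e1 := hne (q - 1) (by omega)
  have e2 := hne (q + 1) (by omega)
  have e3 := h2ne (q - 1 - 1) (by omega) (by omega)
  have e4 := h2ne (q + 1) (by omega) (by omega)
  have hq0 := hg.1 q
  obtain ⟨z, hz⟩ := h.exists_exc_of_rise hg.1 (s := q + 1) (by rw [add_sub_cancel_right]; omega)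
  obtain ⟨hz1, hz2⟩ := hg.2 _ _ hz
  obtain ⟨hz3, -, hz4, hz5⟩ := hz
  have e5 := h2ne z (by omega) (by omega)
  have hdl := h'.diff (q - 1)
  have hdl' := h'.diff (q - 1 - 1)
  have hprev : d (q - 1 - 1) ≤ d (q - 1) := by
    have := h'.left (q - 1)
    omega
  obtain ⟨s, hsq, he, hds, hGs, hr⟩ : ∃ s, s < q ∧ Exc d s z ∧ d s = d q ∧ G' s = G' (q - 1) ∧
      ∀ c, s ≤ c → c ≤ q - 1 → G' s ≤ G' c := by
    -- The merged excursion starts at q-1 if `d` rises there, and otherwise where the excursion of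
    -- `d'` that ends at q-1 starts.
    rcases h'.left (q - 1) with hup | hdown
    · refine ⟨q - 1, by omega, ⟨by omega, by omega, fun c hc hc' => ?_, by omega⟩, hd, rfl, ?_⟩
      · rcases eq_or_ne c (q - 1) with rfl | c1
        · rfl
        rcases eq_or_ne c q with rfl | c2
        · omega
        · have := hz4 c (by omega) hc'
          have := hdle c
          omega
      · intro c hc hc'
        rw [show c = q - 1 by omega]
    · obtain ⟨s, hs, hsd⟩ := h.exists_exc_of_fall hg.1 (z := q - 1) (by omega)
      obtain ⟨r1, r2⟩ := hg.2 _ _ hs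
      obtain ⟨s1, s2, s3, s4⟩ := hs
      have f1 := h2ne s (by omega) (by omega)
      have f2 := h2ne (s - 1) (by omega) (by omega)
      have f3 := hne s (by omega)
      refine ⟨s, by omega, ⟨by omega, by omega, fun c hc hc' => ?_, by omega⟩, by omega, by omega,
        fun c hc hc' => ?_⟩
      · rcases eq_or_ne c (q - 1) with rfl | c1
        · omega
        rcases eq_or_ne c q with rfl | c2
        · omega
        have := hdle c
        rcases lt_or_ge c (q - 1) with c3 | c3
        · have := s3 c hc c3
          omega
        · have := hz4 c (by omega) hc'
          omega
      · have := r2 c hc hc'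
        have := hGle c
        omega
  have hret : Returns G' s z := by
    refine ⟨by rw [hne z (by omega)]; omega, fun c hc hc' => ?_⟩
    rcases le_or_gt c (q - 1) with c1 | c1
    · exact hr c hc c1
    rcases eq_or_ne c q with rfl | c2
    · omega
    · have := hz2 c (by omega) hc'
      have := hGle c
      omega
  constructor
  swap
  · intro hcon
    have := (hcon.2 s z he).2 q hsq.le (by omega)
    have := hne s (by omega)
    omega
  refine ⟨fun c => (hg.1 c).trans (hdle c), fun a b hab => ?_⟩
  rcases eq_or_ne a s with rfl | has
  · rwa [hab.right_unique he]
  obtain ⟨hab1, hab2, hab3, hab4⟩ := hab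
  have ha2 : a ≠ q := by rintro rfl; omega
  have ha3 : a ≠ q + 1 := by rintro rfl; rw [add_sub_cancel_right] at hab2; omega
  have ha1 : a ≠ q - 1 := by
    rintro rfl
    have := he.2.2.1 (q - 1 - 1) (by omega) (by omega)
    omega
  have hb1 : b ≠ q - 1 := by
    rintro rfl
    have := hab3 (q - 1 - 1) (by omega) (by omega)
    omega
  have hb2 : b ≠ q := by
    rintro rfl
    have := hab3 (b - 1) (by omega) (by omega)
    omega
  have f1 := h2ne a ha2 ha1
  have f2 := h2ne b hb2 hb1
  have f3 := h2ne (a - 1) (by omega) (by omega)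
  have hexc : Exc d' a b := by
    refine ⟨hab1, by omega, fun c hc hc' => ?_, by omega⟩
    have h3 := hab3 c hc hc'
    have key : c = q ∨ c = q - 1 → d a < d q := by
      intro hcq
      rcases lt_or_gt_of_ne has with h4 | h4
      · have := hab3 (s - 1) (by omega) (by omega)
        have := he.2.1
        omega
      · have h5 := he.2.2.1 (a - 1) (by omega) (by omega)
        have h6 := hab3 (q - 1) (by omega) (by omega)
        omega
    by_cases c1 : c = q
    · have := key (Or.inl c1)
      subst c1
      omega
    · by_cases c2 : c = q - 1
      · have := key (Or.inr c2)
        subst c2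
        omega
      · rw [h2ne c c1 c2]; omega
  obtain ⟨r1, r2⟩ := hg.2 a b hexc
  refine ⟨by rw [hne b hb2, hne a ha2, r1], fun c hc hc' => ?_⟩
  have := r2 c hc hc'
  have := hGle c
  have := hne a ha2
  omega

/-- Passing from `d` to `d'` moves the end of the excursions ending at q+1 back to q-1, or deletes
them if they start at q-1. Both ends are equally high, as `q` is a peak of `G'`. The other
excursions keep their ends. -/
theorem gam_iff_of_rise (h' : PathPair G' F d)
    (hq : G' q = G q + 2) (hne : ∀ c, c ≠ q → G' c = G c) (h1 : G' q = G' (q - 1) + 1)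
    (h2 : G' (q + 1) = G' q - 1) (hd : d (q - 1) = d q) (hd1 : d (q + 1) = d q - 1)
    (h2q : d' q = d q - 1) (h2q' : d' (q - 1) = d (q - 1) - 1)
    (h2ne : ∀ c, c ≠ q → c ≠ q - 1 → d' c = d c) (hF : F (q - 1) = F (q - 2) - 1) :
    Gam G' d ↔ Gam G d' := by
  rw [show q - 2 = q - 1 - 1 by ring] at hF
  have hdle : ∀ c, d' c ≤ d c := fun c => by
    by_cases c1 : c = q
    · subst c1; omega
    · by_cases c2 : c = q - 1
      · subst c2; omega
      · rw [h2ne c c1 c2]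
  have hGle : ∀ c, G c ≤ G' c := fun c => by
    by_cases c1 : c = q
    · subst c1; omega
    · rw [hne c c1]
  have e1 := hne (q - 1) (by omega)
  have e2 := hne (q + 1) (by omega)
  have e3 := h2ne (q - 1 - 1) (by omega) (by omega)
  have e4 := h2ne (q + 1) (by omega) (by omega)
  have hdl := h'.diff (q - 1)
  have hdl' := h'.diff (q - 1 - 1)
  have hprev : d (q - 1 - 1) = d (q - 1) ∨ d (q - 1 - 1) = d (q - 1) - 1 := by
    have := h'.left (q - 1)
    omega
  constructor
  · intro hg
    have hpos := hg.1 (q + 1)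
    obtain ⟨s, he, hds⟩ := h'.exists_exc_of_fall hg.1 (z := q + 1)
      (by rw [add_sub_cancel_right]; omega)
    rw [add_sub_cancel_right] at hds
    have hret := hg.2 _ _ he
    refine ⟨fun c => ?_, fun a b hab => ?_⟩
    · by_cases c1 : c = q
      · subst c1; omega
      · by_cases c2 : c = q - 1
        · subst c2; omega
        · rw [h2ne c c1 c2]; exact hg.1 c
    obtain ⟨hab1, hab2, hab3, hab4⟩ := hab
    have ha2 : a ≠ q := by rintro rfl; omega
    have ha3 : a ≠ q + 1 := by rintro rfl; rw [add_sub_cancel_right] at hab2; omega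
    have ha1 : a ≠ q - 1 := by rintro rfl; omega
    have hb2 : b ≠ q := by
      rintro rfl
      have := hab3 (b - 1) (by omega) (by omega)
      omega
    have hb3 : b ≠ q + 1 := by
      rintro rfl
      have := hab3 q (by omega) (by omega)
      omega
    have f1 := h2ne a ha2 ha1
    have f3 := h2ne (a - 1) (by omega) (by omega)
    have g1 := hne a ha2
    rcases eq_or_ne b (q - 1) with rfl | hb1
    · have h5 := hab3 (q - 1 - 1) (by omega) (by omega)
      have hexc : Exc d a (q + 1) := by
        refine ⟨by omega, by omega, fun c hc hc' => ?_, by omega⟩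
        rcases lt_or_ge c (q - 1) with c1 | c1
        · have := hab3 c hc c1
          have := hdle c
          omega
        · rcases eq_or_ne c q with rfl | c2
          · omega
          · rw [show c = q - 1 by omega]; omega
      obtain ⟨r1, r2⟩ := hg.2 _ _ hexc
      refine ⟨by omega, fun c hc hc' => ?_⟩
      rw [← hne c (by omega), ← g1]
      exact r2 c hc (by omega)
    have f2 := h2ne b hb2 hb1
    have hexc : Exc d a b := by
      refine ⟨hab1, by omega, fun c hc hc' => ?_, by omega⟩
      have := hab3 c hc hc'
      have := hdle c
      omega
    obtain ⟨r1, r2⟩ := hg.2 a b hexc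
    refine ⟨by rw [← hne b hb2, ← hne a ha2, r1], fun c hc hc' => ?_⟩
    rw [← g1]
    by_cases hcq : c = q
    · subst hcq
      have h5 := hab3 c hc (by omega)
      have has : a < s := by
        by_contra! hcon
        have := he.2.2.1 a hcon (by omega)
        omega
      have h6 := r2 (s - 1) (by omega) (by have := he.1; omega)
      have h7 := (h'.rise he.2.1).1
      have h8 := hret.1
      omega
    · rw [← hne c hcq]
      exact r2 c hc hc'
  · intro hg
    refine ⟨fun c => (hg.1 c).trans (hdle c), fun a b hab => ?_⟩
    obtain ⟨hab1, hab2, hab3, hab4⟩ := hab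
    have ha2 : a ≠ q := by rintro rfl; omega
    have ha3 : a ≠ q + 1 := by rintro rfl; rw [add_sub_cancel_right] at hab2; omega
    have hb2 : b ≠ q := by
      rintro rfl
      have := hab3 (b - 1) (by omega) (by omega)
      omega
    rcases eq_or_ne a (q - 1) with rfl | ha1
    · have hb : b = q + 1 := by
        by_contra hb
        have := hab3 (q + 1) (by omega) (by omega)
        omega
      subst hb
      refine ⟨by omega, fun c hc hc' => ?_⟩
      rcases eq_or_ne c q with rfl | c2
      · omega
      rcases eq_or_ne c (q - 1) with rfl | c3
      · rfl
      · rw [show c = q + 1 by omega]; omega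
    have hb1 : b ≠ q - 1 := by
      rintro rfl
      have := hab3 (q - 1 - 1) (by omega) (by omega)
      omega
    have f1 := h2ne a ha2 ha1
    have f3 := h2ne (a - 1) (by omega) (by omega)
    have g1 := hne a ha2
    rcases eq_or_ne b (q + 1) with rfl | hb3
    · have h5 := hab3 (q - 1 - 1) (by omega) (by omega)
      have h6 := hab3 (q - 1) (by omega) (by omega)
      have hexc : Exc d' a (q - 1) := by
        refine ⟨by omega, by omega, fun c hc hc' => ?_, by omega⟩
        rw [h2ne c (by omega) (by omega), f1]
        exact hab3 c hc (by omega)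
      obtain ⟨r1, r2⟩ := hg.2 _ _ hexc
      refine ⟨by omega, fun c hc hc' => ?_⟩
      rcases eq_or_ne c q with rfl | c2
      · omega
      rcases eq_or_ne c (q + 1) with rfl | c3
      · omega
      · rw [hne c c2, g1]
        exact r2 c hc (by omega)
    have f2 := h2ne b hb2 hb1
    have hexc : Exc d' a b := by
      refine ⟨hab1, by omega, fun c hc hc' => ?_, by omega⟩
      have h3 := hab3 c hc hc'
      by_cases c1 : c = q
      · subst c1
        have := hab3 (c + 1) (by omega) (by omega)
        omega
      · by_cases c2 : c = q - 1
        · subst c2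
          have := hab3 (q + 1) (by omega) (by omega)
          omega
        · rw [h2ne c c1 c2]; omega
    obtain ⟨r1, r2⟩ := hg.2 a b hexc
    refine ⟨by rw [hne b hb2, hne a ha2, r1], fun c hc hc' => ?_⟩
    have := r2 c hc hc'
    have := hGle c
    omega

/-- An excursion ends at q+1, so a return would bring `G'` to its initial height already at q-1. By
`Gam.step_eq`, or because the excursion starts there, `F` would have to fall at q-1. -/
theorem not_gam_of_rise (h' : PathPair G' F d) (h1 : G' q = G' (q - 1) + 1)
    (h2 : G' (q + 1) = G' q - 1) (hd : d (q - 1) = d q) (hd1 : d (q + 1) = d q - 1)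
    (hF : F (q - 1) = F (q - 2) + 1) : ¬ Gam G' d := by
  rw [show q - 2 = q - 1 - 1 by ring] at hF
  intro hg
  obtain ⟨s, he, -⟩ := h'.exists_exc_of_fall hg.1 (z := q + 1)
    (by rw [add_sub_cancel_right]; omega)
  have hret := (hg.2 _ _ he).1
  have hs1 := he.1
  have hs2 := he.2.1
  rcases lt_trichotomy s (q - 1) with hs | rfl | hs
  · have := hg.step_eq h' he hs (by omega) (by omega)
    omega
  · have := h'.rise hs2
    omega
  · rw [show s = q by omega] at hs2
    omega

end AddBox

end TLFock

/-! ### Hooks and layers in terms of profiles -/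

namespace TLFock

/-! ### Strips of boxes -/

theorem box_ext {x y : ℕ × ℕ} (h : content x = content y) (h' : anticontent x = anticontent y) :
    x = y := by
  simp only [content, anticontent] at h h'
  exact Prod.ext (by omega) (by omega)

theorem CellAdj.symm {x y : ℕ × ℕ} (h : CellAdj x y) : CellAdj y x := by
  unfold CellAdj at *
  omega

theorem CellAdj.content {x y : ℕ × ℕ} (h : CellAdj x y) :
    content y = content x + 1 ∨ content y = content x - 1 := by
  simp only [CellAdj, TLFock.content] at *
  omega

theorem cellAdj_of_content {x y : ℕ × ℕ} (h : content y = content x + 1)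
    (h' : (anticontent y : ℤ) = anticontent x + 1 ∨ (anticontent y : ℤ) = anticontent x - 1) :
    CellAdj x y := by
  simp only [CellAdj, content, anticontent] at *
  omega

/-- `S` consists of one box for each content between `s` and `t`, with anticontents given by
`a`. -/
structure IsStrip (S : Finset (ℕ × ℕ)) (a : ℤ → ℤ) (s t : ℤ) : Prop where
  le : s ≤ t
  mem_iff : ∀ x, x ∈ S ↔ (s ≤ content x ∧ content x ≤ t) ∧ (anticontent x : ℤ) = a (content x)
  exists_mem : ∀ c, s ≤ c → c ≤ t → ∃ x ∈ S, content x = c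

theorem exists_mem_content_eq {S : Finset (ℕ × ℕ)} {x y : ℕ × ℕ} {c : ℤ} (hx : x ∈ S)
    (h : Relation.ReflTransGen (fun u v => v ∈ S ∧ CellAdj u v) x y) (h1 : content x ≤ c)
    (h2 : c ≤ content y) : ∃ z ∈ S, content z = c := by
  induction h with
  | refl => exact ⟨x, hx, le_antisymm h1 h2⟩
  | @tail u v huv hv ih =>
    rcases le_or_gt c (content u) with h | h
    · exact ih h
    · have := hv.2.content
      exact ⟨v, hv.1, by omega⟩

/-- Adjacent boxes have contents differing by one, so the contents of a connected set fill an
interval; content and anticontent together determine a box. -/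
theorem IsConn.exists_isStrip {S : Finset (ℕ × ℕ)} {a : ℤ → ℤ} (h : IsConn S)
    (ha : ∀ x ∈ S, (anticontent x : ℤ) = a (content x)) : ∃ s t, IsStrip S a s t := by
  obtain ⟨x, hx, hmin⟩ := S.exists_min_image content h.1
  obtain ⟨y, hy, hmax⟩ := S.exists_max_image content h.1
  have hex : ∀ c, content x ≤ c → c ≤ content y → ∃ z ∈ S, content z = c := fun c h1 h2 =>
    exists_mem_content_eq hx (h.2 x hx y hy) h1 h2
  refine ⟨content x, content y, hmin y hy, fun z => ⟨fun hz => ⟨⟨hmin z hz, hmax z hz⟩, ha z hz⟩,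
    fun hz => ?_⟩, hex⟩
  obtain ⟨w, hw, hwz⟩ := hex _ hz.1.1 hz.1.2
  have : z = w := box_ext hwz.symm (by
    have := ha w hw
    rw [hwz, ← hz.2] at this
    exact_mod_cast this.symm)
  exact this ▸ hw

section Strip

variable {S : Finset (ℕ × ℕ)} {a : ℤ → ℤ} {s t : ℤ}

theorem IsStrip.connected_up (h : IsStrip S a s t) (hs : UnitSteps a) {x : ℕ × ℕ} (hx : x ∈ S)
    {c : ℤ} (hc : content x ≤ c) (hct : c ≤ t) : ∃ y ∈ S, content y = c ∧
      Relation.ReflTransGen (fun u v => v ∈ S ∧ CellAdj u v) x y ∧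
      Relation.ReflTransGen (fun u v => v ∈ S ∧ CellAdj u v) y x := by
  have hx' := (h.mem_iff x).mp hx
  induction c, hc using Int.leInduction with
  | base => exact ⟨x, hx, rfl, .refl, .refl⟩
  | succ n hn ih =>
    obtain ⟨y, hy, hyn, h1, h2⟩ := ih (by omega)
    obtain ⟨z, hz, hzn⟩ := h.exists_mem (n + 1) (by omega) hct
    have hadj : CellAdj y z := by
      have h3 := ((h.mem_iff y).mp hy).2
      have h4 := ((h.mem_iff z).mp hz).2
      have h5 := hs (n + 1)
      rw [hyn] at h3
      rw [hzn] at h4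
      rw [add_sub_cancel_right] at h5
      exact cellAdj_of_content (by omega) (by omega)
    exact ⟨z, hz, hzn, h1.tail ⟨hz, hadj⟩, .head ⟨hy, hadj.symm⟩ h2⟩

theorem IsStrip.unique (h : IsStrip S a s t) {x y : ℕ × ℕ} (hx : x ∈ S) (hy : y ∈ S)
    (hc : content x = content y) : x = y := by
  refine box_ext hc ?_
  have h1 := ((h.mem_iff x).mp hx).2
  have h2 := ((h.mem_iff y).mp hy).2
  rw [hc, ← h2] at h1
  exact_mod_cast h1

theorem IsStrip.isConnHook (h : IsStrip S a s t) (hs : UnitSteps a) : IsConnHook S := by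
  refine ⟨⟨?_, fun x hx y hy => ?_⟩, fun i j hij => ?_⟩
  · obtain ⟨x, hx, -⟩ := h.exists_mem s le_rfl h.le
    exact ⟨x, hx⟩
  · rcases le_total (content x) (content y) with hxy | hxy
    · obtain ⟨z, hz, hzy, h1, -⟩ := h.connected_up hs hx hxy ((h.mem_iff y).mp hy).1.2
      rwa [h.unique hz hy hzy] at h1
    · obtain ⟨z, hz, hzy, -, h1⟩ := h.connected_up hs hy hxy ((h.mem_iff x).mp hx).1.2
      rwa [h.unique hz hx hzy] at h1
  · have := h.unique hij.1 hij.2.2.2 (by simp [content])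
    simp at this

theorem image_Icc_of_steps {f : ℤ → ℕ} (hst : s ≤ t)
    (hf : ∀ c, s ≤ c → c < t → f c ≤ f (c + 1) ∧ f (c + 1) ≤ f c + 1) (y : ℕ) :
    (∃ c, s ≤ c ∧ c ≤ t ∧ f c = y) ↔ f s ≤ y ∧ y ≤ f t := by
  induction t, hst using Int.leInduction with
  | base =>
    constructor
    · rintro ⟨c, h1, h2, rfl⟩
      obtain rfl : c = s := by omega
      simp
    · rintro ⟨h1, h2⟩
      exact ⟨s, le_rfl, le_rfl, by omega⟩
  | succ n hn ih =>
    have ih := ih fun c h1 h2 => hf c h1 (by omega)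
    have h1 := hf n hn (by omega)
    have h2 : f s ≤ f n := by
      by_contra hlt
      have : ∀ c, s ≤ c → c ≤ n → f s ≤ f c := by
        intro c hc
        induction c, hc using Int.leInduction with
        | base => exact fun _ => le_rfl
        | succ k hk ihk => exact fun hk' => (ihk (by omega)).trans (hf k hk (by omega)).1
      exact hlt (this n hn le_rfl)
    constructor
    · rintro ⟨c, h3, h4, h5⟩
      rcases h4.eq_or_lt with rfl | h4
      · omega
      · have := ih.mp ⟨c, h3, by omega, h5⟩
        omega
    · rintro ⟨h3, h4⟩
      rcases h4.eq_or_lt with rfl | h4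
      · exact ⟨n + 1, by omega, le_rfl, rfl⟩
      · obtain ⟨c, h5, h6, h7⟩ := ih.mpr ⟨h3, by omega⟩
        exact ⟨c, h5, by omega, h7⟩

/-- Along the strip the column (a c + c)/2 weakly increases and the row (a c - c)/2 weakly
decreases, by at most one per step up to the index shift. Hence rows and columns fill intervals
whose ends are read off at `s` and `t`. -/
theorem IsStrip.width_sub_height (h : IsStrip S a s t) (hs : UnitSteps a) :
    (width S : ℤ) - height S = a t - a s := by
  have hbox : ∀ c, s ≤ c → c ≤ t → ∃ x ∈ S, (x.1 : ℤ) = (a c - c) / 2 ∧ (x.2 : ℤ) = (a c + c) / 2 ∧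
      (a c - c) % 2 = 0 := by
    intro c h1 h2
    obtain ⟨x, hx, rfl⟩ := h.exists_mem c h1 h2
    have h3 := ((h.mem_iff x).mp hx).2
    refine ⟨x, hx, ?_⟩
    rw [← h3]
    simp only [content, anticontent]
    omega
  have himage : ∀ y : ℕ × ℕ, y ∈ S → y = (((a (content y) - content y) / 2).toNat,
      ((a (content y) + content y) / 2).toNat) := by
    intro y hy
    have h3 := ((h.mem_iff y).mp hy).2
    refine Prod.ext ?_ ?_ <;> rw [← h3] <;> simp only [content, anticontent] <;> omega
  have hw : S.image Prod.snd = Finset.Icc ((a s + s) / 2).toNat ((a t + t) / 2).toNat := by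
    ext y
    rw [Finset.mem_Icc, ← image_Icc_of_steps (f := fun c => ((a c + c) / 2).toNat) h.le,
      Finset.mem_image]
    · constructor
      · rintro ⟨x, hx, rfl⟩
        have h1 := (h.mem_iff x).mp hx
        exact ⟨content x, h1.1.1, h1.1.2, (congrArg Prod.snd (himage x hx)).symm⟩
      · rintro ⟨c, h1, h2, rfl⟩
        obtain ⟨x, hx, -, h3, -⟩ := hbox c h1 h2
        exact ⟨x, hx, by omega⟩
    · intro c h1 h2
      obtain ⟨x, -, -, h3, -⟩ := hbox c h1 h2.le
      have h4 := hs (c + 1)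
      rw [add_sub_cancel_right] at h4
      omega
  have hh : S.image Prod.fst = Finset.Icc ((a t - t) / 2).toNat ((a s - s) / 2).toNat := by
    ext y
    -- Rows decrease with the content, so contents are negated.
    have key := image_Icc_of_steps (s := -t) (t := -s)
      (f := fun c => ((a (-c) - -c) / 2).toNat) (by have := h.le; omega) (fun c h1 h2 => by
        obtain ⟨x, -, h3, -, -⟩ := hbox (-c) (by omega) (by omega)
        have h4 := hs (-c)
        rw [show -c - 1 = -(c + 1) by ring] at h4
        omega) y
    simp only [neg_neg] at key
    rw [Finset.mem_Icc, ← key, Finset.mem_image]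
    constructor
    · rintro ⟨x, hx, rfl⟩
      have h1 := (h.mem_iff x).mp hx
      exact ⟨-content x, by omega, by omega, by
        rw [neg_neg]; exact (congrArg Prod.fst (himage x hx)).symm⟩
    · rintro ⟨c, h1, h2, rfl⟩
      obtain ⟨x, hx, h3, -, -⟩ := hbox (-c) (by omega) (by omega)
      exact ⟨x, hx, by omega⟩
  obtain ⟨x, hxS, h1, h2, h3⟩ := hbox s le_rfl h.le
  obtain ⟨y, -, h4, h5, h6⟩ := hbox t h.le le_rfl
  have hle : (a s + s) / 2 ≤ (a t + t) / 2 := by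
    have hm : x.2 ∈ S.image Prod.snd := Finset.mem_image_of_mem _ hxS
    rw [hw, Finset.mem_Icc] at hm
    omega
  have hle' : (a t - t) / 2 ≤ (a s - s) / 2 := by
    have hm : x.1 ∈ S.image Prod.fst := Finset.mem_image_of_mem _ hxS
    rw [hh, Finset.mem_Icc] at hm
    omega
  rw [width, height, hw, hh, Nat.card_Icc, Nat.card_Icc]
  omega

end Strip

theorem unitSteps_prof (l : YoungDiagram) : UnitSteps (prof l) := prof_step' l

theorem unitSteps_prof_sub (l : YoungDiagram) (k : ℤ) : UnitSteps fun c => prof l c - k := by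
  intro c
  have := prof_step' l c
  dsimp only
  omega

theorem prof_eq_of_mem_iff {m : YoungDiagram} {c v : ℤ} (hv : (c.natAbs : ℤ) ≤ v)
    (hp : (v - c) % 2 = 0) (h : ∀ x, content x = c → (x ∈ m ↔ (anticontent x : ℤ) < v)) :
    prof m c = v := by
  obtain ⟨x, hx, hx'⟩ := exists_box hv hp
  obtain ⟨y, hy, hy'⟩ := exists_box (natAbs_le_prof m c) (prof_emod m c)
  have h1 := h x hx
  have h2 := h y hy
  rw [mem_iff_prof, hx] at h1
  rw [mem_iff_prof, hy] at h2
  omega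

/-- Rim hooks are the strips of the rim whose removal leaves a partition. -/
theorem IsRimHook.exists_isStrip {l : YoungDiagram} {H : Finset (ℕ × ℕ)} (h : IsRimHook l H) :
    ∃ s t, IsStrip H (fun c => prof l c - 2) s t ∧
      ∃ m, m.cells = l.cells \ H ∧ ∀ c, prof m c = prof l c - if s ≤ c ∧ c ≤ t then 2 else 0 := by
  obtain ⟨⟨hconn, hsq⟩, hsub, m, hm⟩ := h
  have hmem : ∀ x, x ∈ m ↔ x ∈ l ∧ x ∉ H := fun x => by
    rw [← YoungDiagram.mem_cells, hm, Finset.mem_sdiff, YoungDiagram.mem_cells]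
  have hup : ∀ x y : ℕ × ℕ, x ∈ H → x ≤ y → y ∈ l → y ∈ H := by
    intro x y hx hxy hy
    by_contra hyH
    have : x ∈ m := m.isLowerSet hxy ((hmem y).mpr ⟨hy, hyH⟩)
    exact ((hmem x).mp this).2 hx
  -- If the diagonal successor of `x` were in `l`, upward closure would put a 2 × 2 square into `H`.
  have hrim : ∀ x ∈ H, (anticontent x : ℤ) = prof l (content x) - 2 := by
    intro x hx
    refine (isRimBox_iff.mp ⟨hsub hx, rfl, fun hcon => ?_⟩).2
    have h1 : (x.1 + 1, x.2) ∈ l := l.up_left_mem le_rfl (by omega) hcon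
    have h2 : (x.1, x.2 + 1) ∈ l := l.up_left_mem (by omega) le_rfl hcon
    refine hsq x.1 x.2 ⟨hx, hup x _ hx ?_ h1, hup x _ hx ?_ h2, hup x _ hx ?_ hcon⟩ <;>
      rw [Prod.le_def] <;> simp
  obtain ⟨s, t, hst⟩ := hconn.exists_isStrip (a := fun c => prof l c - 2) hrim
  refine ⟨s, t, hst, m, hm, fun c => ?_⟩
  split_ifs with hc
  · obtain ⟨x, hx, rfl⟩ := hst.exists_mem c hc.1 hc.2
    have hx1 := hrim x hx
    refine prof_eq_of_mem_iff ?_ ?_ fun y hy => ?_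
    · simp only [content, anticontent] at *
      omega
    · have := prof_emod l (content x)
      omega
    · rw [hmem, mem_iff_prof, hst.mem_iff, hy]
      have h1 := prof_emod l (content x)
      have h2 : ((anticontent y : ℤ) - content y) % 2 = 0 := by
        simp only [content, anticontent]; omega
      omega
  · rw [sub_zero]
    refine prof_eq_of_mem_iff (natAbs_le_prof l c) (prof_emod l c) fun y hy => ?_
    rw [hmem, hst.mem_iff, hy, mem_iff_prof, hy]
    tauto

theorem exists_isRimHook {l m : YoungDiagram} {s t : ℤ} (hst : s ≤ t)
    (hm : ∀ c, prof m c = prof l c - if s ≤ c ∧ c ≤ t then 2 else 0) :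
    IsRimHook l (l.cells \ m.cells) ∧ IsStrip (l.cells \ m.cells) (fun c => prof l c - 2) s t := by
  have hle : m ≤ l := prof_le_iff.mpr fun c => by
    rw [hm]
    split_ifs <;> omega
  have hstrip : IsStrip (l.cells \ m.cells) (fun c => prof l c - 2) s t := by
    have hmem : ∀ x, x ∈ l.cells \ m.cells ↔
        (s ≤ content x ∧ content x ≤ t) ∧ (anticontent x : ℤ) = prof l (content x) - 2 := by
      intro x
      rw [Finset.mem_sdiff, YoungDiagram.mem_cells, YoungDiagram.mem_cells, mem_iff_prof,
        mem_iff_prof, hm]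
      have h1 := prof_emod l (content x)
      have h2 : ((anticontent x : ℤ) - content x) % 2 = 0 := by
        simp only [content, anticontent]; omega
      split_ifs with h <;> omega
    refine ⟨hst, hmem, fun c h1 h2 => ?_⟩
    have h3 := hm c
    rw [if_pos ⟨h1, h2⟩] at h3
    obtain ⟨x, hx, hx'⟩ := exists_box (natAbs_le_prof m c) (prof_emod m c)
    exact ⟨x, (hmem x).mpr ⟨by omega, by rw [hx', hx, h3]⟩, hx⟩
  refine ⟨⟨hstrip.isConnHook (unitSteps_prof_sub l 2), Finset.sdiff_subset, m, ?_⟩, hstrip⟩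
  rw [Finset.sdiff_sdiff_eq_self hle]

theorem IsStrip.startsAt {S : Finset (ℕ × ℕ)} {a : ℤ → ℤ} {s t : ℤ} (h : IsStrip S a s t) :
    StartsAt s S :=
  ⟨h.exists_mem s le_rfl h.le, fun x hx => ((h.mem_iff x).mp hx).1.1⟩

theorem StartsAt.unique {S : Finset (ℕ × ℕ)} {q q' : ℤ} (h : StartsAt q S) (h' : StartsAt q' S) :
    q = q' := by
  obtain ⟨⟨x, hx, rfl⟩, h1⟩ := h
  obtain ⟨⟨y, hy, rfl⟩, h2⟩ := h'
  exact le_antisymm (h1 y hy) (h2 x hx)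

/-- By `IsStrip.width_sub_height`, balance means that the profile is equally high at the first and
the last content of the hook. -/
theorem balancedFrom_iff {q : ℤ} {l : YoungDiagram} {H : Finset (ℕ × ℕ)} :
    BalancedFrom q l H ↔ ∃ t m, q ≤ t ∧ prof l t = prof l q ∧ H = l.cells \ m.cells ∧
      ∀ c, prof m c = prof l c - if q ≤ c ∧ c ≤ t then 2 else 0 := by
  constructor
  · rintro ⟨h1, h2, h3⟩
    obtain ⟨s, t, hst, m, hm, hprof⟩ := h1.exists_isStrip
    obtain rfl := h3.unique hst.startsAt
    have h4 := hst.width_sub_height (unitSteps_prof_sub l 2)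
    refine ⟨t, m, hst.le, by omega, ?_, hprof⟩
    rw [hm, Finset.sdiff_sdiff_eq_self h1.2.1]
  · rintro ⟨t, m, h1, h2, rfl, h3⟩
    obtain ⟨h4, h5⟩ := exists_isRimHook h1 h3
    have h6 := h5.width_sub_height (unitSteps_prof_sub l 2)
    exact ⟨h4, by omega, h5.startsAt⟩

/-- Removing the minimal balanced rim hook means reflecting the first arc of the profile. -/
theorem removesMinimal_of_return {q z : ℤ} {l m : YoungDiagram} (hqz : q < z)
    (hup : prof l (q + 1) = prof l q + 1) (hz : prof l z = prof l q)
    (hbetween : ∀ c, q < c → c < z → prof l q < prof l c)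
    (hm : ∀ c, prof m c = prof l c - if q < c ∧ c < z then 2 else 0) :
    RemovesMinimal (BalancedFrom (q + 1) l) l (basisVec m) := by
  have hz1 : q + 1 < z := by
    rcases (Int.add_one_le_of_lt hqz).lt_or_eq with h | rfl
    · exact h
    · omega
  have hm' : ∀ c, prof m c = prof l c - if q + 1 ≤ c ∧ c ≤ z - 1 then 2 else 0 := fun c => by
    rw [hm]
    split_ifs <;> omega
  have hle : m ≤ l := prof_le_iff.mpr fun c => by
    rw [hm]
    split_ifs <;> omega
  have hP : BalancedFrom (q + 1) l (l.cells \ m.cells) := by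
    refine balancedFrom_iff.mpr ⟨z - 1, m, by omega, ?_, rfl, hm'⟩
    have h1 := prof_step' l z
    have h2 := hbetween (z - 1) (by omega) (by omega)
    omega
  have hleast : ∀ H, BalancedFrom (q + 1) l H → l.cells \ m.cells ⊆ H := by
    intro H hH
    obtain ⟨t, m', h1, h2, rfl, h3⟩ := balancedFrom_iff.mp hH
    -- Removal lowers the profile at `t` but not at `t + 1`, which forces a descent there. So every
    -- balanced hook ends at a return to the height at `q`.
    have h4 : prof l (t + 1) = prof l q := by
      have a1 := h3 t
      have a2 := h3 (t + 1)
      have a3 := prof_step l t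
      have a4 := prof_step m' t
      rw [if_pos (by omega)] at a1
      rw [if_neg (by omega)] at a2
      omega
    have h5 : z ≤ t + 1 := by
      by_contra! hlt
      have := hbetween (t + 1) (by omega) hlt
      omega
    refine Finset.sdiff_subset_sdiff le_rfl ?_
    refine prof_le_iff.mpr fun c => ?_
    rw [h3, hm]
    split_ifs <;> omega
  refine Or.inl ⟨l.cells \ m.cells, ⟨hP, fun H hH _ => hleast H hH⟩, fun H hH => ?_, m, ?_, rfl⟩
  · exact le_antisymm (hH.2 hP (hleast H hH.1)) (hleast H hH.1)
  · rw [Finset.sdiff_sdiff_eq_self hle]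

theorem removesMinimal_of_no_return {q : ℤ} {l : YoungDiagram}
    (hup : prof l (q + 1) = prof l q + 1) (hz : ∀ z, q < z → prof l z ≠ prof l q) :
    RemovesMinimal (BalancedFrom (q + 1) l) l 0 := by
  refine Or.inr ⟨?_, rfl⟩
  rintro ⟨H, hH⟩
  obtain ⟨t, m', h1, h2, rfl, h3⟩ := balancedFrom_iff.mp hH
  refine hz (t + 1) (by omega) ?_
  have a1 := h3 t
  have a2 := h3 (t + 1)
  have a3 := prof_step l t
  have a4 := prof_step m' t
  rw [if_pos (by omega)] at a1
  rw [if_neg (by omega)] at a2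
  omega

/-! ### Layers -/

theorem mem_layer_iff {l m : YoungDiagram} {k : ℕ} {x : ℕ × ℕ} : x ∈ layer l m k ↔
    (anticontent x : ℤ) = prof l (content x) - (2 * k + 2) ∧
      prof m (content x) ≤ anticontent x := by
  unfold layer
  rw [Finset.mem_filter, Finset.mem_sdiff, YoungDiagram.mem_cells, YoungDiagram.mem_cells,
    mem_iff_prof, mem_iff_prof, mem_iff_prof, mem_iff_prof]
  have h1 : content (x.1 + k, x.2 + k) = content x := by simp [content]
  have h2 : content (x.1 + k + 1, x.2 + k + 1) = content x := by simp [content]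
  have h3 : (anticontent (x.1 + k, x.2 + k) : ℤ) = anticontent x + 2 * k := by
    simp only [anticontent]; push_cast; ring
  have h4 : (anticontent (x.1 + k + 1, x.2 + k + 1) : ℤ) = anticontent x + 2 * k + 2 := by
    simp only [anticontent]; push_cast; ring
  have h5 := prof_emod l (content x)
  have h6 : ((anticontent x : ℤ) - content x) % 2 = 0 := by
    simp only [content, anticontent]; omega
  rw [h1, h2, h3, h4]
  omega

/-- Half the difference of two profiles. -/
def profDiff (l m : YoungDiagram) (c : ℤ) : ℤ := (prof l c - prof m c) / 2

theorem pathPair_prof (l m : YoungDiagram) : PathPair (prof l) (prof m) (profDiff l m) where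
  left := unitSteps_prof l
  right := unitSteps_prof m
  diff c := by
    have := prof_emod l c
    have := prof_emod m c
    unfold profDiff
    omega
  fin := by
    obtain ⟨N, h0, hN⟩ := exists_prof_eq_natAbs l
    obtain ⟨M, -, hM⟩ := exists_prof_eq_natAbs m
    refine ⟨max N M, fun c hc => ?_⟩
    rw [profDiff, hN c (by omega), hM c (by omega), sub_self, Int.zero_ediv]

/-- An excursion starting at height k+1 covers the contents s, …, z-1 of one component of the k-th
layer. One more column than rows means G (z-1) = G s + 1, and `G` falls at `z` together with `d`;
minimal anticontent at `s` means that `G` stays at or above G s. -/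
theorem IsGamma.gam {l m : YoungDiagram} (h : IsGamma l m) : Gam (prof l) (profDiff l m) := by
  have hp := pathPair_prof l m
  have h0 : ∀ c, 0 ≤ profDiff l m c := fun c => by
    have := prof_le_iff.mp h.1 c
    have := hp.diff c
    omega
  refine ⟨h0, fun s z he => ?_⟩
  obtain ⟨h1, h2, h3, h4⟩ := he
  obtain ⟨k, hk⟩ : ∃ k : ℕ, profDiff l m s = k + 1 :=
    ⟨(profDiff l m s - 1).toNat, by have := h0 (s - 1); omega⟩
  set S := (layer l m k).filter fun x => s ≤ content x ∧ content x ≤ z - 1 with hS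
  have hmem : ∀ x, x ∈ S ↔ (s ≤ content x ∧ content x ≤ z - 1) ∧
      (anticontent x : ℤ) = prof l (content x) - (2 * k + 2) := by
    intro x
    rw [hS, Finset.mem_filter, mem_layer_iff]
    constructor
    · rintro ⟨⟨a1, -⟩, a2⟩
      exact ⟨a2, a1⟩
    · rintro ⟨a1, a2⟩
      have := h3 (content x) a1.1 (by omega)
      have := hp.diff (content x)
      exact ⟨⟨a2, by omega⟩, a1⟩
  have hstrip : IsStrip S (fun c => prof l c - (2 * k + 2)) s (z - 1) := by
    refine ⟨by omega, hmem, fun c hc hc' => ?_⟩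
    have a1 := h3 c hc (by omega)
    have a2 := hp.diff c
    have a3 := natAbs_le_prof m c
    have a4 := prof_emod l c
    obtain ⟨x, hx, hx'⟩ := exists_box (q := c) (a := prof l c - (2 * k + 2)) (by omega) (by omega)
    exact ⟨x, (hmem x).mpr ⟨by omega, by rw [hx', hx]⟩, hx⟩
  have hus := unitSteps_prof_sub l (2 * k + 2)
  have hcomp : IsComponent S (layer l m k) := by
    refine ⟨Finset.filter_subset _ _, (hstrip.isConnHook hus).1, fun x hx y hy hxy => ?_⟩
    have a1 := ((hmem x).mp hx).1
    obtain ⟨a2, a3⟩ := mem_layer_iff.mp hy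
    refine (hmem y).mpr ⟨?_, a2⟩
    have a4 := hp.diff (content y)
    have a5 := hxy.content
    have a6 : content y ≠ s - 1 := by
      intro h
      rw [h] at a2 a3 a4
      omega
    have a7 : content y ≠ z := by
      intro h
      rw [h] at a2 a3 a4
      omega
    omega
  obtain ⟨-, hw, x, hx, hxmin⟩ := h.2 k S hcomp
  have hwh := hstrip.width_sub_height hus
  have hx1 := (hmem x).mp hx
  obtain ⟨y, hy, hys⟩ := hstrip.exists_mem s le_rfl hstrip.le
  have hxs : content x = s := by
    have := (hxmin y hy).1
    omega
  have h3' := h3 (z - 1) (by omega) (by omega)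
  have hfall := (hp.fall (s := z) (by omega)).1
  have hz : prof l z = prof l s := by
    rw [hw] at hwh
    push_cast at hwh
    omega
  refine ⟨hz, fun c hc hc' => ?_⟩
  rcases eq_or_ne c z with rfl | hcz
  · omega
  · obtain ⟨y, hy, rfl⟩ := hstrip.exists_mem c hc (by omega)
    have a1 := (hxmin y hy).2
    have a2 := ((hmem y).mp hy).2
    rw [hxs] at hx1
    omega

/-- Conversely, a component of the k-th layer occupies a maximal interval on which d ≥ k+1, and this
is an excursion. -/
theorem Gam.isGamma {l m : YoungDiagram} (h : Gam (prof l) (profDiff l m)) : IsGamma l m := by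
  have hp := pathPair_prof l m
  refine ⟨prof_le_iff.mpr fun c => by have := h.1 c; have := hp.diff c; omega, fun k S hS => ?_⟩
  obtain ⟨hsub, hconn, hclosed⟩ := hS
  have hus := unitSteps_prof_sub l (2 * k + 2)
  obtain ⟨s, t, hst⟩ := hconn.exists_isStrip (a := fun c => prof l c - (2 * k + 2))
    fun x hx => (mem_layer_iff.mp (hsub hx)).1
  have hge : ∀ c, s ≤ c → c ≤ t → (k : ℤ) + 1 ≤ profDiff l m c := by
    intro c h1 h2
    obtain ⟨x, hx, rfl⟩ := hst.exists_mem c h1 h2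
    have a1 := mem_layer_iff.mp (hsub hx)
    have a2 := hp.diff (content x)
    omega
  have hbox : ∀ c, (k : ℤ) + 1 ≤ profDiff l m c → ∃ x ∈ layer l m k, content x = c := by
    intro c hc
    have a2 := hp.diff c
    have a3 := natAbs_le_prof m c
    have a4 := prof_emod l c
    obtain ⟨x, hx, hx'⟩ := exists_box (q := c) (a := prof l c - (2 * k + 2)) (by omega) (by omega)
    exact ⟨x, mem_layer_iff.mpr (by rw [hx, hx']; omega), hx⟩
  have hs : profDiff l m (s - 1) < k + 1 := by
    by_contra! hcon
    obtain ⟨y, hy, hys⟩ := hbox _ hcon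
    obtain ⟨x, hx, hxs⟩ := hst.exists_mem s le_rfl hst.le
    have a1 := (mem_layer_iff.mp hy).1
    have a2 := (mem_layer_iff.mp (hsub hx)).1
    have a3 := prof_step' l s
    rw [hys] at a1
    rw [hxs] at a2
    have hadj : CellAdj y x := cellAdj_of_content (by omega) (by omega)
    have := ((hst.mem_iff y).mp (hclosed x hx y hy hadj.symm)).1
    omega
  have ht : profDiff l m (t + 1) < k + 1 := by
    by_contra! hcon
    obtain ⟨y, hy, hys⟩ := hbox _ hcon
    obtain ⟨x, hx, hxs⟩ := hst.exists_mem t hst.le le_rfl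
    have a1 := (mem_layer_iff.mp hy).1
    have a2 := (mem_layer_iff.mp (hsub hx)).1
    have a3 := prof_step l t
    rw [hys] at a1
    rw [hxs] at a2
    have hadj : CellAdj x y := cellAdj_of_content (by omega) (by omega)
    have := ((hst.mem_iff y).mp (hclosed x hx y hy hadj)).1
    omega
  have hs1 := hge s le_rfl hst.le
  have hs2 := hp.step s
  have hst' := hst.le
  have hds : profDiff l m s = k + 1 := by omega
  obtain ⟨hr1, hr2⟩ := h.2 s (t + 1)
    ⟨by omega, by omega, fun c h1 h2 => by have := hge c h1 (by omega); omega, by omega⟩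
  have ht1 := hge t hst.le le_rfl
  have hfall := (hp.fall (s := t + 1) (by rw [add_sub_cancel_right]; omega)).1
  rw [add_sub_cancel_right] at hfall
  have hwh := hst.width_sub_height hus
  obtain ⟨x, hx, hxs⟩ := hst.exists_mem s le_rfl hst.le
  refine ⟨hst.isConnHook hus, by omega, x, hx, fun y hy => ?_⟩
  have a1 := (hst.mem_iff y).mp hy
  have a2 := (hst.mem_iff x).mp hx
  have a3 := hr2 (content y) a1.1.1 (by omega)
  rw [hxs] at a2 ⊢
  exact ⟨a1.1.1, by omega⟩

theorem isGamma_iff {l m : YoungDiagram} : IsGamma l m ↔ Gam (prof l) (profDiff l m) :=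
  ⟨IsGamma.gam, Gam.isGamma⟩

end TLFock

/-! ### Box adding determines the representation -/

namespace TLFock

noncomputable section

/-! ### Representations that add boxes -/

/-- A family of operators that satisfies the relations of the generators and adds boxes. -/
structure AddsBoxes (t : ℤ → Module.End ℤ ParZ) : Prop where
  sq : ∀ q v, t q (t q v) = 0
  comm : ∀ p q, 1 < |p - q| → ∀ v, t p (t q v) = t q (t p v)
  up : ∀ q v, t q (t (q + 1) (t q v)) = t q v
  down : ∀ q v, t q (t (q - 1) (t q v)) = t q v
  bot : ∀ q, q ≠ 0 → t q (basisVec ⊥) = 0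
  add : ∀ q l m, AddsBox q l m → t q (basisVec l) = basisVec m

theorem IsBoxAdding.addsBoxes {R : ParRep} (h : IsBoxAdding R) : AddsBoxes fun q => R (T q) where
  sq q v := by rw [← Module.End.mul_apply, ← map_mul, T_sq]; simp
  comm p q hpq v := by
    rw [← Module.End.mul_apply, ← Module.End.mul_apply, ← map_mul, ← map_mul, T_comm hpq]
  up q v := by
    rw [← Module.End.mul_apply, ← Module.End.mul_apply, ← map_mul, ← map_mul, T_up]
  down q v := by
    rw [← Module.End.mul_apply, ← Module.End.mul_apply, ← map_mul, ← map_mul, T_down]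
  bot q hq := by rw [h.1, if_neg hq]
  add := h.2

variable {t : ℤ → Module.End ℤ ParZ}

theorem AddsBoxes.comm_of_ne (h : AddsBoxes t) {p q : ℤ} (h0 : p ≠ q) (h1 : p ≠ q - 1)
    (h2 : p ≠ q + 1) (v : ParZ) : t p (t q v) = t q (t p v) := by
  refine h.comm p q ?_ v
  rw [lt_abs]
  omega

theorem AddsBoxes.apply_of_removable (h : AddsBoxes t) {q : ℤ} {k l : YoungDiagram}
    (hk : AddsBox q k l) : t q (basisVec l) = 0 := by
  rw [← h.add q k l hk, h.sq]

/-- A corner of `l` has content other than q-1, q, q+1, so its generator commutes with T_q. Removing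
corners one by one leads to the empty partition. -/
theorem AddsBoxes.apply_of_far (h : AddsBoxes t) {q : ℤ} {l : YoungDiagram} (hq : q ≠ 0)
    (h1 : prof l (q - 1) = (q - 1).natAbs) (h2 : prof l q = q.natAbs)
    (h3 : prof l (q + 1) = (q + 1).natAbs) : t q (basisVec l) = 0 := by
  by_cases hl : l = ⊥
  · rw [hl, h.bot q hq]
  obtain ⟨p, m, hm, -⟩ := exists_addsBox_of_lt (bot_le (a := l)) (Ne.symm hl)
  have hcard := hm.card
  have hp := hm.prof_self
  have hp' := natAbs_le_prof m p
  have e1 : q ≠ p := by rintro rfl; omega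
  have e2 : q ≠ p - 1 := by rintro rfl; rw [sub_add_cancel] at h3; omega
  have e3 : q ≠ p + 1 := by rintro rfl; rw [add_sub_cancel_right] at h1; omega
  rw [← h.add p m l hm, h.comm_of_ne e1 e2 e3, h.apply_of_far hq, map_zero]
  · rw [← hm.prof_of_ne (by omega), h1]
  · rw [← hm.prof_of_ne (by omega), h2]
  · rw [← hm.prof_of_ne (by omega), h3]
termination_by l.card

theorem prof_linear {l : YoungDiagram} {q p : ℤ} (hqp : q ≤ p)
    (h : ∀ c, q ≤ c → c < p → prof l (c + 1) = prof l c + 1) : prof l p = prof l q + (p - q) := by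
  induction p, hqp using Int.leInduction with
  | base => simp
  | succ n hn ih =>
    rw [h n hn (by omega), ih fun c h1 h2 => h c h1 (by omega)]
    ring

/-- The value of `T_q` on a partition whose profile rises before and after `q`. -/
theorem AddsBoxes.apply_of_rise (h : AddsBoxes t) (n : ℕ) : ∀ (l : YoungDiagram) (q : ℤ),
    l.card = n → prof l (q - 1) = prof l q - 1 → prof l (q + 1) = prof l q + 1 →
    (∀ z m, q < z → prof l z = prof l q → (∀ c, q < c → c < z → prof l q < prof l c) →
      (∀ c, prof m c = prof l c - if q < c ∧ c < z then 2 else 0) →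
      t q (basisVec l) = basisVec m) ∧
    ((∀ z, q < z → prof l q < prof l z) → t q (basisVec l) = 0) := by
  induction n using Nat.strong_induction_on with
  | _ n ih =>
  intro l q hn hl hr
  -- A profile that rises from `q` on forever is already minimal near `q`.
  by_cases hdown : ∃ p, q ≤ p ∧ prof l (p + 1) = prof l p - 1
  swap
  · have hup : ∀ p, q ≤ p → prof l p = prof l q + (p - q) := fun p hp =>
      prof_linear hp fun c hc _ => (prof_step l c).resolve_right fun h' => hdown ⟨c, hc, h'⟩
    refine ⟨fun z m hz1 hz2 => ?_, fun _ => ?_⟩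
    · have := hup z hz1.le
      omega
    · obtain ⟨N, hN0, hN⟩ := exists_prof_eq_natAbs l
      have h1 := hup (max N q) (le_max_right _ _)
      have h2 := hN (max N q) (by omega)
      have h3 := natAbs_le_prof l q
      have h4 := natAbs_le_prof l (q - 1)
      exact h.apply_of_far (by omega) (by omega) (by omega) (by omega)
  obtain ⟨p, ⟨hqp, hp⟩, hleast⟩ := Int.exists_least_of_bdd
    (P := fun p => q ≤ p ∧ prof l (p + 1) = prof l p - 1) ⟨q, fun z hz => hz.1⟩ hdown
  have hqp' : q < p := by
    rcases hqp.lt_or_eq with h' | rfl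
    · exact h'
    · omega
  have hlin : ∀ c, q ≤ c → c ≤ p → prof l c = prof l q + (c - q) := fun c h1 h2 =>
    prof_linear h1 fun x hx hxc => (prof_step l x).resolve_right fun h' => by
      have := hleast x ⟨hx, h'⟩
      omega
  have hp1 := hlin p hqp le_rfl
  have hp2 := hlin (p - 1) (by omega) (by omega)
  obtain ⟨k, hk⟩ := exists_addsBox_iff'.mpr ⟨show prof l (p - 1) = prof l p - 1 by omega, hp⟩
  have hkcard := hk.card
  have hkp := hk.prof_self
  have hkne : ∀ c, c ≠ p → prof k c = prof l c := fun c hc => (hk.prof_of_ne hc).symm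
  have hk0 := hkne q (by omega)
  have hk1 := hkne (q - 1) (by omega)
  rw [← h.add p k l hk]
  -- For p = q+1 the partition `k` has a peak at `q`, so k = j ⊞ q and T_q T_{q+1} T_q j = T_q j =
  -- k: the hook is a single box.
  rcases (Int.add_one_le_of_lt hqp').eq_or_lt with rfl | hqp2
  · obtain ⟨j, hj⟩ := exists_addsBox_iff'.mpr
      ⟨show prof k (q - 1) = prof k q - 1 by omega, by omega⟩
    rw [← h.add q j k hj, h.up]
    refine ⟨fun z m hz1 hz2 hz3 hm => ?_, fun hz => ?_⟩
    · rw [h.add q j k hj]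
      have hz : z = q + 1 + 1 := by
        rcases lt_trichotomy z (q + 1 + 1) with h' | h' | h'
        · rw [show z = q + 1 by omega] at hz2
          omega
        · exact h'
        · have := hz3 (q + 1 + 1) (by omega) h'
          omega
      subst hz
      congr 1
      refine prof_injective (funext fun c => ?_)
      rw [hm]
      split_ifs with hc
      · obtain rfl : c = q + 1 := by omega
        omega
      · rw [sub_zero, hkne c (by omega)]
    · have := hz (q + 1 + 1) (by omega)
      omega
  have e0 := hkne (q + 1) (by omega)
  rw [h.comm_of_ne (by omega) (by omega) (by omega)]
  rcases (Int.add_one_le_of_lt hqp2).eq_or_lt with hqp3 | hqp3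
  -- For p = q+2, T_q removes the box of content q+1 from `k`. The result again rises through q+2,
  -- and T_{q+2} removes the rest of the hook, while the box at q+2 is missing already.
  · rw [show q + 1 + 1 = q + 2 by ring] at hqp3
    subst hqp3
    have e1 := hlin (q + 1) (by omega) (by omega)
    have e2 : q + 1 + 1 = q + 2 := by ring
    obtain ⟨j, hj⟩ := exists_addsBox_iff' (q := q + 1) (m := k).mpr
      ⟨by rw [add_sub_cancel_right]; omega, by rw [e2]; omega⟩
    have hjcard := hj.card
    have hjp := hj.prof_self
    have hjne : ∀ c, c ≠ q + 1 → prof j c = prof k c := fun c hc => (hj.prof_of_ne hc).symm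
    have e3 : t q (basisVec k) = basisVec j := by
      refine (ih k.card (by omega) k q rfl (by omega) (by omega)).1 (q + 2) j (by omega) (by omega)
        (fun c h1 h2 => ?_) fun c => ?_
      · rw [show c = q + 1 by omega]
        omega
      · split_ifs with hc
        · rw [show c = q + 1 by omega]
          omega
        · rw [sub_zero, hjne c (by omega)]
    rw [e3]
    have f1 := hjne (q + 2) (by omega)
    have f2 := hjne (q + 2 + 1) (by omega)
    have f3 := hkne (q + 2 + 1) (by omega)
    have f4 : q + 2 - 1 = q + 1 := by ring
    obtain ⟨i1, i2⟩ := ih j.card (by omega) j (q + 2) rfl (by rw [f4]; omega) (by omega)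
    refine ⟨fun z m hz1 hz2 hz3 hm => ?_, fun hz => ?_⟩
    · have hz4 : z ≠ q + 1 := by rintro rfl; omega
      have hz5 : z ≠ q + 2 := by rintro rfl; omega
      have hz6 : z ≠ q + 2 + 1 := by rintro rfl; omega
      refine i1 z m (by omega) ?_ (fun c h1 h2 => ?_) fun c => ?_
      · rw [hjne z hz4, hkne z hz5]
        omega
      · rw [hjne c (by omega), hkne c (by omega)]
        have := hz3 c (by omega) h2
        omega
      · rw [hm]
        rcases eq_or_ne c (q + 1) with rfl | c1
        · rw [if_pos (by omega), if_neg (by omega)]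
          omega
        rcases eq_or_ne c (q + 2) with rfl | c2
        · rw [if_pos (by omega), if_neg (by omega)]
          omega
        rw [hjne c c1, hkne c c2]
        split_ifs <;> omega
    · refine i2 fun z hz' => ?_
      rw [hjne z (by omega), hkne z (by omega)]
      have := hz z (by omega)
      omega
  · have e1 : prof k (q + 1) = prof k q + 1 := by omega
    obtain ⟨i1, i2⟩ := ih k.card (by omega) k q rfl (by omega) e1
    refine ⟨fun z m hz1 hz2 hz3 hm => ?_, fun hz => ?_⟩
    · have hzp : p + 1 < z := by
        by_contra! hcon
        rcases hcon.eq_or_lt with rfl | hcon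
        · omega
        · have := hlin z hz1.le (by omega)
          omega
      have m1 := hm (p - 1)
      have m2 := hm p
      have m3 := hm (p + 1)
      rw [if_pos (by omega)] at m1 m2 m3
      -- The arc is lowered as a whole, so `m` keeps the peak at `p`. T_q maps `k` to `m` without
      -- this box, and T_p puts it back.
      obtain ⟨m', hm'⟩ := exists_addsBox_iff'.mpr
        ⟨show prof m (p - 1) = prof m p - 1 by omega, by omega⟩
      rw [i1 z m' hz1 (by rw [hkne z (by omega)]; omega) (fun c h1 h2 => ?_) fun c => ?_,
        h.add p m' m hm']
      · rcases eq_or_ne c p with rfl | c1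
        · omega
        · rw [hkne c c1]
          have := hz3 c h1 h2
          omega
      · rcases eq_or_ne c p with rfl | c1
        · have := hm'.prof_self
          rw [if_pos (by omega)]
          omega
        · rw [← hm'.prof_of_ne c1, hkne c c1, hm]
    · rw [i2 fun z hz' => ?_, map_zero]
      rcases eq_or_ne z p with rfl | c1
      · omega
      · rw [hkne z c1]
        have := hz z hz'
        omega

theorem exists_return_or {l : YoungDiagram} {q : ℤ} (h0 : (q.natAbs : ℤ) < prof l q)
    (hr : prof l (q + 1) = prof l q + 1) :
    (∃ z m, q < z ∧ prof l z = prof l q ∧ (∀ c, q < c → c < z → prof l q < prof l c) ∧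
      ∀ c, prof m c = prof l c - if q < c ∧ c < z then 2 else 0) ∨
    ∀ z, q < z → prof l q < prof l z := by
  by_cases hex : ∃ z, q < z ∧ prof l z ≤ prof l q
  swap
  · push Not at hex
    exact Or.inr hex
  left
  obtain ⟨z, ⟨hz1, hz2⟩, hleast⟩ := Int.exists_least_of_bdd
    (P := fun z => q < z ∧ prof l z ≤ prof l q) ⟨q, fun z hz => hz.1.le⟩ hex
  have hbetween : ∀ c, q < c → c < z → prof l q < prof l c := fun c h1 h2 => by
    by_contra! hcon
    have := hleast c ⟨h1, hcon⟩
    omega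
  have hz3 : z ≠ q + 1 := by rintro rfl; omega
  have hz4 := hbetween (z - 1) (by omega) (by omega)
  have hz5 := prof_step' l z
  -- A profile touching its bound at c ≥ 0 could not come down at `z`; touching it at c ≤ 0 would
  -- make it minimal at `q`, against `h0`. By parity the arc can then be lowered by two.
  have hpos : ∀ c, q < c → c < z → prof l c ≠ c.natAbs := by
    intro c h1 h2 hc
    rcases le_total 0 c with h' | h'
    · have := prof_eq_natAbs_of_le hc h' h2.le
      have := prof_eq_natAbs_of_le (c := z - 1) hc h' (by omega)
      omega
    · have := prof_eq_natAbs_of_ge hc h' h1.le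
      omega
  obtain ⟨m, hm⟩ := exists_prof_eq_sub l (fun c => if q < c ∧ c < z then 1 else 0)
    (fun c => by
      have h1 := natAbs_le_prof l c
      split_ifs with hc
      · have := hpos c hc.1 hc.2
        have := prof_emod l c
        omega
      · omega)
    (fun c => by
      have h1 := prof_step l c
      rcases eq_or_ne c q with rfl | c1
      · rw [if_pos (by omega), if_neg (by omega)]
        omega
      rcases eq_or_ne c (z - 1) with rfl | c2
      · rw [sub_add_cancel, if_neg (by omega), if_pos (by omega)]
        omega
      split_ifs <;> omega)
    ⟨q.natAbs + z.natAbs + 1, fun c hc => if_neg (by omega)⟩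
  refine ⟨z, m, hz1, by omega, hbetween, fun c => ?_⟩
  rw [hm]
  split_ifs <;> omega

/-! ### Transposition -/

theorem prof_transpose (l : YoungDiagram) (c : ℤ) : prof l.transpose c = prof l (-c) := by
  refine prof_eq_of_mem_iff ?_ ?_ fun x hx => ?_
  · have := natAbs_le_prof l (-c)
    omega
  · have := prof_emod l (-c)
    omega
  · have h1 : content x.swap = -c := by rw [← hx]; simp [content]
    have h2 : anticontent x.swap = anticontent x := by simp [anticontent, add_comm]
    rw [YoungDiagram.mem_transpose, mem_iff_prof, h1, h2]

theorem AddsBox.transpose {q : ℤ} {l m : YoungDiagram} (h : AddsBox q l m) :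
    AddsBox (-q) l.transpose m.transpose := by
  rw [addsBox_iff] at *
  intro p
  rw [prof_transpose, prof_transpose, h]
  congr 2
  exact propext neg_eq_iff_eq_neg

theorem transpose_bot : (⊥ : YoungDiagram).transpose = ⊥ :=
  prof_injective (funext fun c => by rw [prof_transpose, prof_bot, prof_bot, Int.natAbs_neg])

/-- Transposition as a linear map. -/
def transposeMap : Module.End ℤ ParZ := Finsupp.lmapDomain ℤ ℤ YoungDiagram.transpose

theorem transposeMap_basisVec (l : YoungDiagram) :
    transposeMap (basisVec l) = basisVec l.transpose := by
  simp [transposeMap]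

theorem transposeMap_transposeMap (v : ParZ) : transposeMap (transposeMap v) = v := by
  have : transposeMap ∘ₗ transposeMap = LinearMap.id := by
    ext l : 2
    change transposeMap (transposeMap (basisVec l)) = basisVec l
    rw [transposeMap_basisVec, transposeMap_basisVec, YoungDiagram.transpose_transpose]
  exact LinearMap.congr_fun this v

/-- Negating the index exchanges the two cubic relations. Stating rigidity for families of operators
makes an automorphism of the algebra unnecessary here. -/
theorem AddsBoxes.transpose (h : AddsBoxes t) :
    AddsBoxes fun q => transposeMap * t (-q) * transposeMap where
  sq q v := by simp [transposeMap_transposeMap, h.sq]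
  comm p q hpq v := by
    have hpq' : 1 < |(-p) - (-q)| := by
      rwa [show -p - -q = -(p - q) by ring, abs_neg]
    simp [transposeMap_transposeMap, h.comm _ _ hpq']
  up q v := by
    have := h.down (-q)
    rw [show -q - 1 = -(q + 1) by ring] at this
    simp only [Module.End.mul_apply, transposeMap_transposeMap, this]
  down q v := by
    have := h.up (-q)
    rw [show -q + 1 = -(q - 1) by ring] at this
    simp only [Module.End.mul_apply, transposeMap_transposeMap, this]
  bot q hq := by
    simp only [Module.End.mul_apply, transposeMap_basisVec, transpose_bot]
    rw [h.bot _ (by omega), map_zero]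
  add q l m hm := by
    simp only [Module.End.mul_apply, transposeMap_basisVec]
    rw [h.add _ _ _ hm.transpose, transposeMap_basisVec, YoungDiagram.transpose_transpose]

/-- The value of `T_q` on a partition whose profile falls before and after `q`. -/
theorem AddsBoxes.apply_of_fall (h : AddsBoxes t) {l : YoungDiagram} {q : ℤ}
    (hl : prof l (q - 1) = prof l q + 1) (hr : prof l (q + 1) = prof l q - 1) :
    (∀ z m, z < q → prof l z = prof l q → (∀ c, z < c → c < q → prof l q < prof l c) →
      (∀ c, prof m c = prof l c - if z < c ∧ c < q then 2 else 0) →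
      t q (basisVec l) = basisVec m) ∧
    ((∀ z, z < q → prof l q < prof l z) → t q (basisVec l) = 0) := by
  have e1 : -(-q - 1) = q + 1 := by ring
  have e2 : -(-q + 1) = q - 1 := by ring
  obtain ⟨i1, i2⟩ := h.transpose.apply_of_rise _ l.transpose (-q) rfl
    (by rw [prof_transpose, prof_transpose, neg_neg, e1, hr])
    (by rw [prof_transpose, prof_transpose, neg_neg, e2, hl])
  have key : t q (basisVec l) = transposeMap ((transposeMap * t (-(-q)) * transposeMap)
      (basisVec l.transpose)) := by
    simp only [Module.End.mul_apply, transposeMap_basisVec, transposeMap_transposeMap,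
      YoungDiagram.transpose_transpose, neg_neg]
  simp only [prof_transpose, neg_neg] at i1 i2
  refine ⟨fun z m h1 h2 h3 h4 => ?_, fun h1 => ?_⟩
  · rw [key, neg_neg, i1 (-z) m.transpose (by omega) (by rwa [neg_neg])
      (fun c h5 h6 => h3 (-c) (by omega) (by omega)) fun c => ?_, transposeMap_basisVec,
      YoungDiagram.transpose_transpose]
    rw [prof_transpose, h4]
    split_ifs <;> omega
  · rw [key, neg_neg, i2 fun z hz => h1 (-z) (by omega), map_zero]

theorem exists_return_or' {l : YoungDiagram} {q : ℤ} (h0 : (q.natAbs : ℤ) < prof l q)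
    (hl : prof l (q - 1) = prof l q + 1) :
    (∃ z m, z < q ∧ prof l z = prof l q ∧ (∀ c, z < c → c < q → prof l q < prof l c) ∧
      ∀ c, prof m c = prof l c - if z < c ∧ c < q then 2 else 0) ∨
    ∀ z, z < q → prof l q < prof l z := by
  have e2 : -(-q + 1) = q - 1 := by ring
  have := exists_return_or (l := l.transpose) (q := -q)
    (by rw [prof_transpose, neg_neg, Int.natAbs_neg]; exact h0)
    (by rw [prof_transpose, prof_transpose, neg_neg, e2, hl])
  simp only [prof_transpose, neg_neg] at this
  rcases this with ⟨z, m, h1, h2, h3, h4⟩ | h1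
  · refine Or.inl ⟨-z, m.transpose, by omega, h2, fun c h5 h6 => ?_, fun c => ?_⟩
    · simpa using h3 (-c) (by omega) (by omega)
    · rw [prof_transpose, h4, neg_neg]
      split_ifs <;> omega
  · exact Or.inr fun z hz => by simpa using h1 (-z) (by omega)

/-! ### Balanced rim hooks with given end -/

theorem IsStrip.endsAt {S : Finset (ℕ × ℕ)} {a : ℤ → ℤ} {s t : ℤ} (h : IsStrip S a s t) :
    EndsAt t S :=
  ⟨h.exists_mem t h.le le_rfl, fun x hx => ((h.mem_iff x).mp hx).1.2⟩

theorem EndsAt.unique {S : Finset (ℕ × ℕ)} {q q' : ℤ} (h : EndsAt q S) (h' : EndsAt q' S) :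
    q = q' := by
  obtain ⟨⟨x, hx, rfl⟩, h1⟩ := h
  obtain ⟨⟨y, hy, rfl⟩, h2⟩ := h'
  exact le_antisymm (h2 x hx) (h1 y hy)

theorem balancedTo_iff {q : ℤ} {l : YoungDiagram} {H : Finset (ℕ × ℕ)} :
    BalancedTo q l H ↔ ∃ s m, s ≤ q ∧ prof l s = prof l q ∧ H = l.cells \ m.cells ∧
      ∀ c, prof m c = prof l c - if s ≤ c ∧ c ≤ q then 2 else 0 := by
  constructor
  · rintro ⟨h1, h2, h3⟩
    obtain ⟨s, t, hst, m, hm, hprof⟩ := h1.exists_isStrip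
    obtain rfl := h3.unique hst.endsAt
    have h4 := hst.width_sub_height (unitSteps_prof_sub l 2)
    refine ⟨s, m, hst.le, by omega, ?_, hprof⟩
    rw [hm, Finset.sdiff_sdiff_eq_self h1.2.1]
  · rintro ⟨s, m, h1, h2, rfl, h3⟩
    obtain ⟨h4, h5⟩ := exists_isRimHook h1 h3
    have h6 := h5.width_sub_height (unitSteps_prof_sub l 2)
    exact ⟨h4, by omega, h5.endsAt⟩

theorem removesMinimal_of_return' {q z : ℤ} {l m : YoungDiagram} (hqz : z < q)
    (hup : prof l (q - 1) = prof l q + 1) (hz : prof l z = prof l q)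
    (hbetween : ∀ c, z < c → c < q → prof l q < prof l c)
    (hm : ∀ c, prof m c = prof l c - if z < c ∧ c < q then 2 else 0) :
    RemovesMinimal (BalancedTo (q - 1) l) l (basisVec m) := by
  have hz1 : z ≠ q - 1 := by rintro rfl; omega
  have hm' : ∀ c, prof m c = prof l c - if z + 1 ≤ c ∧ c ≤ q - 1 then 2 else 0 := fun c => by
    rw [hm]
    split_ifs <;> omega
  have hle : m ≤ l := prof_le_iff.mpr fun c => by
    rw [hm]
    split_ifs <;> omega
  have hP : BalancedTo (q - 1) l (l.cells \ m.cells) := by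
    refine balancedTo_iff.mpr ⟨z + 1, m, by omega, ?_, rfl, hm'⟩
    have h1 := prof_step l z
    have h2 := hbetween (z + 1) (by omega) (by omega)
    omega
  have hleast : ∀ H, BalancedTo (q - 1) l H → l.cells \ m.cells ⊆ H := by
    intro H hH
    obtain ⟨s, m', h1, h2, rfl, h3⟩ := balancedTo_iff.mp hH
    have h4 : prof l (s - 1) = prof l q := by
      have a1 := h3 s
      have a2 := h3 (s - 1)
      have a3 := prof_step' l s
      have a4 := prof_step' m' s
      rw [if_pos (by omega)] at a1
      rw [if_neg (by omega)] at a2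
      omega
    have h5 : s - 1 ≤ z := by
      by_contra! hlt
      have := hbetween (s - 1) hlt (by omega)
      omega
    refine Finset.sdiff_subset_sdiff le_rfl ?_
    refine prof_le_iff.mpr fun c => ?_
    rw [h3, hm]
    split_ifs <;> omega
  refine Or.inl ⟨l.cells \ m.cells, ⟨hP, fun H hH _ => hleast H hH⟩, fun H hH => ?_, m, ?_, rfl⟩
  · exact le_antisymm (hH.2 hP (hleast H hH.1)) (hleast H hH.1)
  · rw [Finset.sdiff_sdiff_eq_self hle]

theorem removesMinimal_of_no_return' {q : ℤ} {l : YoungDiagram}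
    (hup : prof l (q - 1) = prof l q + 1) (hz : ∀ z, z < q → prof l z ≠ prof l q) :
    RemovesMinimal (BalancedTo (q - 1) l) l 0 := by
  refine Or.inr ⟨?_, rfl⟩
  rintro ⟨H, hH⟩
  obtain ⟨s, m', h1, h2, rfl, h3⟩ := balancedTo_iff.mp hH
  refine hz (s - 1) (by omega) ?_
  have a1 := h3 s
  have a2 := h3 (s - 1)
  have a3 := prof_step' l s
  have a4 := prof_step' m' s
  rw [if_pos (by omega)] at a1
  rw [if_neg (by omega)] at a2
  omega

theorem IsBoxAdding.hasRimHookValues {R : ParRep} (h : IsBoxAdding R) : HasRimHookValues R := by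
  have ht := h.addsBoxes
  refine fun q l => ⟨?_, fun hd => ?_, fun he => ?_⟩
  · rintro (⟨k, hk⟩ | hc)
    · exact ht.apply_of_removable hk
    · rw [hasType_c_iff] at hc
      exact ht.apply_of_far hc.1 hc.2.1 hc.2.2.1 hc.2.2.2
  · rw [hasType_d_iff] at hd
    obtain ⟨i1, i2⟩ := ht.apply_of_rise _ l q rfl hd.2.2 hd.2.1
    rcases exists_return_or hd.1 hd.2.1 with ⟨z, m, h1, h2, h3, h4⟩ | h1
    · rw [show R (T q) (basisVec l) = basisVec m from i1 z m h1 h2 h3 h4]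
      exact removesMinimal_of_return h1 hd.2.1 h2 h3 h4
    · rw [show R (T q) (basisVec l) = 0 from i2 h1]
      exact removesMinimal_of_no_return hd.2.1 fun z hz => (h1 z hz).ne'
  · rw [hasType_e_iff] at he
    obtain ⟨i1, i2⟩ := ht.apply_of_fall he.2.2 he.2.1
    rcases exists_return_or' he.1 he.2.2 with ⟨z, m, h1, h2, h3, h4⟩ | h1
    · rw [show R (T q) (basisVec l) = basisVec m from i1 z m h1 h2 h3 h4]
      exact removesMinimal_of_return' h1 he.2.2 h2 h3 h4
    · rw [show R (T q) (basisVec l) = 0 from i2 h1]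
      exact removesMinimal_of_no_return' he.2.2 fun z hz => (h1 z hz).ne'

theorem RemovesMinimal.unique {P : Finset (ℕ × ℕ) → Prop} {l : YoungDiagram} {v w : ParZ}
    (hv : RemovesMinimal P l v) (hw : RemovesMinimal P l w) : v = w := by
  rcases hv with ⟨H, h1, h2, m, h3, rfl⟩ | ⟨h1, rfl⟩ <;>
    rcases hw with ⟨H', h1', h2', m', h3', rfl⟩ | ⟨h1', rfl⟩
  · rw [h2' H h1, ← h3'] at h3
    rw [YoungDiagram.ext h3]
  · exact absurd ⟨H, h1.1⟩ h1'
  · exact absurd ⟨H', h1'.1⟩ h1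
  · rfl

theorem IsBoxAdding.unique {R R' : ParRep} (h : IsBoxAdding R) (h' : IsBoxAdding R') : R = R' := by
  refine rep_hom_ext fun q l => ?_
  obtain ⟨c1, d1, e1⟩ := h.hasRimHookValues q l
  obtain ⟨c2, d2, e2⟩ := h'.hasRimHookValues q l
  obtain ⟨τ, hτ, -⟩ := existsUnique_hasType q l
  cases τ with
  | a =>
    obtain ⟨m, hm⟩ := hτ
    rw [h.2 q l m hm, h'.2 q l m hm]
  | b => rw [c1 (Or.inl hτ), c2 (Or.inl hτ)]
  | c => rw [c1 (Or.inr hτ), c2 (Or.inr hτ)]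
  | d => exact (d1 hτ).unique (d2 hτ)
  | e => exact (e1 hτ).unique (e2 hτ)

end

end TLFock

/-! ### The automorphism given by c intertwines box adding with Fock space -/

namespace TLFock

noncomputable section

/-! ### The intertwiner -/

theorem gam_zero (G : ℤ → ℤ) {d : ℤ → ℤ} (hd : ∀ c, d c = 0) : Gam G d := by
  refine ⟨fun c => (hd c).ge, fun s z he => ?_⟩
  have := he.2.1
  rw [hd, hd] at this
  exact absurd this (lt_irrefl _)

theorem isGamma_self (l : YoungDiagram) : IsGamma l l :=
  isGamma_iff.mpr (gam_zero _ fun c => by simp [profDiff])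

theorem cMat_self (l : YoungDiagram) : cMat l l = 1 := if_pos (isGamma_self l)

theorem le_of_cMat_ne_zero {l m : YoungDiagram} (h : cMat l m ≠ 0) : m ≤ l := by
  by_contra hle
  exact h (if_neg fun hg => hle hg.1)

theorem finite_le (l : YoungDiagram) : {m : YoungDiagram | m ≤ l}.Finite := by
  refine ((Finset.finite_toSet l.cells.powerset).preimage (f := YoungDiagram.cells)
    (fun _ _ _ _ h => YoungDiagram.ext h)).subset fun m hm => ?_
  simpa using hm

/-- The rows of the matrix `c`. -/
def cRow (l : YoungDiagram) : ParZ :=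
  Finsupp.ofSupportFinite (cMat l) ((finite_le l).subset fun _ hm => le_of_cMat_ne_zero hm)

theorem cRow_apply (l m : YoungDiagram) : cRow l m = cMat l m := rfl

/-- The linear map with matrix `c`. -/
def cOp : Module.End ℤ ParZ := Finsupp.linearCombination ℤ cRow

theorem cOp_basisVec (l : YoungDiagram) : cOp (basisVec l) = cRow l := by
  simp [cOp]

theorem card_lt_of_le_of_ne {l m : YoungDiagram} (h : m ≤ l) (hne : m ≠ l) : m.card < l.card :=
  Finset.card_lt_card (Finset.ssubset_iff_subset_ne.mpr ⟨h, fun e => hne (YoungDiagram.ext e)⟩)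

theorem mem_of_forall_basisVec_mem {p : Submodule ℤ ParZ} (v : ParZ)
    (h : ∀ m, v m ≠ 0 → basisVec m ∈ p) : v ∈ p := by
  rw [← Finsupp.sum_single v]
  refine Submodule.sum_mem _ fun m hm => ?_
  have e : Finsupp.single m (v m) = v m • basisVec m := by simp
  rw [e]
  exact Submodule.smul_mem _ _ (h m (Finsupp.mem_support_iff.mp hm))

/-- The row of `l` is `l` plus a combination of smaller partitions, so induction on the size
applies. -/
theorem basisVec_mem_range_cOp (l : YoungDiagram) : basisVec l ∈ LinearMap.range cOp := by
  have h1 : cRow l - basisVec l ∈ LinearMap.range cOp := by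
    refine mem_of_forall_basisVec_mem _ fun m hm => ?_
    have hml : m ≠ l := by
      rintro rfl
      simp [cRow_apply, cMat_self] at hm
    rw [Finsupp.sub_apply, basisVec, Finsupp.single_eq_of_ne hml, sub_zero] at hm
    have := card_lt_of_le_of_ne (le_of_cMat_ne_zero hm) hml
    exact basisVec_mem_range_cOp m
  have h2 : cRow l ∈ LinearMap.range cOp := ⟨basisVec l, cOp_basisVec l⟩
  simpa using sub_mem h2 h1
termination_by l.card

theorem cOp_surjective : Function.Surjective cOp := fun v =>
  mem_of_forall_basisVec_mem (p := LinearMap.range cOp) v fun m _ => basisVec_mem_range_cOp m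

/-- No other partition in the support contributes to the coefficient of one of maximal size. -/
theorem cOp_injective : Function.Injective cOp := by
  rw [injective_iff_map_eq_zero]
  intro v hv
  by_contra hne
  obtain ⟨l, hl, hmax⟩ := v.support.exists_max_image YoungDiagram.card
    (Finsupp.support_nonempty_iff.mpr hne)
  have h1 : cOp v l = v l := by
    rw [cOp, Finsupp.linearCombination_apply, Finsupp.sum, Finsupp.finsetSum_apply,
      Finset.sum_eq_single l]
    · simp [cRow_apply, cMat_self]
    · intro m hm hml
      rw [Finsupp.smul_apply, cRow_apply]
      by_contra h
      have := card_lt_of_le_of_ne (le_of_cMat_ne_zero (right_ne_zero_of_smul h)) hml.symm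
      have := hmax m hm
      omega
    · exact fun h => absurd hl h
  rw [hv] at h1
  exact Finsupp.mem_support_iff.mp hl h1.symm

/-- The automorphism with matrix `c`. -/
def cEquiv : ParZ ≃ₗ[ℤ] ParZ := LinearEquiv.ofBijective cOp ⟨cOp_injective, cOp_surjective⟩

theorem cEquiv_basisVec (l : YoungDiagram) : cEquiv (basisVec l) = cRow l := cOp_basisVec l

theorem cRow_bot : cRow ⊥ = basisVec ⊥ := by
  ext m
  rw [cRow_apply]
  rcases eq_or_ne m ⊥ with rfl | h
  · simp [cMat_self]
  · rw [basisVec, Finsupp.single_eq_of_ne h]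
    by_contra h'
    exact h (le_bot_iff.mp (le_of_cMat_ne_zero h'))

open scoped Classical in
theorem cMat_eq (l m : YoungDiagram) :
    cMat l m = if Gam (prof l) (profDiff l m) then 1 else 0 := by
  unfold cMat
  simp only [isGamma_iff]

/-- The Fock space operator of `T_q` maps the row of `l` to the row of `l ⊞ q`. -/
theorem fockOp_cRow {q : ℤ} {l l' : YoungDiagram} (h : AddsBox q l l') :
    fockOp q (cRow l) = cRow l' := by
  classical
  ext m
  rw [fockOp_apply]
  simp only [cRow_apply, cMat_eq]
  have hp' := pathPair_prof l' m
  have hq := h.prof_self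
  have hne : ∀ c, c ≠ q → prof l' c = prof l c := fun c hc => h.prof_of_ne hc
  obtain ⟨t1, t2⟩ := exists_addsBox_iff'.mp ⟨l, h⟩
  have t1' : prof l' q = prof l' (q - 1) + 1 := by omega
  have dq := hp'.diff q
  have dq1 := hp'.diff (q - 1)
  have dq2 := hp'.diff (q + 1)
  have s1 := prof_step' m q
  have s2 := prof_step m q
  have s3 := prof_step' m (q - 1)
  have e1 : q - 1 - 1 = q - 2 := by ring
  rw [e1] at s3
  have x1 : (∃ k, AddsBox q k m) ↔ _ := exists_addsBox_iff'
  have x2 : (∃ k, AddsBox (q - 1) m k) ↔ _ := exists_addsBox_iff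
  rw [e1, sub_add_cancel] at x2
  have d1 : ∀ k, AddsBox q k m → profDiff l k = profDiff l' m := by
    intro k hk
    funext c
    have a1 := addsBox_iff.mp hk c
    have a2 := addsBox_iff.mp h c
    unfold profDiff
    rw [a1, a2]
    split_ifs <;> ring_nf
  have d2 : ∀ k, AddsBox (q - 1) m k → profDiff l k q = profDiff l' m q - 1 ∧
      profDiff l k (q - 1) = profDiff l' m (q - 1) - 1 ∧
      ∀ c, c ≠ q → c ≠ q - 1 → profDiff l k c = profDiff l' m c := by
    intro k hk
    refine ⟨?_, ?_, fun c c1 c2 => ?_⟩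
    · have a1 := hk.prof_of_ne (p := q) (by omega)
      have a2 := (pathPair_prof l k).diff q
      omega
    · have a1 := hk.prof_self
      have a2 := (pathPair_prof l k).diff (q - 1)
      have a3 := hne (q - 1) (by omega)
      omega
    · unfold profDiff
      rw [hk.prof_of_ne c2, hne c c1]
  -- The steps of `prof m` into q-1, q and q+1 decide whether m ⊟ q and m ⊞ (q-1) exist. A fall into
  -- `q` excludes both, and then the right-hand side vanishes too.
  rcases s1 with s1 | s1
  swap
  · rw [dif_neg (by rw [x1]; omega), dif_neg (by rw [x2]; omega),
      if_neg (not_gam_of_fall hp' t1' t2 s1), add_zero]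
  rcases s2 with s2 | s2
  · rw [dif_neg (by rw [x1]; omega)]
    rcases s3 with s3 | s3
    · rw [dif_neg (by rw [x2]; omega),
        if_neg (not_gam_of_rise hp' t1' t2 (by omega) (by omega) s3), add_zero]
    · have hk2 := x2.mpr (by omega)
      obtain ⟨b1, b2, b3⟩ := d2 _ hk2.choose_spec
      rw [dif_pos hk2, zero_add]
      simp only [gam_iff_of_rise hp' hq hne t1' t2 (by omega) (by omega) b1 b2 b3 s3]
  · have hk1 := x1.mpr (by omega)
    have c1 := d1 _ hk1.choose_spec
    have hd : profDiff l' m (q - 1) = profDiff l' m q := by omega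
    have hd1 : profDiff l' m (q + 1) = profDiff l' m q := by omega
    rw [dif_pos hk1, c1]
    rcases s3 with s3 | s3
    · rw [dif_neg (by rw [x2]; omega), add_zero]
      -- Only m ⊟ q contributes. Failure for `l` alone would need an excursion in which `prof l'` is
      -- at its initial height at q-1, and this forces `prof m` to fall into q-1.
      have : Gam (prof l) (profDiff l' m) ↔ Gam (prof l') (profDiff l' m) := by
        refine ⟨Gam.raise hq hne hd, fun hg' => ?_⟩
        by_contra hg
        obtain ⟨s, z, he, hs, hz, hG⟩ := exists_exc_of_not_gam hp' hq hne t1' t2 hd hg' hg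
        have hsq : s ≠ q - 1 := by
          rintro rfl
          have := (hp'.rise he.2.1).2.1
          rw [e1] at this
          omega
        have := (hg'.step_eq hp' he (p := q - 1) (by omega) (by omega) hG).2
        rw [e1] at this
        omega
      simp only [this]
    · have hk2 := x2.mpr (by omega)
      obtain ⟨b1, b2, b3⟩ := d2 _ hk2.choose_spec
      have hp := pathPair_prof l hk2.choose
      rw [dif_pos hk2]
      -- Both partitions exist here. Their conditions exclude each other, and together they exhaust
      -- the condition for `l'`: either `prof l` returns along all excursions, or the offending one
      -- is cut by adding the (q-1)-box to `m`.
      have key1 : Gam (prof l) (profDiff l hk2.choose) →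
          Gam (prof l') (profDiff l' m) ∧ ¬ Gam (prof l) (profDiff l' m) :=
        Gam.raise_of_lower hp' hp hq hne t1' t2 hd hd1 b1 b2 b3 s3
      have key2 : Gam (prof l) (profDiff l' m) → Gam (prof l') (profDiff l' m) :=
        Gam.raise hq hne hd
      have key3 : Gam (prof l') (profDiff l' m) → ¬ Gam (prof l) (profDiff l' m) →
          Gam (prof l) (profDiff l hk2.choose) := fun hg' hg => by
        obtain ⟨s, z, he, hs, hz, hG⟩ := exists_exc_of_not_gam hp' hq hne t1' t2 hd hg' hg
        exact (hg'.lower_of_peak hp' hq hne t1' t2 hd hd1 b1 b2 b3 he hs hz hG).2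
      by_cases g1 : Gam (prof l) (profDiff l hk2.choose)
      · rw [if_neg (key1 g1).2, if_pos g1, if_pos (key1 g1).1, zero_add]
      by_cases g2 : Gam (prof l) (profDiff l' m)
      · rw [if_pos g2, if_neg g1, if_pos (key2 g2), add_zero]
      · rw [if_neg g2, if_neg g1, if_neg fun g => g1 (key3 g g2), add_zero]

/-- The representation obtained from Fock space by conjugation with the automorphism `c`. -/
def twistRep : ParRep := (LinearEquiv.conjAlgEquiv ℤ cEquiv.symm).toAlgHom.comp fockRep

theorem twistRep_apply (x : TLInf) (v : ParZ) :
    twistRep x v = cEquiv.symm (fockRep x (cEquiv v)) := by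
  simp [twistRep]

theorem twistRep_of_addsBox {q : ℤ} {l m : YoungDiagram} (h : AddsBox q l m) :
    twistRep (T q) (basisVec l) = basisVec m := by
  rw [twistRep_apply, LinearEquiv.symm_apply_eq, cEquiv_basisVec, cEquiv_basisVec, fockRep_T,
    fockOp_cRow h]

theorem isBoxAdding_twistRep : IsBoxAdding twistRep := by
  refine ⟨fun q => ?_, fun q l m h => twistRep_of_addsBox h⟩
  split_ifs with hq
  · rw [hq, twistRep_of_addsBox addsBox_bot_box]
  · rw [twistRep_apply, LinearEquiv.symm_apply_eq, cEquiv_basisVec, cRow_bot, fockRep_T,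
      fockOp_basisVec, map_zero, addVec, dif_neg, remVec, dif_neg, add_zero]
    · rintro ⟨m, hm⟩
      have := hm.prof_self
      have := natAbs_le_prof m (q - 1)
      rw [prof_bot] at *
      omega
    · rw [exists_addsBox_iff]
      simp only [prof_bot]
      omega

theorem twistRep_injective : Function.Injective twistRep := by
  intro x y hxy
  refine fockRep_injective (LinearMap.ext fun v => ?_)
  have := LinearMap.congr_fun hxy (cEquiv.symm v)
  rwa [twistRep_apply, twistRep_apply, cEquiv.apply_symm_apply, EmbeddingLike.apply_eq_iff_eq]
    at this

end

end TLFock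

open TLFock
theorem mainTheorem6 :
    -- the five types are exhaustive and mutually exclusive
    (∀ (q : ℤ) (l : YoungDiagram), ∃! t : Config, HasType q l t) ∧
    -- every representation with the two box-adding properties has the other values listed
    (∀ R : ParRep, IsBoxAdding R → HasRimHookValues R) ∧
    -- existence and uniqueness, the realisation as a twist, and faithfulness
    ∃ (Xi Xi' : ParRep) (C : ParZ ≃ₗ[ℤ] ParZ),
      (IsBoxAdding Xi ∧ ∀ R : ParRep, IsBoxAdding R → R = Xi) ∧
      (IsFock Xi' ∧ ∀ R : ParRep, IsFock R → R = Xi') ∧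
      (∀ l m : YoungDiagram, C (basisVec l) m = cMat l m) ∧
      (∀ (x : TLInf) (v : ParZ), Xi x v = C.symm (Xi' x (C v))) ∧
      Function.Injective Xi ∧ Function.Injective Xi' :=
  ⟨existsUnique_hasType, fun _ h => h.hasRimHookValues, twistRep, fockRep, cEquiv,
    ⟨isBoxAdding_twistRep, fun _ h => h.unique isBoxAdding_twistRep⟩,
    ⟨isFock_fockRep, fun _ h => h.unique⟩,
    fun l m => by rw [cEquiv_basisVec, cRow_apply], twistRep_apply, twistRep_injective,
    fockRep_injective⟩
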